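/- Let $d\ge 1$ and $k$ be integers, $k\ge 0$. For a finite cloud $S$ of points of $\mathbb R^d$, the $k$-nearest neighbour graph of $S$ joins each $x\in S$ to the $k$ points of $S\setminus\{x\}$ closest to $x$ (to all other points if there are fewer than $k$ of them); it is taken either as a directed graph, or as an undirected graph in which two points are joined by one edge as soon as one of them is among the $k$ nearest neighbours of the other. (Points tied in distance are all included: $y$ is a neighbour of $x$ when fewer than $k$ points of $S\setminus\{x\}$ are strictly closer to $x$ than $y$; for samples from distributions with a density, ties have probability $0$.) Let $l_{\mathrm{NN},k}(S)$ be the sum of the Euclidean lengths of its edges. The following holds for each of the two conventions. For $\gamma>0$, $r_0>0$ and a bounded set $C\subset\mathbb R^d$, let $\mathcal D_{\gamma,r_0}(C)$ be the class of probability distributions $\mu$ on $\mathbb R^d$ that are concentrated on $C$ (i.e. $\mu(\mathbb R^d\setminus C)=0$) and satisfy $\mu(B_x(r))\ge\gamma r^d$ for all $x\in C$ and all $0<r\le r_0$, where $B_x(r)$ is the closed ball of radius $r$ about $x$. Let $p\in(2,\infty]$, and let $F\in\mathcal D_{\gamma,r_0}(C)$ have a Lebesgue density $f$ with $\|f\|_p<\infty$.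 Let $X_1,X_2,\dots$ be i.i.d. with law $F$ and $\mathbf X_n=\{X_1,\dots,X_n\}$. For each $n$ let $\hat F_n$ be a probability distribution on $\mathbb R^d$ with Lebesgue density $\hat f_n$, each a (measurable) function of the sample $\mathbf X_n$. Let $(m_n)$ be positive integers with $m_n\to\infty$, and, conditionally on $\mathbf X_n$, let $\mathbf X^*_{m_n}$ be an i.i.d. sample of size $m_n$ from $\hat F_n$. Suppose that $$\|\hat f_n-f\|_1\to0,\qquad \|\hat f_n-f\|_p\to0,\qquad \mathbf 1\{\hat F_n\in\mathcal D_{\gamma,r_0}(C)\}\to1$$ in probability (resp. almost surely). Then, for every probability distribution $G$ on $\mathbb R$, $$\frac1{\sqrt n}\Bigl(l_{\mathrm{NN},k}(\sqrt[d]{n}\,\mathbf X_n)-\mathbb E\bigl[l_{\mathrm{NN},k}(\sqrt[d]{n}\,\mathbf X_n)\bigr]\Bigr)\xrightarrow{d}G$$ if and only if $$\frac1{\sqrt{m_n}}\Bigl(l_{\mathrm{NN},k}(\sqrt[d]{m_n}\,\mathbf X^*_{m_n})-\mathbb E\bigl[l_{\mathrm{NN},k}(\sqrt[d]{m_n}\,\mathbf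 X^*_{m_n})\,\big|\,\mathbf X_n\bigr]\Bigr)\xrightarrow{d}G\quad\text{in probability (resp. almost surely)}.$$ Here the second convergence is that of the conditional law given $\mathbf X_n$: almost surely means that for almost every realization of the data these conditional laws converge weakly to $G$; in probability means that for every bounded continuous $v:\mathbb R\to\mathbb R$ the conditional expectation of $v$ at the bootstrap statistic converges in probability to $\int v\,dG$. -/

import Mathlib

open MeasureTheory ProbabilityTheory Filter Topology
open scoped ENNReal BoundedContinuousFunction

namespace KnnBootstrap

/-- Euclidean space of dimension `d`. -/
abbrev Pt (d : ℕ) : Type := EuclideanSpace ℝ (Fin d)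

/-- In the point cloud `x 0, …, x (n - 1)`, the point with label `j` is one of the `k` nearest
neighbours of the point with label `i`: it is another point of the cloud, and fewer than `k` of the
points other than `i` are strictly closer to `x i`. When the distances from `x i` to the other
points are distinct (which holds almost surely for samples from a distribution with a density),
these are exactly the `k` closest points, or all other points if there are fewer than `k` of them.
The relation does not depend on the labelling of the cloud. -/
def IsNearestNeighbor {d n : ℕ} (k : ℕ) (x : Fin n → Pt d) (i j : Fin n) : Prop :=
  j ≠ i ∧ {l : Fin n | l ≠ i ∧ dist (x i) (x l) < dist (x i) (x j)}.ncard < k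

/-- The two conventions for the `k`-nearest neighbour graph. -/
inductive GraphKind
  | directed
  | undirected

open Classical in
/-- The total edge length of the `k`-nearest neighbour graph of the point cloud `x`. In the directed
graph there is an edge from `i` to `j` when `j` is one of the `k` nearest neighbours of `i`. In the
undirected graph `i` and `j` are joined by one edge when at least one of them is among the `k`
nearest neighbours of the other; each unordered pair is counted once. -/
noncomputable def totalLength {d n : ℕ} (κ : GraphKind) (k : ℕ) (x : Fin n → Pt d) : ℝ :=
  match κ with
  | .directed =>
      ∑ i : Fin n, ∑ j : Fin n, if IsNearestNeighbor k x i j then dist (x i) (x j) else 0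
  | .undirected =>
      ∑ i : Fin n, ∑ j : Fin n,
        if i < j ∧ (IsNearestNeighbor k x i j ∨ IsNearestNeighbor k x j i)
        then dist (x i) (x j) else 0

/-- The total edge length of the `k`-nearest neighbour graph of the cloud `n ^ (1 / d) • x` of `n`
points. -/
noncomputable def scaledLength {d n : ℕ} (κ : GraphKind) (k : ℕ) (x : Fin n → Pt d) : ℝ :=
  totalLength κ k (fun i => ((n : ℝ) ^ ((1 : ℝ) / (d : ℝ))) • x i)

/-- The standardization `n ^ (-1 / 2) * (Y - 𝔼 Y)` of a random variable `Y`. -/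
noncomputable def standardize {Ω : Type*} [MeasurableSpace Ω] (P : Measure Ω) (n : ℕ)
    (Y : Ω → ℝ) (ω : Ω) : ℝ :=
  1 / √(n : ℝ) * (Y ω - ∫ ω', Y ω' ∂P)

/-- The law of an i.i.d. sample of size `m` from the distribution `μ`. -/
noncomputable abbrev sampleLaw {d : ℕ} (m : ℕ) (μ : ProbabilityMeasure (Pt d)) :
    Measure (Fin m → Pt d) :=
  Measure.pi (fun _ => (μ : Measure (Pt d)))

/-- The standardized total length of the `k`-nearest neighbour graph, as a random variable on the
space of samples of size `m` from `μ`. -/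
noncomputable def standardizedLength {d : ℕ} (κ : GraphKind) (k m : ℕ)
    (μ : ProbabilityMeasure (Pt d)) : (Fin m → Pt d) → ℝ :=
  standardize (sampleLaw m μ) m (scaledLength κ k)

/-- `f` is a density of the probability distribution `μ` with respect to Lebesgue measure. -/
def HasDensity {d : ℕ} (μ : ProbabilityMeasure (Pt d)) (f : Pt d → ℝ) : Prop :=
  Measurable f ∧ (∀ x, 0 ≤ f x) ∧
    (μ : Measure (Pt d)) = volume.withDensity (fun x => ENNReal.ofReal (f x))

/-- The class of probability distributions on `ℝ ^ d` that are concentrated on `C` and give mass at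
least `γ * r ^ d` to every closed ball of radius `r ≤ r₀` centred at a point of `C`. -/
def ballMassClass {d : ℕ} (γ r₀ : ℝ) (C : Set (Pt d)) : Set (ProbabilityMeasure (Pt d)) :=
  {μ | (μ : Measure (Pt d)) Cᶜ = 0 ∧
    ∀ x ∈ C, ∀ r : ℝ, 0 < r → r ≤ r₀ →
      ENNReal.ofReal (γ * r ^ d) ≤ (μ : Measure (Pt d)) (Metric.closedBall x r)}

/-- Conditional convergence in distribution, in probability, of the bootstrap statistic. Here
`Q n ω` is the distribution that the bootstrap sample of size `m n` is drawn from, given the data.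
For every bounded continuous `v`, the conditional expectation of `v` at the standardized statistic
of the bootstrap sample tends to `∫ v dG` in probability. -/
def BootstrapTendstoInProbability {d : ℕ} {Ω : Type*} [MeasurableSpace Ω] (P : Measure Ω)
    (κ : GraphKind) (k : ℕ) (m : ℕ → ℕ) (Q : ℕ → Ω → ProbabilityMeasure (Pt d))
    (G : ProbabilityMeasure ℝ) : Prop :=
  ∀ v : ℝ →ᵇ ℝ, TendstoInMeasure P
    (fun n ω => ∫ x, v (standardizedLength κ k (m n) (Q n ω) x) ∂(sampleLaw (m n) (Q n ω)))
    atTop (fun _ => ∫ y, v y ∂(G : Measure ℝ))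

/-- Conditional convergence in distribution, almost surely, of the bootstrap statistic: for almost
every realization of the data, the standardized statistic of the bootstrap sample converges in
distribution to `G`. -/
def BootstrapTendstoAlmostSurely {d : ℕ} {Ω : Type*} [MeasurableSpace Ω] (P : Measure Ω)
    (κ : GraphKind) (k : ℕ) (m : ℕ → ℕ) (Q : ℕ → Ω → ProbabilityMeasure (Pt d))
    (G : ProbabilityMeasure ℝ) : Prop :=
  ∀ᵐ ω ∂P, TendstoInDistribution
    (fun n => standardizedLength κ k (m n) (Q n ω)) atTop (id : ℝ → ℝ)
    (fun n => sampleLaw (m n) (Q n ω)) (G : Measure ℝ)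

end KnnBootstrap

/-!
Why the theorem is true. The standardized total length satisfies a central limit theorem that is
uniform in the distribution: for a square integrable density `f` there is one Gaussian law `N` such
that the standardized length of a sample of size `m` from `Q` has a law close to `N` as soon as `m`
is large, `Q` lies in `ballMassClass γ r₀ C`, and the density of `Q` is close to `f` in `L¹` and
`L²` (`exists_gaussian_limit`, `exists_isUniformLimitLaw`). Convergence in `L¹` and in `Lᵖ` with
`p > 2` implies such closeness (`exists_forall_momentSize_le`). Hence the laws of the original
statistics converge to `N`, and so do the conditional laws of the bootstrap statistics, and by the
uniqueness of limits either side of each equivalence says that `G = N`.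

The uniform central limit theorem rests on the Efron–Stein inequality `efron_stein`, by which the
variance of a functional of an i.i.d. sample is controlled by the effects of removing single
points. For the nearest neighbour graph with edge weights bounded by `B`, the removal of a point
changes the sum of the weights by at most a constant times `B` (`abs_removal_le_const`), because a
point is one of the `k` nearest neighbours of boundedly many others (`card_in_le`, by a covering of
the space with narrow cones); and if only edges of length at most `r` count, this effect depends
only on the cloud within distance `3 * r` of the point (`removal_congr_of_near`). Two functionals
for which the effects of removing a point mostly coincide, or are small, have a difference of small
variance, and their centred characteristic functions are close (`norm_centredChar_sub_le`).

* Long edges. Since balls have a large mass, a nearest neighbour is far away only with an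
  exponentially small probability, and edges of length more than `R` contribute little to the
  variance, uniformly in the distribution (`variance_longEdges_le`). So edge lengths may be
  truncated.
* Change of the density. Couple two samples pointwise by maximal couplings of their laws. The
  effect of removing a point is the same in both samples unless the point, or one near to it,
  differs in the two samples; the expected number of such points is controlled by the `L¹` and `L²`
  norms of the difference of the densities (`norm_sumChar_sub_le_of_density`). So `f` may be
  replaced by a bounded density that is constant on the cells of a grid (`exists_step_density`).
* Blocks. Such a distribution is a mixture of `L ^ d` copies of itself, each cell being contracted
  onto one of its `L ^ d` subcells (`map_subcellMap`). A sample of it is a union of as many blocks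
  which, except for the edges near the boundaries of the subcells, do not see each other
  (`norm_sumChar_sub_labelledSum_le`). With blocks of about `j ^ 4` points, they are independent
  given their sizes, and a product of characteristic functions of many small independent variables
  is nearly Gaussian (`norm_centredChar_labelledSum_sub_le`). The fluctuations of the sizes of the
  blocks contribute little, because the expected length of a block is nearly linear in its size
  (`abs_meanStep_sub_le`) and the total size is fixed.

This gives, for every `ε`, a Gaussian characteristic function within `ε` of the one of the
standardized length (`exists_gaussian_approx_near`). The variances of these Gaussian laws converge
(`exists_common_variance`), and Lévy's continuity theorem concludes. The limit may be degenerate.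
-/

namespace KnnBootstrap

/-! ### Bounded measurable functions, the Efron–Stein inequality and characteristic functions -/

/-- A bounded measurable real function. -/
def BddMeas {α : Type*} [MeasurableSpace α] (f : α → ℝ) : Prop :=
  Measurable f ∧ ∃ B, ∀ x, |f x| ≤ B

namespace BddMeas

variable {α β : Type*} [MeasurableSpace α] [MeasurableSpace β] {f g : α → ℝ}

lemma integrable (hf : BddMeas f) (μ : Measure α) [IsFiniteMeasure μ] : Integrable f μ := by
  obtain ⟨hm, B, hB⟩ := hf
  exact Integrable.of_bound hm.aestronglyMeasurable B (Eventually.of_forall hB)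

lemma memLp (hf : BddMeas f) (μ : Measure α) [IsFiniteMeasure μ] (p : ℝ≥0∞) : MemLp f p μ := by
  obtain ⟨hm, B, hB⟩ := hf
  exact MemLp.of_bound hm.aestronglyMeasurable B (Eventually.of_forall hB)

lemma const (c : ℝ) : BddMeas (fun _ : α => c) := ⟨measurable_const, |c|, fun _ => le_rfl⟩

lemma add (hf : BddMeas f) (hg : BddMeas g) : BddMeas (fun x => f x + g x) := by
  obtain ⟨hm, B, hB⟩ := hf
  obtain ⟨hm', B', hB'⟩ := hg
  exact ⟨hm.add hm', B + B', fun x => (abs_add_le _ _).trans (add_le_add (hB x) (hB' x))⟩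

lemma neg (hf : BddMeas f) : BddMeas (fun x => - f x) := by
  obtain ⟨hm, B, hB⟩ := hf
  exact ⟨hm.neg, B, fun x => by simpa using hB x⟩

lemma sub (hf : BddMeas f) (hg : BddMeas g) : BddMeas (fun x => f x - g x) := by
  simpa [sub_eq_add_neg] using hf.add hg.neg

lemma mul (hf : BddMeas f) (hg : BddMeas g) : BddMeas (fun x => f x * g x) := by
  obtain ⟨hm, B, hB⟩ := hf
  obtain ⟨hm', B', hB'⟩ := hg
  refine ⟨hm.mul hm', B * B', fun x => ?_⟩
  rw [abs_mul]
  exact mul_le_mul (hB x) (hB' x) (abs_nonneg _) ((abs_nonneg _).trans (hB x))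

lemma sq (hf : BddMeas f) : BddMeas (fun x => f x ^ 2) := by
  simpa [_root_.sq] using hf.mul hf

lemma comp (hf : BddMeas f) {φ : β → α} (hφ : Measurable φ) : BddMeas (fun x => f (φ x)) := by
  obtain ⟨hm, B, hB⟩ := hf
  exact ⟨hm.comp hφ, B, fun x => hB _⟩

lemma sum {ι : Type*} (s : Finset ι) {f : ι → α → ℝ} (hf : ∀ i ∈ s, BddMeas (f i)) :
    BddMeas (fun x => ∑ i ∈ s, f i x) := by
  classical
  induction s using Finset.induction_on with
  | empty => simpa using BddMeas.const (α := α) 0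
  | insert i s hi ih =>
    simp_rw [Finset.sum_insert hi]
    exact (hf i (by simp)).add (ih fun j hj => hf j (by simp [hj]))

lemma integral_prod_right {f : α × β → ℝ} (hf : BddMeas f) (ν : Measure β)
    [IsProbabilityMeasure ν] : BddMeas (fun a => ∫ b, f (a, b) ∂ν) := by
  obtain ⟨hm, B, hB⟩ := hf
  refine ⟨hm.stronglyMeasurable.integral_prod_right'.measurable, B, fun a => ?_⟩
  have := norm_integral_le_of_norm_le_const (μ := ν) (f := fun b => f (a, b)) (C := B)
    (Eventually.of_forall fun b => hB _)
  simpa using this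

end BddMeas

section Variance

variable {α β : Type*} [MeasurableSpace α] [MeasurableSpace β]

lemma variance_eq_sq_sub {f : α → ℝ} (hf : BddMeas f) (μ : Measure α) [IsProbabilityMeasure μ] :
    Var[f; μ] = ∫ x, f x ^ 2 ∂μ - (∫ x, f x ∂μ) ^ 2 := by
  rw [variance_eq_sub (hf.memLp μ 2)]; rfl

lemma sq_integral_le {f : α → ℝ} (hf : BddMeas f) (μ : Measure α) [IsProbabilityMeasure μ] :
    (∫ x, f x ∂μ) ^ 2 ≤ ∫ x, f x ^ 2 ∂μ := by
  have := variance_eq_sq_sub hf μ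
  have := variance_nonneg f μ
  linarith

/-- The law of total variance on a product space. -/
lemma variance_prod {f : α × β → ℝ} (hf : BddMeas f) (μ : Measure α) (ν : Measure β)
    [IsProbabilityMeasure μ] [IsProbabilityMeasure ν] :
    Var[f; μ.prod ν] =
      ∫ a, Var[fun b => f (a, b); ν] ∂μ + Var[fun a => ∫ b, f (a, b) ∂ν; μ] := by
  have h1 : ∀ a, Var[fun b => f (a, b); ν] = ∫ b, f (a, b) ^ 2 ∂ν - (∫ b, f (a, b) ∂ν) ^ 2 :=
    fun a => variance_eq_sq_sub (hf.comp (by fun_prop)) ν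
  simp_rw [h1]
  rw [integral_sub ((hf.sq.integral_prod_right ν).integrable μ)
      ((hf.integral_prod_right ν).sq.integrable μ),
    variance_eq_sq_sub hf, variance_eq_sq_sub (hf.integral_prod_right ν),
    integral_prod _ (hf.integrable _), integral_prod _ (hf.sq.integrable _)]
  ring

/-- The variance of the conditional mean is at most the mean square distance of `f` to any function
of the second variable alone: this is one step of the Efron–Stein inequality. -/
lemma variance_prod_le {f : α × β → ℝ} (hf : BddMeas f) (μ : Measure α) (ν : Measure β)
    [IsProbabilityMeasure μ] [IsProbabilityMeasure ν] {h : β → ℝ} (hh : BddMeas h) :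
    Var[f; μ.prod ν] ≤
      ∫ z, (f z - h z.2) ^ 2 ∂(μ.prod ν) + ∫ a, Var[fun b => f (a, b); ν] ∂μ := by
  rw [variance_prod hf, add_comm]
  gcongr
  have hd : BddMeas (fun z : α × β => f z - h z.2) := hf.sub (hh.comp measurable_snd)
  have hF := hf.integral_prod_right ν
  set c := ∫ b, h b ∂ν
  calc Var[fun a => ∫ b, f (a, b) ∂ν; μ]
      = Var[fun a => (∫ b, f (a, b) ∂ν) - c; μ] := by
        rw [variance_sub_const hF.1.aestronglyMeasurable]
    _ ≤ ∫ a, ((∫ b, f (a, b) ∂ν) - c) ^ 2 ∂μ := by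
        rw [variance_eq_sq_sub (hF.sub (BddMeas.const c))]
        have := sq_nonneg (∫ x, ((∫ b, f (x, b) ∂ν) - c) ∂μ)
        linarith
    _ ≤ ∫ a, ∫ b, (f (a, b) - h b) ^ 2 ∂ν ∂μ := by
        refine integral_mono ((hF.sub (BddMeas.const c)).sq.integrable μ)
          ((hd.sq.integral_prod_right ν).integrable μ) fun a => ?_
        have e : (∫ b, f (a, b) ∂ν) - c = ∫ b, (f (a, b) - h b) ∂ν :=
          (integral_sub ((hf.comp (by fun_prop : Measurable fun b => (a, b))).integrable ν)
            (hh.integrable ν)).symm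
        simp only [e]
        exact sq_integral_le (hd.comp (by fun_prop : Measurable fun b => (a, b))) ν
    _ = _ := (integral_prod _ (hd.sq.integrable _)).symm

end Variance

section EfronStein

variable {E : Type*} [MeasurableSpace E] (μ : Measure E) [IsProbabilityMeasure μ]

/-- The Efron–Stein inequality for the labels `Fin n`: the coordinates are split off one at a time
by `variance_prod_le`. -/
lemma efron_stein_fin (n : ℕ) (f : (Fin n → E) → ℝ) (hf : BddMeas f)
    (g : Fin n → (Fin n → E) → ℝ) (hg : ∀ i, BddMeas (g i))
    (hgi : ∀ i x y, g i (Function.update x i y) = g i x) :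
    Var[f; Measure.pi fun _ => μ] ≤ ∑ i, ∫ x, (f x - g i x) ^ 2 ∂(Measure.pi fun _ => μ) := by
  induction n with
  | zero =>
    have : f = fun _ => f default := by
      funext x; congr 1; exact Subsingleton.elim _ _
    rw [this, variance_eq_sq_sub (BddMeas.const _)]
    simp
  | succ n ih =>
    let e := (MeasurableEquiv.piFinSuccAbove (fun _ : Fin (n + 1) => E) 0).symm
    have he : MeasurePreserving e (μ.prod (Measure.pi fun _ : Fin n => μ))
        (Measure.pi fun _ : Fin (n + 1) => μ) :=
      (measurePreserving_piFinSuccAbove (fun _ : Fin (n + 1) => μ) 0).symm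
    have hes : ∀ a b, e (a, b) = Fin.cons a b := by
      intro a b; simp [e]; rfl
    have key := variance_prod_le (hf.comp e.measurable) μ (Measure.pi fun _ : Fin n => μ)
      (h := fun b => g 0 (e (Classical.choice (nonempty_of_isProbabilityMeasure μ), b)))
      ((hg 0).comp (by fun_prop))
    have hv : Var[f; Measure.pi fun _ : Fin (n + 1) => μ]
        = Var[fun z => f (e z); μ.prod (Measure.pi fun _ : Fin n => μ)] := by
      rw [← he.map_eq, variance_map hf.1.aemeasurable he.measurable.aemeasurable]; rfl
    have hI : ∀ φ : (Fin (n + 1) → E) → ℝ, ∫ x, φ x ∂(Measure.pi fun _ : Fin (n + 1) => μ)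
        = ∫ z, φ (e z) ∂(μ.prod (Measure.pi fun _ : Fin n => μ)) := fun φ =>
      (he.integral_comp e.measurableEmbedding φ).symm
    rw [hv, Fin.sum_univ_succ]
    refine key.trans (add_le_add (le_of_eq ?_) ?_)
    · rw [hI]
      refine integral_congr_ae (Eventually.of_forall fun z => ?_)
      obtain ⟨a, b⟩ := z
      simp only [hes]
      congr 2
      rw [← hgi 0 (Fin.cons a b) (Classical.choice (nonempty_of_isProbabilityMeasure μ)),
        Fin.update_cons_zero]
    · simp_rw [hI]
      have hd : ∀ i : Fin n, BddMeas (fun z => f (e z) - g i.succ (e z)) := fun i =>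
        (hf.comp e.measurable).sub ((hg _).comp e.measurable)
      simp_rw [integral_prod _ ((hd _).sq.integrable _)]
      rw [← integral_finsetSum _ fun i _ => ((hd i).sq.integral_prod_right _).integrable μ]
      refine integral_mono_of_nonneg (Eventually.of_forall fun a => variance_nonneg _ _)
        ((BddMeas.sum _ fun i _ => (hd i).sq.integral_prod_right _).integrable μ)
        (Eventually.of_forall fun a => ?_)
      refine ih (fun b => f (e (a, b))) (hf.comp (by fun_prop))
        (fun i b => g i.succ (e (a, b))) (fun i => (hg _).comp (by fun_prop)) fun i x y => ?_
      rw [hes, hes, Fin.cons_update, hgi]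

lemma measurePreserving_pi_comp {ι κ : Type*} [Fintype ι] [Fintype κ] (s : κ → ι)
    (hs : Function.Injective s) :
    MeasurePreserving (fun (x : ι → E) j => x (s j)) (Measure.pi fun _ => μ)
      (Measure.pi fun _ => μ) := by
  refine ⟨by fun_prop, ?_⟩
  have := Measure.map_infinitePi_infinitePi_of_inj (P := fun _ : ι => μ) hs
  rwa [Measure.infinitePi_eq_pi, Measure.infinitePi_eq_pi] at this

/-- The **Efron–Stein inequality**, in the form in which the function obtained by removing the
`i`-th coordinate is replaced by any function `g i` that does not depend on that coordinate. -/
theorem efron_stein {ι : Type*} [Fintype ι] [DecidableEq ι] (f : (ι → E) → ℝ) (hf : BddMeas f)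
    (g : ι → (ι → E) → ℝ) (hg : ∀ i, BddMeas (g i))
    (hgi : ∀ i x y, g i (Function.update x i y) = g i x) :
    Var[f; Measure.pi fun _ => μ] ≤ ∑ i, ∫ x, (f x - g i x) ^ 2 ∂(Measure.pi fun _ => μ) := by
  let s := Fintype.equivFin ι
  have he := measurePreserving_pi_comp μ s s.injective
  have hI : ∀ φ : (ι → E) → ℝ, BddMeas φ → ∫ x, φ x ∂(Measure.pi fun _ : ι => μ)
        = ∫ z, φ (fun j => z (s j)) ∂(Measure.pi fun _ => μ) := fun φ hφ => by
    rw [← he.map_eq, integral_map he.measurable.aemeasurable hφ.1.aestronglyMeasurable]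
  have hv : Var[f; Measure.pi fun _ : ι => μ]
      = Var[fun z => f (fun j => z (s j)); Measure.pi fun _ => μ] := by
    rw [← he.map_eq, variance_map hf.1.aemeasurable he.measurable.aemeasurable]; rfl
  rw [hv]
  refine (efron_stein_fin μ _ _ (hf.comp (by fun_prop))
    (fun i z => g (s.symm i) (fun j => z (s j))) (fun i => (hg _).comp (by fun_prop))
    fun i x y => ?_).trans (le_of_eq ?_)
  · rw [← hgi _ (fun j => x (s j)) y]
    congr 1
    funext j
    by_cases h : j = s.symm i
    · subst h; simp
    · rw [Function.update_of_ne h, Function.update_of_ne]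
      intro h'; exact h (by rw [← h']; simp)
  · rw [← s.symm.sum_comp]
    exact Finset.sum_congr rfl fun i _ => (hI _ (hf.sub (hg _)).sq).symm

/-- The Efron–Stein inequality when removing a coordinate changes the value by at most `B`, and
only on an event that has to be measured. -/
theorem efron_stein_event {ι : Type*} [Fintype ι] [DecidableEq ι] (f : (ι → E) → ℝ)
    (hf : BddMeas f) (g : ι → (ι → E) → ℝ) (hg : ∀ i, BddMeas (g i))
    (hgi : ∀ i x y, g i (Function.update x i y) = g i x) (B : ℝ) (A : ι → Set (ι → E))
    (hA : ∀ i, MeasurableSet (A i))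
    (h : ∀ i, ∀ᵐ x ∂(Measure.pi fun _ => μ), |f x - g i x| ≤ (A i).indicator (fun _ => B) x) :
    Var[f; Measure.pi fun _ => μ] ≤ B ^ 2 * ∑ i, (Measure.pi fun _ => μ).real (A i) := by
  refine (efron_stein μ f hf g hg hgi).trans ?_
  rw [Finset.mul_sum]
  refine Finset.sum_le_sum fun i _ => ?_
  calc ∫ x, (f x - g i x) ^ 2 ∂(Measure.pi fun _ => μ)
      ≤ ∫ x, (A i).indicator (fun _ => B ^ 2) x ∂(Measure.pi fun _ => μ) := by
        refine integral_mono_ae ((hf.sub (hg i)).sq.integrable _)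
          ((integrable_const _).indicator (hA i)) ?_
        filter_upwards [h i] with x hx
        by_cases hxA : x ∈ A i
        · simp only [Set.indicator_of_mem hxA] at hx ⊢
          exact sq_le_sq' (by linarith [neg_abs_le (f x - g i x)]) (le_of_abs_le hx)
        · simp only [Set.indicator_of_notMem hxA] at hx ⊢
          have := abs_nonpos_iff.1 hx
          simp [this]
    _ = _ := by rw [integral_indicator_const _ (hA i), smul_eq_mul, mul_comm]

end EfronStein

section CharFun

variable {α : Type*} [MeasurableSpace α]

/-- The characteristic function at `t` of the centred random variable `f - 𝔼 f`. -/
noncomputable def centredChar (μ : Measure α) (f : α → ℝ) (t : ℝ) : ℂ :=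
  ∫ x, Complex.exp (((t * (f x - ∫ y, f y ∂μ) : ℝ) : ℂ) * Complex.I) ∂μ

lemma norm_exp_mul_I_sub_le (a b : ℝ) :
    ‖Complex.exp ((a : ℂ) * Complex.I) - Complex.exp ((b : ℂ) * Complex.I)‖ ≤ |a - b| := by
  have h : Complex.exp ((a : ℂ) * Complex.I) - Complex.exp ((b : ℂ) * Complex.I)
      = Complex.exp ((b : ℂ) * Complex.I) * (Complex.exp (Complex.I * ((a - b : ℝ) : ℂ)) - 1) := by
    rw [mul_sub, ← Complex.exp_add]; push_cast; ring_nf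
  rw [h, norm_mul, Complex.norm_exp_ofReal_mul_I, one_mul]
  exact Real.norm_exp_I_mul_ofReal_sub_one_le

lemma integral_abs_sub_mean_le {f : α → ℝ} (hf : BddMeas f) (μ : Measure α)
    [IsProbabilityMeasure μ] : ∫ x, |f x - ∫ y, f y ∂μ| ∂μ ≤ √(Var[f; μ]) := by
  have hg : BddMeas fun x => f x - ∫ y, f y ∂μ := hf.sub (BddMeas.const _)
  have hg' : BddMeas fun x => |f x - ∫ y, f y ∂μ| :=
    ⟨hg.1.abs, by obtain ⟨B, hB⟩ := hg.2; exact ⟨B, by simpa using hB⟩⟩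
  apply Real.le_sqrt_of_sq_le
  rw [variance_eq_integral hf.1.aemeasurable]
  simpa using sq_integral_le hg' μ

lemma integrable_exp_mul_I {f : α → ℝ} (hf : Measurable f) (μ : Measure α)
    [IsProbabilityMeasure μ] :
    Integrable (fun x => Complex.exp ((f x : ℂ) * Complex.I)) μ := by
  refine Integrable.of_bound (by fun_prop) 1 (Eventually.of_forall fun x => ?_)
  rw [Complex.norm_exp_ofReal_mul_I]

/-- Random variables whose difference has a small variance have close centred characteristic
functions. -/
lemma norm_centredChar_sub_le {f g : α → ℝ} (hf : BddMeas f) (hg : BddMeas g) (μ : Measure α)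
    [IsProbabilityMeasure μ] (t : ℝ) :
    ‖centredChar μ f t - centredChar μ g t‖ ≤ |t| * √(Var[fun x => f x - g x; μ]) := by
  unfold centredChar
  have hfm := hf.1
  have hgm := hg.1
  rw [← integral_sub (integrable_exp_mul_I (by fun_prop) μ) (integrable_exp_mul_I (by fun_prop) μ)]
  refine (norm_integral_le_integral_norm _).trans ?_
  have hd := hf.sub hg
  have he : ∫ y, (f y - g y) ∂μ = ∫ y, f y ∂μ - ∫ y, g y ∂μ :=
    integral_sub (hf.integrable μ) (hg.integrable μ)
  refine le_trans ?_ (mul_le_mul_of_nonneg_left (integral_abs_sub_mean_le hd μ) (abs_nonneg t))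
  rw [← integral_const_mul]
  have hd' : BddMeas fun x => f x - g x - ∫ y, (f y - g y) ∂μ := hd.sub (BddMeas.const _)
  refine integral_mono_of_nonneg (Eventually.of_forall fun _ => norm_nonneg _)
    ((hd'.integrable μ).abs.const_mul _) (Eventually.of_forall fun x => ?_)
  refine (norm_exp_mul_I_sub_le _ _).trans (le_of_eq ?_)
  simp only [he, ← abs_mul]
  congr 1
  ring

lemma centredChar_map {β : Type*} [MeasurableSpace β] {μ : Measure α} {φ : α → β}
    (hφ : Measurable φ) {f : β → ℝ} (hf : Measurable f) (t : ℝ) :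
    centredChar (μ.map φ) f t = centredChar μ (fun x => f (φ x)) t := by
  unfold centredChar
  rw [integral_map hφ.aemeasurable hf.aestronglyMeasurable,
    integral_map hφ.aemeasurable (by fun_prop)]

lemma centredChar_congr_ae {μ : Measure α} {f g : α → ℝ} (h : f =ᵐ[μ] g) (t : ℝ) :
    centredChar μ f t = centredChar μ g t := by
  unfold centredChar
  rw [integral_congr_ae h]
  refine integral_congr_ae ?_
  filter_upwards [h] with x hx
  rw [hx]

end CharFun

/-! ### Nearest neighbour graphs and the removal of a point -/

section Graph

variable {d : ℕ} {ι : Type*}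

open Classical in
/-- The points of the sub-cloud `S` other than `i` that are strictly closer to `i` than `j` is. -/
noncomputable def closer (x : ι → Pt d) (S : Finset ι) (i j : ι) : Finset ι :=
  S.filter fun l => l ≠ i ∧ dist (x i) (x l) < dist (x i) (x j)

lemma mem_closer {x : ι → Pt d} {S : Finset ι} {i j l : ι} :
    l ∈ closer x S i j ↔ l ∈ S ∧ l ≠ i ∧ dist (x i) (x l) < dist (x i) (x j) := by
  simp [closer]

/-- `Nb k x S i j`: within the sub-cloud with labels in `S`, the point `j` is one of the `k` nearest
neighbours of `i`. Keeping the label set explicit makes it possible to remove points from the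
cloud, and to split it, without relabelling. -/
def Nb (k : ℕ) (x : ι → Pt d) (S : Finset ι) (i j : ι) : Prop :=
  i ∈ S ∧ j ∈ S ∧ j ≠ i ∧ (closer x S i j).card < k

open Classical in
/-- The multiplicity of the ordered pair `(i, j)` in the graph on `S`: the indicator of `i → j`,
minus `c` times the indicator that both `i → j` and `j → i`. With `c = 0` this describes the
directed graph, with `c = 1 / 2` the undirected one. -/
noncomputable def edgeCoef (c : ℝ) (k : ℕ) (x : ι → Pt d) (S : Finset ι) (i j : ι) : ℝ :=
  (if Nb k x S i j then 1 else 0) - c * (if Nb k x S i j ∧ Nb k x S j i then 1 else 0)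

/-- The sum of `w (length)` over the edges of the nearest neighbour graph on `S`. -/
noncomputable def graphSum (c : ℝ) (k : ℕ) (w : ℝ → ℝ) (x : ι → Pt d) (S : Finset ι) : ℝ :=
  ∑ i ∈ S, ∑ j ∈ S, w (dist (x i) (x j)) * edgeCoef c k x S i j

open Classical in
/-- The sum of `u (length)` over the edges from `i` to its `k` nearest neighbours in `S`. -/
noncomputable def nearSum (k : ℕ) (u : ℝ → ℝ) (x : ι → Pt d) (S : Finset ι) (i : ι) : ℝ :=
  ∑ j ∈ S, if Nb k x S i j then u (dist (x i) (x j)) else 0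

lemma edgeCoef_eq_zero_left {c : ℝ} {k : ℕ} {x : ι → Pt d} {S : Finset ι} {i j : ι} (h : i ∉ S) :
    edgeCoef c k x S i j = 0 := by
  simp [edgeCoef, Nb, h]

lemma edgeCoef_eq_zero_right {c : ℝ} {k : ℕ} {x : ι → Pt d} {S : Finset ι} {i j : ι} (h : j ∉ S) :
    edgeCoef c k x S i j = 0 := by
  simp [edgeCoef, Nb, h]

lemma edgeCoef_congr {κ : Type*} {c : ℝ} {k : ℕ} {x : ι → Pt d} {y : κ → Pt d} {S : Finset ι}
    {T : Finset κ} {i j : ι} {a b : κ} (h : Nb k x S i j ↔ Nb k y T a b)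
    (h' : Nb k x S j i ↔ Nb k y T b a) : edgeCoef c k x S i j = edgeCoef c k y T a b := by
  unfold edgeCoef
  by_cases h1 : Nb k x S i j <;> by_cases h2 : Nb k x S j i
  · rw [if_pos h1, if_pos ⟨h1, h2⟩, if_pos (h.1 h1), if_pos ⟨h.1 h1, h'.1 h2⟩]
  · rw [if_pos h1, if_neg (fun q => h2 q.2), if_pos (h.1 h1), if_neg (fun q => h2 (h'.2 q.2))]
  all_goals rw [if_neg h1, if_neg (fun q => h1 q.1), if_neg (fun q => h1 (h.2 q)),
    if_neg (fun q => h1 (h.2 q.1))]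

lemma graphSum_eq_sum_of_subset (c : ℝ) (k : ℕ) (w : ℝ → ℝ) (x : ι → Pt d) {S T : Finset ι}
    (h : S ⊆ T) :
    graphSum c k w x S = ∑ i ∈ T, ∑ j ∈ T, w (dist (x i) (x j)) * edgeCoef c k x S i j := by
  unfold graphSum
  rw [← Finset.sum_subset h fun i _ hi => ?_]
  · refine Finset.sum_congr rfl fun i _ => ?_
    exact Finset.sum_subset h fun j _ hj => by rw [edgeCoef_eq_zero_right hj, mul_zero]
  · exact Finset.sum_eq_zero fun j _ => by rw [edgeCoef_eq_zero_left hi, mul_zero]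

lemma nb_congr_dist {k : ℕ} {x y : ι → Pt d} {S : Finset ι}
    (h : ∀ i ∈ S, ∀ j ∈ S, dist (x i) (x j) = dist (y i) (y j)) (i j : ι) :
    Nb k x S i j ↔ Nb k y S i j := by
  by_cases hi : i ∈ S
  swap
  · simp [Nb, hi]
  by_cases hj : j ∈ S
  swap
  · simp [Nb, hj]
  have : closer x S i j = closer y S i j := by
    ext l
    simp only [mem_closer]
    refine and_congr_right fun hl => ?_
    rw [h i hi l hl, h i hi j hj]
  simp [Nb, this]

lemma graphSum_congr_dist {c : ℝ} {k : ℕ} {w : ℝ → ℝ} {x y : ι → Pt d} {S : Finset ι}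
    (h : ∀ i ∈ S, ∀ j ∈ S, dist (x i) (x j) = dist (y i) (y j)) :
    graphSum c k w x S = graphSum c k w y S := by
  unfold graphSum
  refine Finset.sum_congr rfl fun i hi => Finset.sum_congr rfl fun j hj => ?_
  rw [h i hi j hj, edgeCoef_congr (nb_congr_dist h i j) (nb_congr_dist h j i)]

lemma graphSum_congr {c : ℝ} {k : ℕ} {w : ℝ → ℝ} {x y : ι → Pt d} {S : Finset ι}
    (h : ∀ i ∈ S, x i = y i) : graphSum c k w x S = graphSum c k w y S :=
  graphSum_congr_dist fun i hi j hj => by rw [h i hi, h j hj]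

/-- The graph is invariant under dilations, which only act on the lengths. -/
lemma graphSum_smul {c : ℝ} {k : ℕ} {w : ℝ → ℝ} {x : ι → Pt d} {S : Finset ι} {s : ℝ}
    (hs : 0 < s) :
    graphSum c k w (fun i => s • x i) S = graphSum c k (fun t => w (s * t)) x S := by
  have hd : ∀ i j, dist (s • x i) (s • x j) = s * dist (x i) (x j) := fun i j => by
    rw [dist_smul₀, Real.norm_of_nonneg hs.le]
  have hnb : ∀ i j, Nb k (fun i => s • x i) S i j ↔ Nb k x S i j := fun i j => by
    have : closer (fun i => s • x i) S i j = closer x S i j := by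
      ext l
      simp only [mem_closer, hd, mul_lt_mul_iff_right₀ hs]
    simp [Nb, this]
  unfold graphSum
  simp only [hd, fun i j => edgeCoef_congr (c := c) (hnb i j) (hnb j i)]

lemma graphSum_map {κ : Type*} {c : ℝ} {k : ℕ} {w : ℝ → ℝ} {x : ι → Pt d} (e : κ ↪ ι)
    (S : Finset κ) : graphSum c k w x (S.map e) = graphSum c k w (fun a => x (e a)) S := by
  have hnb : ∀ i j, Nb k x (S.map e) (e i) (e j) ↔ Nb k (fun a => x (e a)) S i j := fun i j => by
    have : closer x (S.map e) (e i) (e j) = (closer (fun a => x (e a)) S i j).map e := by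
      ext l
      simp only [mem_closer, Finset.mem_map]
      constructor
      · rintro ⟨⟨a, ha, rfl⟩, h1, h2⟩
        exact ⟨a, ⟨ha, fun h => h1 (by rw [h]), h2⟩, rfl⟩
      · rintro ⟨a, ⟨ha, h1, h2⟩, rfl⟩
        exact ⟨⟨a, ha, rfl⟩, fun h => h1 (e.injective h), h2⟩
    simp [Nb, this]
  unfold graphSum
  simp only [Finset.sum_map, fun i j => edgeCoef_congr (c := c) (hnb i j) (hnb j i)]

lemma edgeCoef_mem_Icc {c : ℝ} (hc0 : 0 ≤ c) (hc1 : c ≤ 1) (k : ℕ) (x : ι → Pt d) (S : Finset ι)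
    (i j : ι) : edgeCoef c k x S i j ∈ Set.Icc (0 : ℝ) 1 := by
  unfold edgeCoef
  by_cases h1 : Nb k x S i j <;> by_cases h2 : Nb k x S j i <;>
    simp [h1, h2, hc0, hc1]

lemma abs_graphSum_le {c : ℝ} (hc0 : 0 ≤ c) (hc1 : c ≤ 1) {k : ℕ} {w : ℝ → ℝ} {B : ℝ}
    (hw : ∀ t, |w t| ≤ B) (x : ι → Pt d) (S : Finset ι) :
    |graphSum c k w x S| ≤ S.card * (S.card * B) := by
  unfold graphSum
  refine (Finset.abs_sum_le_sum_abs _ _).trans ?_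
  rw [← nsmul_eq_mul]
  refine Finset.sum_le_card_nsmul _ _ _ fun i _ => ?_
  refine (Finset.abs_sum_le_sum_abs _ _).trans ?_
  rw [← nsmul_eq_mul]
  refine Finset.sum_le_card_nsmul _ _ _ fun j _ => ?_
  have := edgeCoef_mem_Icc hc0 hc1 k x S i j
  rw [abs_mul, abs_of_nonneg this.1]
  exact (mul_le_of_le_one_right (abs_nonneg _) this.2).trans (hw _)

/-! #### Locality -/

/-- Whether an edge of length at most `r` leaves `i` only depends on the cloud within distance `r`
of `i`. -/
lemma nb_congr_of_near {k : ℕ} {x : ι → Pt d} {S S' : Finset ι} {i j : ι} {r : ℝ}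
    (hij : dist (x i) (x j) ≤ r) (h : ∀ l, dist (x i) (x l) ≤ r → (l ∈ S ↔ l ∈ S')) :
    Nb k x S i j ↔ Nb k x S' i j := by
  have hi := h i (by simpa using dist_nonneg.trans hij)
  have : closer x S i j = closer x S' i j := by
    ext l
    simp only [mem_closer]
    constructor
    · rintro ⟨h1, h2, h3⟩
      exact ⟨(h l (h3.le.trans hij)).1 h1, h2, h3⟩
    · rintro ⟨h1, h2, h3⟩
      exact ⟨(h l (h3.le.trans hij)).2 h1, h2, h3⟩
  simp only [Nb, this, hi, h j hij]

lemma edgeCoef_congr_of_near {c : ℝ} {k : ℕ} {x : ι → Pt d} {S S' : Finset ι} {i j : ι} {r : ℝ}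
    (hij : dist (x i) (x j) ≤ r) (hi : ∀ l, dist (x i) (x l) ≤ r → (l ∈ S ↔ l ∈ S'))
    (hj : ∀ l, dist (x j) (x l) ≤ r → (l ∈ S ↔ l ∈ S')) :
    edgeCoef c k x S i j = edgeCoef c k x S' i j := by
  exact edgeCoef_congr (nb_congr_of_near hij hi)
    (nb_congr_of_near (dist_comm (x i) (x j) ▸ hij) hj)

variable [DecidableEq ι]

/-- The change of `graphSum` when the point `l` is removed from the cloud. -/
noncomputable def removal (c : ℝ) (k : ℕ) (w : ℝ → ℝ) (x : ι → Pt d) (S : Finset ι) (l : ι) : ℝ :=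
  graphSum c k w x S - graphSum c k w x (S.erase l)

lemma removal_eq_sum (c : ℝ) (k : ℕ) (w : ℝ → ℝ) (x : ι → Pt d) {S T : Finset ι} (h : S ⊆ T)
    (l : ι) : removal c k w x S l = ∑ i ∈ T, ∑ j ∈ T, w (dist (x i) (x j)) *
      (edgeCoef c k x S i j - edgeCoef c k x (S.erase l) i j) := by
  unfold removal
  rw [graphSum_eq_sum_of_subset c k w x h,
    graphSum_eq_sum_of_subset c k w x ((Finset.erase_subset l S).trans h),
    ← Finset.sum_sub_distrib]
  refine Finset.sum_congr rfl fun i _ => ?_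
  rw [← Finset.sum_sub_distrib]
  exact Finset.sum_congr rfl fun j _ => by ring

lemma removal_of_notMem {c : ℝ} {k : ℕ} {w : ℝ → ℝ} {x : ι → Pt d} {S : Finset ι} {l : ι}
    (h : l ∉ S) : removal c k w x S l = 0 := by
  simp [removal, Finset.erase_eq_of_notMem h]

/-- If only edges of length at most `r` count, then the effect of removing a point depends only on
the cloud within distance `3 * r` of that point. -/
lemma removal_congr_of_near {c : ℝ} {k : ℕ} {w : ℝ → ℝ} {r : ℝ} (hw : ∀ t, r < t → w t = 0)
    {x : ι → Pt d} {S S' : Finset ι} {l : ι}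
    (h : ∀ i, dist (x i) (x l) ≤ 3 * r → (i ∈ S ↔ i ∈ S')) :
    removal c k w x S l = removal c k w x S' l := by
  rw [removal_eq_sum c k w x (Finset.subset_union_left (s₁ := S) (s₂ := S')),
    removal_eq_sum c k w x (Finset.subset_union_right (s₁ := S) (s₂ := S'))]
  refine Finset.sum_congr rfl fun i _ => Finset.sum_congr rfl fun j _ => ?_
  by_cases hij : r < dist (x i) (x j)
  · rw [hw _ hij, zero_mul, zero_mul]
  push Not at hij
  have hji : dist (x j) (x i) ≤ r := by rwa [dist_comm]
  have hr : 0 ≤ r := dist_nonneg.trans hij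
  congr 1
  by_cases hnear : dist (x i) (x l) ≤ 2 * r ∧ dist (x j) (x l) ≤ 2 * r
  · have key : ∀ m, dist (x m) (x l) ≤ 2 * r → ∀ q, dist (x m) (x q) ≤ r → (q ∈ S ↔ q ∈ S') :=
      fun m hm q hq => h q (by
        have := dist_triangle (x q) (x m) (x l)
        rw [dist_comm (x q) (x m)] at this
        linarith)
    have key' : ∀ m, dist (x m) (x l) ≤ 2 * r → ∀ q, dist (x m) (x q) ≤ r →
        (q ∈ S.erase l ↔ q ∈ S'.erase l) := fun m hm q hq => by
      simp only [Finset.mem_erase, key m hm q hq]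
    rw [edgeCoef_congr_of_near hij (key i hnear.1) (key j hnear.2),
      edgeCoef_congr_of_near hij (key' i hnear.1) (key' j hnear.2)]
  · have hfar : r < dist (x i) (x l) ∧ r < dist (x j) (x l) := by
      have h1 := dist_triangle (x i) (x j) (x l)
      have h2 := dist_triangle (x j) (x i) (x l)
      by_contra hcon
      apply hnear
      rw [not_and_or, not_lt, not_lt] at hcon
      rcases hcon with hcon | hcon <;> constructor <;> linarith
    have key : ∀ (U : Finset ι) m, r < dist (x m) (x l) → ∀ q, dist (x m) (x q) ≤ r →
        (q ∈ U ↔ q ∈ U.erase l) := fun U m hm q hq => by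
      have : q ≠ l := by rintro rfl; linarith
      simp [Finset.mem_erase, this]
    rw [edgeCoef_congr_of_near hij (key S i hfar.1) (key S j hfar.2),
      edgeCoef_congr_of_near hij (key S' i hfar.1) (key S' j hfar.2)]
    ring

/-! #### The edges affected by the removal of a point -/

/-- The removal of `l` affects the relation `i → j` only if `i = l`, or if `l` was a neighbour of
`i`; in the second case `j` is one of the `k + 1` nearest neighbours of `i` before the removal. -/
lemma nb_change {k : ℕ} {x : ι → Pt d} {S : Finset ι} {l i j : ι}
    (h : ¬ (Nb k x S i j ↔ Nb k x (S.erase l) i j)) :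
    (i = l ∧ Nb (k + 1) x S l j) ∨ (Nb k x S i l ∧ Nb (k + 1) x S i j) := by
  have hsub : closer x (S.erase l) i j ⊆ closer x S i j := fun m hm => by
    rw [mem_closer] at hm ⊢
    exact ⟨Finset.mem_of_mem_erase hm.1, hm.2⟩
  by_cases h1 : Nb k x S i j
  · have h2 : ¬ Nb k x (S.erase l) i j := fun h2 => h ⟨fun _ => h2, fun _ => h1⟩
    obtain ⟨hi, hj, hne, hcard⟩ := h1
    by_cases hil : i = l
    · subst hil
      exact Or.inl ⟨rfl, hi, hj, hne, hcard.trans (Nat.lt_succ_self k)⟩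
    by_cases hjl : j = l
    · subst hjl
      exact Or.inr ⟨⟨hi, hj, hne, hcard⟩, hi, hj, hne, hcard.trans (Nat.lt_succ_self k)⟩
    exact absurd ⟨Finset.mem_erase.2 ⟨hil, hi⟩, Finset.mem_erase.2 ⟨hjl, hj⟩, hne,
      (Finset.card_le_card hsub).trans_lt hcard⟩ h2
  · have h2 : Nb k x (S.erase l) i j := by
      by_contra h2
      exact h ⟨fun h => absurd h h1, fun h => absurd h h2⟩
    obtain ⟨hi, hj, hne, hcard⟩ := h2
    rw [Finset.mem_erase] at hi hj
    have hsub' : closer x S i j ⊆ insert l (closer x (S.erase l) i j) := fun m hm => by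
      rw [mem_closer] at hm
      by_cases hml : m = l
      · simp [hml]
      · exact Finset.mem_insert_of_mem (mem_closer.2 ⟨Finset.mem_erase.2 ⟨hml, hm.1⟩, hm.2⟩)
    have hle : (closer x S i j).card ≤ k :=
      ((Finset.card_le_card hsub').trans (Finset.card_insert_le _ _)).trans hcard
    have hge : k ≤ (closer x S i j).card := by
      by_contra hlt
      exact h1 ⟨hi.2, hj.2, hne, not_le.1 hlt⟩
    have hl : l ∈ closer x S i j := by
      by_contra hl
      have : closer x S i j ⊆ closer x (S.erase l) i j := fun m hm => by
        rcases Finset.mem_insert.1 (hsub' hm) with rfl | h'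
        · exact absurd hm hl
        · exact h'
      exact absurd (hge.trans (Finset.card_le_card this)) (not_le.2 hcard)
    refine Or.inr ⟨⟨hi.2, (mem_closer.1 hl).1, fun h => hi.1 h.symm, ?_⟩, hi.2, hj.2, hne,
      Nat.lt_succ_of_le hle⟩
    have hsub2 : closer x S i l ⊆ (closer x S i j).erase l := fun m hm => by
      rw [mem_closer] at hm
      refine Finset.mem_erase.2
        ⟨?_, mem_closer.2 ⟨hm.1, hm.2.1, hm.2.2.trans (mem_closer.1 hl).2.2⟩⟩
      rintro rfl
      exact lt_irrefl _ hm.2.2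
    have := Finset.card_le_card hsub2
    rw [Finset.card_erase_of_mem hl] at this
    have := Finset.card_pos.2 ⟨l, hl⟩
    omega

open Classical in
/-- The removal of `l` only affects the edges at `l` and those that leave the points of which `l` is
a neighbour. -/
lemma abs_removal_le {c : ℝ} (hc0 : 0 ≤ c) (hc1 : c ≤ 1) {k : ℕ} {w : ℝ → ℝ} {x : ι → Pt d}
    {S : Finset ι} {l : ι} (hl : l ∈ S) :
    |removal c k w x S l| ≤ 2 * (nearSum (k + 1) (fun t => |w t|) x S l +
      ∑ i ∈ S, if Nb k x S i l then nearSum (k + 1) (fun t => |w t|) x S i else 0) := by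
  -- `a i j` is a bound for the weight of the relation `i → j` when the removal affects it
  set a : ι → ι → ℝ := fun i j =>
    (if i = l then (if Nb (k + 1) x S l j then |w (dist (x i) (x j))| else 0) else 0) +
    (if Nb k x S i l then (if Nb (k + 1) x S i j then |w (dist (x i) (x j))| else 0) else 0)
    with ha
  have ha0 : ∀ i j, 0 ≤ a i j := fun i j => by
    simp only [ha]; positivity
  have hsum : ∑ i ∈ S, ∑ j ∈ S, a i j = nearSum (k + 1) (fun t => |w t|) x S l +
      ∑ i ∈ S, if Nb k x S i l then nearSum (k + 1) (fun t => |w t|) x S i else 0 := by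
    simp only [ha, Finset.sum_add_distrib]
    congr 1
    · rw [Finset.sum_eq_single_of_mem l hl]
      · simp [nearSum]
      · intro i _ hi; simp [hi]
    · refine Finset.sum_congr rfl fun i _ => ?_
      split_ifs
      · rfl
      · simp
  have hchange : ∀ i j, ¬ (Nb k x S i j ↔ Nb k x (S.erase l) i j) →
      |w (dist (x i) (x j))| ≤ a i j := fun i j h => by
    rcases nb_change h with ⟨rfl, h2⟩ | ⟨h1, h2⟩
    · simp only [ha, if_pos h2, if_true]
      have : 0 ≤ (if Nb k x S i i then |w (dist (x i) (x j))| else (0 : ℝ)) := by positivity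
      linarith
    · simp only [ha, if_pos h1, if_pos h2]
      have : 0 ≤ (if i = l then (if Nb (k + 1) x S l j then |w (dist (x i) (x j))| else 0)
        else (0 : ℝ)) := by positivity
      linarith
  have hterm : ∀ i j, |w (dist (x i) (x j)) *
      (edgeCoef c k x S i j - edgeCoef c k x (S.erase l) i j)| ≤ a i j + a j i := fun i j => by
    rw [abs_mul]
    have hle1 : |edgeCoef c k x S i j - edgeCoef c k x (S.erase l) i j| ≤ 1 := by
      have h1 := edgeCoef_mem_Icc hc0 hc1 k x S i j
      have h2 := edgeCoef_mem_Icc hc0 hc1 k x (S.erase l) i j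
      rw [abs_le]; constructor <;> linarith [h1.1, h1.2, h2.1, h2.2]
    have hle : |w (dist (x i) (x j))| *
        |edgeCoef c k x S i j - edgeCoef c k x (S.erase l) i j| ≤ |w (dist (x i) (x j))| :=
      mul_le_of_le_one_right (abs_nonneg _) hle1
    by_cases h1 : Nb k x S i j ↔ Nb k x (S.erase l) i j
    · by_cases h2 : Nb k x S j i ↔ Nb k x (S.erase l) j i
      · have : edgeCoef c k x S i j = edgeCoef c k x (S.erase l) i j :=
          edgeCoef_congr h1 h2
        rw [this, sub_self, abs_zero, mul_zero]
        exact add_nonneg (ha0 _ _) (ha0 _ _)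
      · have := hchange j i h2
        rw [dist_comm] at this
        linarith [ha0 i j]
    · linarith [ha0 j i, hchange i j h1]
  rw [removal_eq_sum c k w x (Finset.Subset.refl S), ← hsum]
  calc |∑ i ∈ S, ∑ j ∈ S, w (dist (x i) (x j)) *
        (edgeCoef c k x S i j - edgeCoef c k x (S.erase l) i j)|
      ≤ ∑ i ∈ S, ∑ j ∈ S, (a i j + a j i) := by
        refine (Finset.abs_sum_le_sum_abs _ _).trans (Finset.sum_le_sum fun i _ => ?_)
        exact (Finset.abs_sum_le_sum_abs _ _).trans (Finset.sum_le_sum fun j _ => hterm i j)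
    _ = 2 * ∑ i ∈ S, ∑ j ∈ S, a i j := by
        simp only [Finset.sum_add_distrib]
        rw [Finset.sum_comm (f := fun i j => a j i)]
        ring

/-- General position: the points are distinct and no point is equidistant from two others. -/
def GenPos (x : ι → Pt d) : Prop :=
  Function.Injective x ∧
    ∀ i j l, j ≠ i → l ≠ i → j ≠ l → dist (x i) (x j) ≠ dist (x i) (x l)

open Classical in
/-- In general position there are no ties, and so at most `k` edges leave each point. -/
lemma card_out_le {k : ℕ} {x : ι → Pt d} (hx : GenPos x) (S : Finset ι) (i : ι) :
    (S.filter fun j => Nb k x S i j).card ≤ k := by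
  set T := S.filter fun j => Nb k x S i j with hT
  rcases T.eq_empty_or_nonempty with h | h
  · simp [h]
  obtain ⟨j, hj, hmax⟩ := T.exists_max_image (fun j => dist (x i) (x j)) h
  have hj' := (Finset.mem_filter.1 hj).2
  have hsub : T.erase j ⊆ closer x S i j := fun m hm => by
    rw [Finset.mem_erase] at hm
    have hm' := (Finset.mem_filter.1 hm.2).2
    exact mem_closer.2 ⟨hm'.2.1, hm'.2.2.1, lt_of_le_of_ne (hmax m hm.2)
      (hx.2 i m j hm'.2.2.1 hj'.2.2.1 hm.1)⟩
  have := (Finset.card_le_card hsub).trans_lt hj'.2.2.2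
  rw [Finset.card_erase_of_mem hj] at this
  omega

lemma nearSum_le {k : ℕ} {u : ℝ → ℝ} {B : ℝ} (hu : ∀ t, u t ≤ B) (hB : 0 ≤ B) {x : ι → Pt d}
    (hx : GenPos x) (S : Finset ι) (i : ι) : nearSum k u x S i ≤ k * B := by
  classical
  unfold nearSum
  rw [← Finset.sum_filter]
  refine (Finset.sum_le_card_nsmul _ _ B fun j _ => hu _).trans ?_
  rw [nsmul_eq_mul]
  exact mul_le_mul_of_nonneg_right (by exact_mod_cast card_out_le hx S i) hB

end Graph

section Cones

/-- If the directions of `u` and `v` make an angle less than `π / 3` and `u` is not longer than `v`,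
then `v` is closer to `u` than to the origin. -/
lemma dist_lt_of_angle {F : Type*} [NormedAddCommGroup F] [InnerProductSpace ℝ F] {u v : F}
    (hu : u ≠ 0) (hv : v ≠ 0) (huv : ‖u‖ ≤ ‖v‖) (h : ‖‖u‖⁻¹ • u - ‖v‖⁻¹ • v‖ < 1) :
    ‖v - u‖ < ‖v‖ := by
  have hu' : 0 < ‖u‖ := norm_pos_iff.2 hu
  have hv' : 0 < ‖v‖ := norm_pos_iff.2 hv
  have h1 : ‖‖u‖⁻¹ • u - ‖v‖⁻¹ • v‖ ^ 2 < 1 := by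
    rw [sq_lt_one_iff₀ (norm_nonneg _)]; exact h
  rw [norm_sub_sq_real, norm_smul, norm_smul, real_inner_smul_left, real_inner_smul_right,
    norm_inv, norm_inv, norm_norm, norm_norm, inv_mul_cancel₀ hu'.ne', inv_mul_cancel₀ hv'.ne']
    at h1
  set p := inner ℝ u v with hp
  have h2 : ‖u‖ * ‖v‖ < 2 * p := by
    have : 1 < 2 * (‖u‖⁻¹ * (‖v‖⁻¹ * p)) := by linarith
    have h3 := mul_lt_mul_of_pos_left this (mul_pos hu' hv')
    field_simp at h3
    linarith
  have h3 : ‖v - u‖ ^ 2 < ‖v‖ ^ 2 := by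
    rw [norm_sub_sq_real, real_inner_comm]
    nlinarith [mul_le_mul_of_nonneg_left huv hu'.le]
  exact lt_of_pow_lt_pow_left₀ 2 (norm_nonneg _) h3

/-- Finitely many caps of radius `1 / 2` cover the unit sphere; the directions in one of them are at
distance less than `1` from each other. -/
lemma exists_cone_cover (d : ℕ) : ∃ V : Finset (Pt d), ∀ u : Pt d, u ≠ 0 →
    ∃ v ∈ V, ‖‖u‖⁻¹ • u - v‖ < 1 / 2 := by
  obtain ⟨t, -, ht, hcov⟩ := Metric.totallyBounded_iff.1
    (isCompact_sphere (0 : Pt d) 1).totallyBounded (1 / 2) (by norm_num) |>.imp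
      fun t ht => (⟨Set.subset_univ t, ht.1, ht.2⟩ : t ⊆ Set.univ ∧ t.Finite ∧ _)
  refine ⟨ht.toFinset, fun u hu => ?_⟩
  have : ‖u‖⁻¹ • u ∈ Metric.sphere (0 : Pt d) 1 := by
    rw [mem_sphere_zero_iff_norm, norm_smul, norm_inv, norm_norm,
      inv_mul_cancel₀ (norm_ne_zero_iff.2 hu)]
  obtain ⟨v, hv, hv'⟩ := Set.mem_iUnion₂.1 (hcov this)
  exact ⟨v, by simpa using hv, by simpa [dist_eq_norm] using hv'⟩

/-- The number of cones used to cover `ℝ ^ d`, each so narrow that two of its directions make an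
angle less than `π / 3`. -/
noncomputable def coneNumber (d : ℕ) : ℕ := (exists_cone_cover d).choose.card

variable {d : ℕ} {ι : Type*}

open Classical in
/-- A point is among the `k` nearest neighbours of at most `k` points in each cone: of the points
in a narrow cone with apex `l`, the farthest one is closer to all the others than to `l`. -/
lemma card_in_le {k : ℕ} {x : ι → Pt d} (hx : Function.Injective x) (S : Finset ι) (l : ι) :
    (S.filter fun i => Nb k x S i l).card ≤ coneNumber d * k := by
  set V := (exists_cone_cover d).choose with hV
  have hVs := (exists_cone_cover d).choose_spec
  set T := S.filter fun i => Nb k x S i l with hT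
  let Tv : Pt d → Finset ι := fun v => T.filter fun i => ‖‖x i - x l‖⁻¹ • (x i - x l) - v‖ < 1 / 2
  have hne : ∀ i ∈ T, x i - x l ≠ 0 := fun i hi =>
    sub_ne_zero.2 fun h => (Finset.mem_filter.1 hi).2.2.2.1 (hx h).symm
  have hcov : T ⊆ V.biUnion Tv := fun i hi => by
    obtain ⟨v, hv, hv'⟩ := hVs (x i - x l) (hne i hi)
    exact Finset.mem_biUnion.2 ⟨v, hv, Finset.mem_filter.2 ⟨hi, hv'⟩⟩
  refine (Finset.card_le_card hcov).trans (Finset.card_biUnion_le_card_mul _ _ _ fun v _ => ?_)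
  rcases (Tv v).eq_empty_or_nonempty with h | h
  · simp [h]
  obtain ⟨i, hi, hmax⟩ := (Tv v).exists_max_image (fun i => ‖x i - x l‖) h
  have hiT := Finset.mem_filter.1 hi
  have hiN := (Finset.mem_filter.1 hiT.1).2
  have hsub : (Tv v).erase i ⊆ closer x S i l := fun m hm => by
    rw [Finset.mem_erase] at hm
    have hmT := Finset.mem_filter.1 hm.2
    have hmN := (Finset.mem_filter.1 hmT.1).2
    refine mem_closer.2 ⟨hmN.1, hm.1, ?_⟩
    have hang : ‖‖x m - x l‖⁻¹ • (x m - x l) - ‖x i - x l‖⁻¹ • (x i - x l)‖ < 1 := by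
      have h1 := hmT.2
      have h2 := hiT.2
      rw [← norm_neg, neg_sub] at h2
      have := norm_add_le (‖x m - x l‖⁻¹ • (x m - x l) - v) (v - ‖x i - x l‖⁻¹ • (x i - x l))
      rw [sub_add_sub_cancel] at this
      linarith
    have := dist_lt_of_angle (hne m hmT.1) (hne i hiT.1) (hmax m hm.2) hang
    rwa [sub_sub_sub_cancel_right, ← dist_eq_norm, ← dist_eq_norm] at this
  have := (Finset.card_le_card hsub).trans_lt hiN.2.2.2
  rw [Finset.card_erase_of_mem hi] at this
  omega

variable [DecidableEq ι]

/-- A bound for the effect of removing a point, per unit of edge weight. -/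
noncomputable def removalConst (d k : ℕ) : ℝ := 2 * ((k + 1) * (1 + coneNumber d * k))

lemma removalConst_nonneg (d k : ℕ) : 0 ≤ removalConst d k := by
  unfold removalConst; positivity

lemma abs_removal_le_const {c : ℝ} (hc0 : 0 ≤ c) (hc1 : c ≤ 1) {k : ℕ} {w : ℝ → ℝ} {B : ℝ}
    (hw : ∀ t, |w t| ≤ B) {x : ι → Pt d} (hx : GenPos x) (S : Finset ι) (l : ι) :
    |removal c k w x S l| ≤ removalConst d k * B := by
  classical
  have hB : 0 ≤ B := (abs_nonneg _).trans (hw 0)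
  by_cases hl : l ∈ S
  swap
  · rw [removal_of_notMem hl, abs_zero]
    exact mul_nonneg (removalConst_nonneg d k) hB
  refine (abs_removal_le hc0 hc1 hl).trans ?_
  have h1 : ∀ i, nearSum (k + 1) (fun t => |w t|) x S i ≤ (k + 1) * B := fun i => by
    simpa using nearSum_le (k := k + 1) hw hB hx S i
  have h2 : (∑ i ∈ S, if Nb k x S i l then nearSum (k + 1) (fun t => |w t|) x S i else 0) ≤
      (coneNumber d * k : ℝ) * ((k + 1) * B) := by
    rw [← Finset.sum_filter]
    refine (Finset.sum_le_card_nsmul _ _ _ fun i _ => h1 i).trans ?_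
    rw [nsmul_eq_mul]
    refine mul_le_mul_of_nonneg_right ?_ (by positivity)
    exact_mod_cast card_in_le hx.1 S l
  unfold removalConst
  nlinarith [h1 l]

/-- The squared effects of removing a point, summed over all points. -/
lemma sum_sq_removal_le {c : ℝ} (hc0 : 0 ≤ c) (hc1 : c ≤ 1) {k : ℕ} {w : ℝ → ℝ}
    {x : ι → Pt d} (hx : GenPos x) (S : Finset ι) :
    ∑ l ∈ S, removal c k w x S l ^ 2 ≤ 4 * (1 + coneNumber d * k) * (1 + k) * (k + 1) *
      ∑ i ∈ S, nearSum (k + 1) (fun t => w t ^ 2) x S i := by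
  classical
  set D : ℝ := coneNumber d * k with hD
  set M : ι → ℝ := fun i => nearSum (k + 1) (fun t => |w t|) x S i with hM
  set N : ι → ℝ := fun i => nearSum (k + 1) (fun t => w t ^ 2) x S i with hN
  have hMN : ∀ i, M i ^ 2 ≤ (k + 1) * N i := fun i => by
    simp only [hM, hN, nearSum, ← Finset.sum_filter]
    refine (sq_sum_le_card_mul_sum_sq).trans ?_
    simp only [sq_abs]
    refine mul_le_mul_of_nonneg_right ?_ (Finset.sum_nonneg fun _ _ => sq_nonneg _)
    exact_mod_cast card_out_le (k := k + 1) hx S i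
  have hN0 : ∀ i, 0 ≤ N i := fun i =>
    Finset.sum_nonneg fun j _ => by split_ifs <;> positivity
  have hpt : ∀ l ∈ S, removal c k w x S l ^ 2 ≤
      4 * (1 + D) * (M l ^ 2 + ∑ i ∈ S, if Nb k x S i l then M i ^ 2 else 0) := fun l hl => by
    have h1 := abs_removal_le (w := w) (x := x) (k := k) hc0 hc1 hl
    rw [← Finset.sum_filter] at h1 ⊢
    set T := S.filter fun i => Nb k x S i l
    have hcard : (T.card : ℝ) ≤ D := by
      rw [hD]; exact_mod_cast card_in_le hx.1 S l
    have hcs : (∑ i ∈ T, M i) ^ 2 ≤ T.card * ∑ i ∈ T, M i ^ 2 := sq_sum_le_card_mul_sum_sq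
    have h0 : 0 ≤ ∑ i ∈ T, M i ^ 2 := Finset.sum_nonneg fun _ _ => sq_nonneg _
    have hcs' : (∑ i ∈ T, M i) ^ 2 ≤ D * ∑ i ∈ T, M i ^ 2 :=
      hcs.trans (mul_le_mul_of_nonneg_right hcard h0)
    have hD0 : 0 ≤ D := (Nat.cast_nonneg _).trans hcard
    have h2 : removal c k w x S l ^ 2 ≤ (2 * (M l + ∑ i ∈ T, M i)) ^ 2 :=
      sq_le_sq.2 (h1.trans (le_abs_self _))
    refine h2.trans ?_
    -- Cauchy–Schwarz: `(a + b) ^ 2 ≤ (1 + D) * (a ^ 2 + Q)` as soon as `b ^ 2 ≤ D * Q`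
    set a := M l
    set b := ∑ i ∈ T, M i
    set Q := ∑ i ∈ T, M i ^ 2
    have h3 : (2 * a * b) ≤ D * a ^ 2 + Q := by
      rcases hD0.eq_or_lt with h | h
      · rw [← h] at hcs'
        have : b = 0 := by
          have : b ^ 2 ≤ 0 := by linarith
          exact pow_eq_zero_iff (two_ne_zero) |>.1 (le_antisymm this (sq_nonneg b))
        rw [this]; nlinarith [sq_nonneg a]
      · have : 0 ≤ (D * a - b) ^ 2 := sq_nonneg _
        have h4 : D * (2 * a * b) ≤ D * (D * a ^ 2 + Q) := by nlinarith
        exact le_of_mul_le_mul_left h4 h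
    nlinarith
  have hout : ∀ i, ((S.filter fun l => Nb k x S i l).card : ℝ) ≤ k := fun i => by
    exact_mod_cast card_out_le hx S i
  have hswap : ∑ l ∈ S, ∑ i ∈ S, (if Nb k x S i l then M i ^ 2 else 0) ≤
      k * ∑ i ∈ S, M i ^ 2 := by
    rw [Finset.sum_comm, Finset.mul_sum]
    refine Finset.sum_le_sum fun i _ => ?_
    rw [← Finset.sum_filter, Finset.sum_const, nsmul_eq_mul]
    exact mul_le_mul_of_nonneg_right (hout i) (sq_nonneg _)
  have hD0 : 0 ≤ D := by positivity
  calc ∑ l ∈ S, removal c k w x S l ^ 2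
      ≤ ∑ l ∈ S, 4 * (1 + D) * (M l ^ 2 + ∑ i ∈ S, if Nb k x S i l then M i ^ 2 else 0) :=
        Finset.sum_le_sum hpt
    _ = 4 * (1 + D) * (∑ l ∈ S, M l ^ 2 +
          ∑ l ∈ S, ∑ i ∈ S, if Nb k x S i l then M i ^ 2 else 0) := by
        rw [← Finset.mul_sum, Finset.sum_add_distrib]
    _ ≤ 4 * (1 + D) * ((1 + k) * ∑ i ∈ S, M i ^ 2) := by
        refine mul_le_mul_of_nonneg_left ?_ (by positivity)
        linarith
    _ ≤ 4 * (1 + D) * ((1 + k) * ∑ i ∈ S, (k + 1) * N i) := by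
        gcongr with i _
        exact hMN i
    _ = _ := by rw [← Finset.mul_sum]; ring

end Cones

/-! ### Samples in general position and measurability -/

section Resampling

variable {E : Type*} [MeasurableSpace E] (μ : Measure E) [IsProbabilityMeasure μ]
  {ι : Type*} [Fintype ι]

lemma pi_real_pair {i l : ι} (hil : i ≠ l) {R : Set (E × E)} (hR : MeasurableSet R) :
    (Measure.pi fun _ : ι => μ).real {z | (z i, z l) ∈ R} = (μ.prod μ).real R := by
  have := Measure.infinitePi_map_eval_prod (P := fun _ : ι => μ) hil
  rw [Measure.infinitePi_eq_pi] at this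
  rw [← this, map_measureReal_apply (by fun_prop) hR]
  rfl

lemma pi_real_single (i : ι) {R : Set E} (hR : MeasurableSet R) :
    (Measure.pi fun _ : ι => μ).real {z | z i ∈ R} = μ.real R := by
  have := (measurePreserving_eval (fun _ : ι => μ) i)
  rw [← this.map_eq, map_measureReal_apply (by fun_prop) hR, this.map_eq]
  rfl

variable [DecidableEq ι]

/-- Resampling one coordinate of an i.i.d. family does not change its law. -/
lemma measurePreserving_update (j : ι) :
    MeasurePreserving (fun p : E × (ι → E) => Function.update p.2 j p.1)
      (μ.prod (Measure.pi fun _ => μ)) (Measure.pi fun _ => μ) := by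
  have hm : Measurable (fun p : E × (ι → E) => Function.update p.2 j p.1) := by
    refine measurable_pi_lambda _ fun i => ?_
    by_cases h : i = j
    · subst h; simpa using measurable_fst
    · simp only [Function.update_of_ne h]; fun_prop
  refine ⟨hm, (Measure.pi_eq fun s hs => ?_).symm⟩
  rw [Measure.map_apply hm (MeasurableSet.univ_pi hs)]
  have : (fun p : E × (ι → E) => Function.update p.2 j p.1) ⁻¹' (Set.univ.pi s) =
      (s j) ×ˢ (Set.univ.pi (Function.update s j Set.univ)) := by
    ext ⟨y, x⟩
    simp only [Set.mem_preimage, Set.mem_pi, Set.mem_univ, true_imp_iff, Set.mem_prod]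
    constructor
    · intro h
      refine ⟨by simpa using h j, fun i => ?_⟩
      by_cases hi : i = j
      · subst hi; simp
      · simpa [Function.update_of_ne hi] using h i
    · rintro ⟨h1, h2⟩ i
      by_cases hi : i = j
      · subst hi; simpa using h1
      · simpa [Function.update_of_ne hi] using h2 i
  rw [this, Measure.prod_prod, Measure.pi_pi,
    ← Finset.mul_prod_erase Finset.univ (fun i => μ (Function.update s j Set.univ i))
      (Finset.mem_univ j), ← Finset.mul_prod_erase Finset.univ (fun i => μ (s i))
      (Finset.mem_univ j)]
  simp only [Function.update_self, measure_univ, one_mul]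
  congr 1
  refine Finset.prod_congr rfl fun i hi => ?_
  rw [Function.update_of_ne (Finset.ne_of_mem_erase hi)]

/-- A set of configurations is a null set if, whatever the other coordinates are, almost no choice
of the coordinate `j` leads into it. -/
lemma pi_eq_zero_of_update {A : Set (ι → E)} (hA : MeasurableSet A) (j : ι)
    (h : ∀ x, μ {y | Function.update x j y ∈ A} = 0) : (Measure.pi fun _ => μ) A = 0 := by
  rw [← (measurePreserving_update μ j).map_eq,
    Measure.map_apply (measurePreserving_update μ j).measurable hA,
    Measure.prod_apply_symm ((measurePreserving_update μ j).measurable hA)]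
  exact (lintegral_congr fun x => h x).trans lintegral_zero

end Resampling

section GeneralPosition

variable {d : ℕ} {E : Type*} [MeasurableSpace E] (μ : Measure E) [IsProbabilityMeasure μ]
  {ι : Type*} [Fintype ι] [DecidableEq ι]

/-- Independent points with a common absolutely continuous law are in general position. -/
lemma ae_genPos (hd : 1 ≤ d) {φ : E → Pt d} (hφ : Measurable φ)
    (hac : μ.map φ ≪ (volume : Measure (Pt d))) :
    ∀ᵐ z ∂(Measure.pi fun _ : ι => μ), GenPos (fun i => φ (z i)) := by
  have : Nonempty (Fin d) := ⟨⟨0, hd⟩⟩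
  have hsph : ∀ (a : Pt d) (r : ℝ), μ {y | dist a (φ y) = r} = 0 := fun a r => by
    have h1 : {y | dist a (φ y) = r} = φ ⁻¹' (Metric.sphere a r) := by
      ext y; rw [Set.mem_preimage, Metric.mem_sphere, dist_comm]; rfl
    rw [h1, ← Measure.map_apply hφ Metric.isClosed_sphere.measurableSet]
    exact hac (Measure.addHaar_sphere _ _ _)
  unfold GenPos
  refine ae_iff.2 ?_ |>.mono (p := fun z => ∀ i l, i ≠ l → dist (φ (z l)) (φ (z i)) ≠ 0)
    (fun z h => fun i l hil => by
      by_contra hne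
      exact h i l hne (by rw [show φ (z i) = φ (z l) from hil, dist_self])) |>.and ?_
  · rw [← ae_iff]
    refine ae_all_iff.2 fun i => ae_all_iff.2 fun l => ?_
    by_cases hil : i = l
    · simp [hil]
    rw [ae_iff]
    have : {z : ι → E | ¬ (i ≠ l → dist (φ (z l)) (φ (z i)) ≠ 0)}
        = {z | dist (φ (z l)) (φ (z i)) = 0} := by
      ext z; simp [hil]
    rw [this]
    refine pi_eq_zero_of_update μ (measurableSet_eq_fun (by fun_prop) (by fun_prop)) i fun x => ?_
    simp only [Set.mem_ofPred_eq, Function.update_self, Function.update_of_ne (Ne.symm hil)]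
    exact hsph _ _
  · refine ae_all_iff.2 fun i => ae_all_iff.2 fun j => ae_all_iff.2 fun l => ?_
    by_cases h : j ≠ i ∧ l ≠ i ∧ j ≠ l
    swap
    · exact Eventually.of_forall fun z h1 h2 h3 => absurd ⟨h1, h2, h3⟩ h
    rw [ae_iff]
    have : {z : ι → E | ¬ (j ≠ i → l ≠ i → j ≠ l →
        dist (φ (z i)) (φ (z j)) ≠ dist (φ (z i)) (φ (z l)))}
        = {z | dist (φ (z i)) (φ (z j)) = dist (φ (z i)) (φ (z l))} := by
      ext z; simp [h]
    rw [this]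
    refine pi_eq_zero_of_update μ (measurableSet_eq_fun (by fun_prop) (by fun_prop)) j fun x => ?_
    simp only [Set.mem_ofPred_eq, Function.update_self, Function.update_of_ne h.1.symm,
      Function.update_of_ne h.2.2.symm]
    exact hsph _ _

end GeneralPosition

section Measurability

variable {d : ℕ} {α : Type*} [MeasurableSpace α] {ι : Type*}

lemma measurableSet_nb (k : ℕ) {φ : ι → α → Pt d} (hφ : ∀ i, Measurable (φ i)) (S : Finset ι)
    (i j : ι) : MeasurableSet {z | Nb k (fun a => φ a z) S i j} := by
  classical
  have hcard : Measurable fun z => (closer (fun a => φ a z) S i j).card := by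
    have : (fun z => (closer (fun a => φ a z) S i j).card) = fun z =>
        ∑ l ∈ S, if l ≠ i ∧ dist (φ i z) (φ l z) < dist (φ i z) (φ j z) then 1 else 0 := by
      funext z
      rw [closer, Finset.card_filter]
    rw [this]
    refine Finset.measurable_sum _ fun l _ => Measurable.ite ?_ measurable_const measurable_const
    exact (MeasurableSet.const _).inter <|
      measurableSet_lt ((hφ i).dist (hφ l)) ((hφ i).dist (hφ j))
  exact (MeasurableSet.const _).inter ((MeasurableSet.const _).inter ((MeasurableSet.const _).inter
    (measurableSet_lt hcard measurable_const)))

lemma measurable_graphSum (c : ℝ) (k : ℕ) {w : ℝ → ℝ} (hw : Measurable w) {φ : ι → α → Pt d}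
    (hφ : ∀ i, Measurable (φ i)) (S : Finset ι) :
    Measurable fun z => graphSum c k w (fun a => φ a z) S := by
  classical
  unfold graphSum edgeCoef
  refine Finset.measurable_sum _ fun i _ => Finset.measurable_sum _ fun j _ => ?_
  refine (hw.comp ((hφ i).dist (hφ j))).mul ((Measurable.ite (measurableSet_nb k hφ S i j)
    measurable_const measurable_const).sub (Measurable.const_mul (Measurable.ite
      ((measurableSet_nb k hφ S i j).inter (measurableSet_nb k hφ S j i))
      measurable_const measurable_const) c))

lemma bddMeas_graphSum {c : ℝ} (hc0 : 0 ≤ c) (hc1 : c ≤ 1) (k : ℕ) {w : ℝ → ℝ} (hw : BddMeas w)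
    {φ : ι → α → Pt d} (hφ : ∀ i, Measurable (φ i)) (S : Finset ι) :
    BddMeas fun z => graphSum c k w (fun a => φ a z) S := by
  obtain ⟨hm, B, hB⟩ := hw
  exact ⟨measurable_graphSum c k hm hφ S, _, fun z => abs_graphSum_le hc0 hc1 hB _ S⟩

end Measurability

lemma graphSum_erase_update {d : ℕ} {ι E : Type*} [DecidableEq ι] (c : ℝ) (k : ℕ) (w : ℝ → ℝ)
    (φ : E → Pt d) (S : Finset ι) (i : ι) (z : ι → E) (y : E) :
    graphSum c k w (fun a => φ (Function.update z i y a)) (S.erase i) =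
      graphSum c k w (fun a => φ (z a)) (S.erase i) :=
  graphSum_congr fun a ha => by rw [Function.update_of_ne (Finset.ne_of_mem_erase ha)]

/-! ### Long edges -/

section Truncation

/-- The edge length, with long edges switched off continuously: `t` for `0 ≤ t ≤ R`, decreasing to
`0` at `2 * R`. -/
noncomputable def trunc (R t : ℝ) : ℝ := max 0 (min t (2 * R - t))

lemma trunc_nonneg (R t : ℝ) : 0 ≤ trunc R t := le_max_left _ _

lemma trunc_le {R : ℝ} (hR : 0 ≤ R) (t : ℝ) : trunc R t ≤ R := by
  unfold trunc
  refine max_le hR ?_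
  rcases le_total t R with h | h
  · exact (min_le_left _ _).trans h
  · exact (min_le_right _ _).trans (by linarith)

lemma trunc_eq_zero {R t : ℝ} (h : 2 * R < t) : trunc R t = 0 := by
  unfold trunc
  exact max_eq_left ((min_le_right _ _).trans (by linarith))

lemma trunc_eq_self {R t : ℝ} (h0 : 0 ≤ t) (h : t ≤ R) : trunc R t = t := by
  unfold trunc
  rw [min_eq_left (by linarith), max_eq_right h0]

lemma trunc_le_self {R t : ℝ} (h0 : 0 ≤ t) : trunc R t ≤ t :=
  max_le h0 (min_le_left _ _)

lemma measurable_trunc (R : ℝ) : Measurable (trunc R) := by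
  unfold trunc; fun_prop

lemma abs_trunc_le {R : ℝ} (hR : 0 ≤ R) (t : ℝ) : |trunc R t| ≤ R := by
  rw [abs_of_nonneg (trunc_nonneg R t)]; exact trunc_le hR t

lemma bddMeas_trunc {R : ℝ} (hR : 0 ≤ R) : BddMeas (trunc R) :=
  ⟨measurable_trunc R, R, abs_trunc_le hR⟩

lemma abs_trunc_sub_le (R a b : ℝ) : |trunc R a - trunc R b| ≤ |a - b| := by
  unfold trunc
  refine (abs_max_sub_max_le_max _ _ _ _).trans ?_
  rw [sub_self, abs_zero, max_eq_right (abs_nonneg _)]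
  refine (abs_min_sub_min_le_max _ _ _ _).trans (max_le le_rfl ?_)
  rw [show 2 * R - a - (2 * R - b) = -(a - b) by ring, abs_neg]

end Truncation

open Classical in
lemma bddMeas_nearSum {d : ℕ} {ι : Type*} (k : ℕ) {u : ℝ → ℝ} (hu : BddMeas u) {α : Type*}
    [MeasurableSpace α] {φ : ι → α → Pt d} (hφ : ∀ i, Measurable (φ i)) (S : Finset ι) (i : ι) :
    BddMeas fun z => nearSum k u (fun a => φ a z) S i := by
  unfold nearSum
  refine BddMeas.sum _ fun j _ => ?_
  obtain ⟨hum, B, hB⟩ := hu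
  refine ⟨Measurable.ite (measurableSet_nb k hφ S i j)
    (hum.comp ((hφ i).dist (hφ j))) measurable_const, B, fun z => ?_⟩
  dsimp only
  split_ifs
  · exact hB _
  · simpa using (abs_nonneg _).trans (hB 0)

section Tails

variable {d : ℕ} {ι : Type*} [Fintype ι] [DecidableEq ι]

/-- The expectation of `2 ^ (-N)`, where `N` is the number of the points other than `i` in `A`. -/
lemma integral_prod_one_sub_half {E : Type*} [MeasurableSpace E] (μ : Measure E)
    [IsProbabilityMeasure μ] {A : Set E} (hA : MeasurableSet A) (i : ι) :
    ∫ z, ∏ l ∈ Finset.univ.erase i, (1 - 1 / 2 * A.indicator (fun _ => (1 : ℝ)) (z l))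
      ∂(Measure.pi fun _ : ι => μ) = (1 - 1 / 2 * μ.real A) ^ (Fintype.card ι - 1) := by
  let h : ι → E → ℝ := fun l y =>
    if l = i then 1 else (1 - 1 / 2 * A.indicator (fun _ => (1 : ℝ)) y)
  have h1 : ∀ z : ι → E, ∏ l ∈ Finset.univ.erase i,
      (1 - 1 / 2 * A.indicator (fun _ => (1 : ℝ)) (z l)) = ∏ l, h l (z l) := fun z => by
    rw [← Finset.mul_prod_erase Finset.univ _ (Finset.mem_univ i)]
    simp only [h, if_true, one_mul]
    exact Finset.prod_congr rfl fun l hl => by rw [if_neg (Finset.ne_of_mem_erase hl)]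
  rw [integral_congr_ae (Eventually.of_forall h1),
    integral_fintype_prod_eq_prod (μ := fun _ : ι => μ) h,
    ← Finset.mul_prod_erase Finset.univ _ (Finset.mem_univ i)]
  simp only [h]
  simp only [if_true, integral_const, probReal_univ, smul_eq_mul, one_mul]
  rw [Finset.prod_congr rfl (g := fun _ => 1 - 1 / 2 * μ.real A), Finset.prod_const,
    Finset.card_erase_of_mem (Finset.mem_univ i), Finset.card_univ]
  intro l hl
  simp only [if_neg (Finset.ne_of_mem_erase hl)]
  rw [integral_sub (integrable_const _) (((integrable_const _).indicator hA).const_mul _),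
    integral_const_mul, integral_indicator_const _ hA]
  simp

/-- If at most `k` of the other points are within distance `t` of the point `i`, the product below
is at least `2 ^ (-k)`. -/
lemma indicator_le_prod {x : ι → Pt d} {i : ι} {t : ℝ} {k : ℕ} {S : Finset ι}
    (hS : ∀ l, l ∈ S ↔ l ≠ i ∧ dist (x i) (x l) ≤ t) (hk : S.card ≤ k) :
    (1 : ℝ) ≤ 2 ^ k * ∏ l ∈ Finset.univ.erase i,
      (1 - 1 / 2 * (Metric.closedBall (x i) t).indicator (fun _ => (1 : ℝ)) (x l)) := by
  classical
  have h1 : ∀ l ∈ Finset.univ.erase i,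
      (1 - 1 / 2 * (Metric.closedBall (x i) t).indicator (fun _ => (1 : ℝ)) (x l))
      = if l ∈ S then (1 / 2 : ℝ) else 1 := fun l hl => by
    have hne := Finset.ne_of_mem_erase hl
    by_cases h : l ∈ S
    · have := ((hS l).1 h).2
      rw [Set.indicator_of_mem (by rwa [Metric.mem_closedBall, dist_comm]), if_pos h]
      norm_num
    · have : ¬ dist (x i) (x l) ≤ t := fun h' => h ((hS l).2 ⟨hne, h'⟩)
      rw [Set.indicator_of_notMem (by rwa [Metric.mem_closedBall, dist_comm]), if_neg h]
      norm_num
  rw [Finset.prod_congr rfl h1, Finset.prod_ite, Finset.prod_const, Finset.prod_const_one, mul_one]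
  have h2 : ((Finset.univ.erase i).filter fun l => l ∈ S).card ≤ k :=
    (Finset.card_le_card fun l hl => (Finset.mem_filter.1 hl).2).trans hk
  have h3 : (1 / 2 : ℝ) ^ k ≤ (1 / 2) ^ ((Finset.univ.erase i).filter fun l => l ∈ S).card :=
    pow_le_pow_of_le_one (by norm_num) (by norm_num) h2
  calc (1 : ℝ) = 2 ^ k * (1 / 2) ^ k := by rw [← mul_pow]; norm_num
    _ ≤ _ := by gcongr

lemma ae_genPos_smul (F : Measure (Pt d)) [IsProbabilityMeasure F] (hd : 1 ≤ d) (hac : F ≪ volume)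
    {s : ℝ} (hs : 0 < s) :
    ∀ᵐ z ∂(Measure.pi fun _ : ι => F), GenPos (fun a => s • z a) :=
  ae_genPos F hd (φ := fun y => s • y) (by fun_prop) (by
    refine (hac.map (by fun_prop)).trans ?_
    rw [Measure.map_addHaar_smul volume hs.ne']
    exact Measure.smul_absolutelyContinuous)

/-- A bound, up to a constant, for the contribution to the second moment of the edges of length
between `t` and `t + 1`. -/
noncomputable def tailTerm (γ : ℝ) (t : ℕ) : ℝ := ((t : ℝ) + 1) ^ 2 * Real.exp (-(γ * t / 4))

lemma summable_tailTerm {γ : ℝ} (hγ : 0 < γ) : Summable (tailTerm γ) := by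
  have h1 : Summable fun t : ℕ => ((t : ℝ) + 1) ^ 2 * Real.exp (-(γ / 4)) ^ (t + 1) := by
    have := (summable_nat_add_iff 1).2 (summable_pow_mul_geometric_of_norm_lt_one 2
      (r := Real.exp (-(γ / 4))) (by
        rw [Real.norm_of_nonneg (Real.exp_pos _).le, Real.exp_lt_one_iff]; linarith))
    simpa using this
  refine (h1.mul_left (Real.exp (γ / 4))).congr fun t => ?_
  rw [tailTerm, ← Real.exp_nat_mul, mul_left_comm, ← Real.exp_add]
  congr 2
  push_cast; ring

variable (F : Measure (Pt d)) [IsProbabilityMeasure F]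

/-- Uniform control of the long edges: the expected sum of `u (length)` over the nearest neighbours
of a point, when `u` is at most quadratic and vanishes on `[0, R]`. -/
lemma integral_nearSum_le (hd : 1 ≤ d) (hac : F ≪ volume) {C : Set (Pt d)} (hC : F Cᶜ = 0)
    {Δ γ : ℝ} (hΔ : ∀ x ∈ C, ∀ y ∈ C, dist x y ≤ Δ) (hγ : 0 < γ)
    (hF : ∀ x ∈ C, ∀ r, 0 < r → r ≤ Δ → γ * r ^ d ≤ F.real (Metric.closedBall x r))
    (k : ℕ) {s : ℝ} (hs : 0 < s) (hcard : 2 ≤ Fintype.card ι) (hsn : s ^ d = Fintype.card ι)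
    {R : ℕ} (hR : 1 ≤ R) {u : ℝ → ℝ} (hu : BddMeas u)
    (huR : ∀ t, 0 ≤ t → t ≤ s * Δ → u t ≤ if (R : ℝ) < t then t ^ 2 else 0) (i : ι) :
    ∫ z, nearSum (k + 1) u (fun a => s • z a) Finset.univ i ∂(Measure.pi fun _ : ι => F) ≤
      (k + 1) * 2 ^ k * ∑' t, tailTerm γ (t + R) := by
  classical
  set P := (Measure.pi fun _ : ι => F)
  set T := ⌈s * Δ⌉₊
  -- `G t` is `2 ^ (-N)` for the number `N` of the points at distance at most `t / s` from `i`. If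
  -- an edge leaving `i` has a length greater than `t` after dilation by `s`, then `N ≤ k`.
  let G : ℕ → (ι → Pt d) → ℝ := fun t z => ∏ l ∈ Finset.univ.erase i,
    (1 - 1 / 2 * (Metric.closedBall (z i) (t / s)).indicator (fun _ => (1 : ℝ)) (z l))
  have hGm : ∀ t, BddMeas (G t) := fun t => by
    refine ⟨Finset.measurable_prod _ fun l _ => ?_, 1, fun z => ?_⟩
    · have : (fun z : ι → Pt d =>
          (Metric.closedBall (z i) (t / s)).indicator (fun _ => (1 : ℝ)) (z l)) =
          {z : ι → Pt d | dist (z l) (z i) ≤ t / s}.indicator fun _ => 1 := by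
        funext z; simp only [Set.indicator, Metric.mem_closedBall]; rfl
      refine measurable_const.sub (Measurable.const_mul ?_ _)
      rw [this]
      exact measurable_const.indicator (measurableSet_le (by fun_prop) measurable_const)
    · rw [Finset.abs_prod]
      refine Finset.prod_le_one (fun _ _ => abs_nonneg _) fun l _ => ?_
      simp only [Set.indicator]
      split_ifs <;> norm_num
  have hG0 : ∀ t z, 0 ≤ G t z := fun t z => Finset.prod_nonneg fun l _ => by
    simp only [Set.indicator]
    split_ifs <;> norm_num
  -- the expected value of the product decays exponentially
  have hGint : ∀ t : ℕ, 1 ≤ t → (t : ℝ) ≤ s * Δ → ∫ z, G t z ∂P ≤ Real.exp (-(γ * t / 4)) := by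
    intro t ht htT
    have hmp := measurePreserving_update F i
    change ∫ z, G t z ∂(Measure.pi fun _ : ι => F) ≤ _
    rw [← hmp.map_eq, integral_map hmp.measurable.aemeasurable
      (hGm t).1.aestronglyMeasurable, integral_prod _ (((hGm t).comp hmp.measurable).integrable _)]
    have hinner : ∀ y, ∫ z, G t (Function.update z i y) ∂P =
        (1 - 1 / 2 * F.real (Metric.closedBall y (t / s))) ^ (Fintype.card ι - 1) := fun y => by
      rw [← integral_prod_one_sub_half F Metric.isClosed_closedBall.measurableSet i]
      refine integral_congr_ae (Eventually.of_forall fun z => Finset.prod_congr rfl fun l hl => ?_)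
      simp only [Function.update_self, Function.update_of_ne (Finset.ne_of_mem_erase hl)]
    change ∫ y, ∫ z, G t (Function.update z i y) ∂P ∂F ≤ _
    simp_rw [hinner]
    have hbound : ∀ᵐ y ∂F, (1 - 1 / 2 * F.real (Metric.closedBall y (t / s))) ^
        (Fintype.card ι - 1) ≤ Real.exp (-(γ * t / 4)) := by
      have hCae : ∀ᵐ y ∂F, y ∈ C := hC
      filter_upwards [hCae] with y hy
      have htpos : (0 : ℝ) < t := by exact_mod_cast ht
      have hm := hF y hy (t / s) (by positivity) (by rw [div_le_iff₀ hs]; linarith)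
      have h1 : F.real (Metric.closedBall y (t / s)) ≤ 1 := measureReal_le_one
      set q := F.real (Metric.closedBall y (t / s))
      have hn0 : (0 : ℝ) < Fintype.card ι := by positivity
      have hq : γ * t / Fintype.card ι ≤ q := by
        refine le_trans ?_ hm
        rw [div_pow, hsn, ← mul_div_assoc]
        have : (t : ℝ) ≤ t ^ d := le_self_pow₀ (by exact_mod_cast ht) (by omega)
        gcongr
      calc (1 - 1 / 2 * q) ^ (Fintype.card ι - 1)
          ≤ Real.exp (-(1 / 2 * q)) ^ (Fintype.card ι - 1) := by
            refine pow_le_pow_left₀ (by linarith) ?_ _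
            have := Real.add_one_le_exp (-(1 / 2 * q))
            linarith
        _ = Real.exp (-(((Fintype.card ι - 1 : ℕ) : ℝ) * (1 / 2 * q))) := by
            rw [← Real.exp_nat_mul]; congr 1; ring
        _ ≤ _ := by
            rw [Real.exp_le_exp, neg_le_neg_iff]
            have h2 : (Fintype.card ι : ℝ) / 2 ≤ ((Fintype.card ι - 1 : ℕ) : ℝ) := by
              rw [Nat.cast_sub (by omega)]
              have : (2 : ℝ) ≤ Fintype.card ι := by exact_mod_cast hcard
              push_cast; linarith
            calc γ * t / 4 = (Fintype.card ι : ℝ) / 2 * (1 / 2 * (γ * t / Fintype.card ι)) := by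
                  field_simp; norm_num
              _ ≤ _ := by
                  refine mul_le_mul h2 (by linarith) (by positivity) (by positivity)
    refine (integral_mono_of_nonneg (Eventually.of_forall fun y => ?_) (integrable_const _)
      hbound).trans (by simp)
    refine pow_nonneg ?_ _
    have : F.real (Metric.closedBall y (t / s)) ≤ 1 := measureReal_le_one
    linarith
  -- an edge of length in `(t, t + 1]` contributes at most `(t + 1) ^ 2`, and forces
  -- `1 ≤ 2 ^ k * G t`
  let I : Finset ℕ := (Finset.Icc R T).filter fun t => (t : ℝ) ≤ s * Δ
  have hpt : ∀ᵐ z ∂P, nearSum (k + 1) u (fun a => s • z a) Finset.univ i ≤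
      ∑ t ∈ I, (k + 1) * (((t : ℝ) + 1) ^ 2 * (2 ^ k * G t z)) := by
    have hgp := ae_genPos_smul (ι := ι) F hd hac hs
    have hall : ∀ᵐ z ∂P, ∀ a, z a ∈ C := by
      refine ae_all_iff.2 fun a => ?_
      have := (measurePreserving_eval (fun _ : ι => F) a).quasiMeasurePreserving
      exact this.ae (p := fun y => y ∈ C) hC
    filter_upwards [hgp, hall] with z hz hzC
    have hdist : ∀ a b, dist (s • z a) (s • z b) = s * dist (z a) (z b) := fun a b => by
      rw [dist_smul₀, Real.norm_of_nonneg hs.le]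
    unfold nearSum
    rw [← Finset.sum_filter]
    set N := Finset.univ.filter fun j => Nb (k + 1) (fun a => s • z a) Finset.univ i j
    have hNcard : (N.card : ℝ) ≤ k + 1 := by
      exact_mod_cast card_out_le hz Finset.univ i
    set Q := ∑ t ∈ I, ((t : ℝ) + 1) ^ 2 * (2 ^ k * G t z) with hQ
    have hQ0 : ∀ t ∈ I, 0 ≤ ((t : ℝ) + 1) ^ 2 * (2 ^ k * G t z) := fun t _ => by
      have := hG0 t z; positivity
    have hj : ∀ j ∈ N, u (dist (s • z i) (s • z j)) ≤ Q := fun j hj => by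
      have hle : dist (s • z i) (s • z j) ≤ s * Δ := by
        rw [hdist]; exact mul_le_mul_of_nonneg_left (hΔ _ (hzC i) _ (hzC j)) hs.le
      refine (huR _ dist_nonneg hle).trans ?_
      split_ifs with hRd
      swap
      · exact Finset.sum_nonneg hQ0
      set D := dist (s • z i) (s • z j) with hD
      obtain ⟨t, ht⟩ : ∃ t : ℕ, t + 1 = ⌈D⌉₊ :=
        ⟨⌈D⌉₊ - 1, Nat.sub_add_cancel (Nat.ceil_pos.2 ((Nat.cast_nonneg R).trans_lt hRd))⟩
      have ht1 : D ≤ t + 1 := by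
        have := Nat.le_ceil D
        rw [← ht] at this; exact_mod_cast this
      have ht2 : (t : ℝ) < D := by
        have : t < ⌈D⌉₊ := by omega
        exact Nat.lt_ceil.1 this
      have ht3 : R ≤ t := by
        have : R < t + 1 := by exact_mod_cast hRd.trans_le ht1
        omega
      have htI : t ∈ I := by
        refine Finset.mem_filter.2 ⟨Finset.mem_Icc.2 ⟨ht3, ?_⟩, ht2.le.trans hle⟩
        exact_mod_cast (ht2.le.trans hle).trans (Nat.le_ceil _)
      refine le_trans ?_ (Finset.single_le_sum hQ0 htI)
      have hone : (1 : ℝ) ≤ 2 ^ k * G t z := by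
        refine indicator_le_prod (x := z) (S := Finset.univ.filter fun l =>
          l ≠ i ∧ dist (z i) (z l) ≤ t / s) (fun l => by simp) ?_
        have hnb := (Finset.mem_filter.1 hj).2
        have : (Finset.univ.filter fun l => l ≠ i ∧ dist (z i) (z l) ≤ t / s) ⊆
            closer (fun a => s • z a) Finset.univ i j := fun l hl => by
          obtain ⟨-, hl1, hl2⟩ := Finset.mem_filter.1 hl
          refine mem_closer.2 ⟨Finset.mem_univ _, hl1, ?_⟩
          refine lt_of_le_of_lt ?_ ht2
          rw [le_div_iff₀ hs] at hl2
          rw [hdist]; linarith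
        have h1 := Finset.card_le_card this
        have h2 := hnb.2.2.2
        omega
      calc D ^ 2 ≤ ((t : ℝ) + 1) ^ 2 := pow_le_pow_left₀ dist_nonneg ht1 2
        _ ≤ _ := le_mul_of_one_le_right (by positivity) hone
    rw [← Finset.mul_sum]
    refine (Finset.sum_le_card_nsmul _ _ _ hj).trans ?_
    rw [nsmul_eq_mul]
    exact mul_le_mul_of_nonneg_right hNcard (Finset.sum_nonneg hQ0)
  have hnm := bddMeas_nearSum (k + 1) hu (φ := fun a (z : ι → Pt d) => s • z a)
    (fun a => by fun_prop) Finset.univ i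
  have hSm : ∀ t ∈ I, BddMeas fun z => (k + 1 : ℝ) * (((t : ℝ) + 1) ^ 2 * (2 ^ k * G t z)) :=
    fun t _ => (BddMeas.const _).mul ((BddMeas.const _).mul ((BddMeas.const _).mul (hGm t)))
  refine (integral_mono_ae (hnm.integrable _) ((BddMeas.sum _ hSm).integrable _) hpt).trans ?_
  rw [integral_finsetSum _ fun t ht => (hSm t ht).integrable _]
  have hterm : ∀ t ∈ I, ∫ z, (k + 1 : ℝ) * (((t : ℝ) + 1) ^ 2 * (2 ^ k * G t z)) ∂P ≤
      (k + 1) * 2 ^ k * tailTerm γ t := fun t ht => by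
    obtain ⟨h1, h2⟩ := Finset.mem_filter.1 ht
    rw [integral_const_mul, integral_const_mul, integral_const_mul, tailTerm]
    have := hGint t (hR.trans (Finset.mem_Icc.1 h1).1) h2
    calc (k + 1 : ℝ) * (((t : ℝ) + 1) ^ 2 * (2 ^ k * ∫ z, G t z ∂P))
        ≤ (k + 1 : ℝ) * (((t : ℝ) + 1) ^ 2 * (2 ^ k * Real.exp (-(γ * t / 4)))) := by gcongr
      _ = _ := by ring
  refine (Finset.sum_le_sum hterm).trans ?_
  rw [← Finset.mul_sum]
  refine mul_le_mul_of_nonneg_left ?_ (by positivity)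
  have htt : ∀ t, 0 ≤ tailTerm γ t := fun t => by unfold tailTerm; positivity
  have hsub : I ⊆ (Finset.range (T + 1)).image (fun t => t + R) := fun t ht => by
    have := Finset.mem_Icc.1 (Finset.mem_filter.1 ht).1
    exact Finset.mem_image.2 ⟨t - R, Finset.mem_range.2 (by omega), by omega⟩
  calc ∑ t ∈ I, tailTerm γ t
      ≤ ∑ t ∈ (Finset.range (T + 1)).image (fun t => t + R), tailTerm γ t :=
        Finset.sum_le_sum_of_subset_of_nonneg hsub fun t _ _ => htt t
    _ = ∑ t ∈ Finset.range (T + 1), tailTerm γ (t + R) :=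
        Finset.sum_image fun a _ b _ h => by simpa using h
    _ ≤ _ := ((summable_nat_add_iff R).2 (summable_tailTerm hγ)).sum_le_tsum _ fun t _ => htt _

/-- The constant in `variance_longEdges_le`. -/
noncomputable def tailConst (d k : ℕ) : ℝ :=
  4 * (1 + coneNumber d * k) * (1 + k) * (k + 1) * ((k + 1) * 2 ^ k)

/-- The contribution of the edges longer than `R` to the variance is small, uniformly in the sample
size and in the distribution. -/
lemma variance_longEdges_le (hd : 1 ≤ d) (hac : F ≪ volume) {C : Set (Pt d)} (hC : F Cᶜ = 0)
    {Δ γ : ℝ} (hΔ : ∀ x ∈ C, ∀ y ∈ C, dist x y ≤ Δ) (hγ : 0 < γ)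
    (hF : ∀ x ∈ C, ∀ r, 0 < r → r ≤ Δ → γ * r ^ d ≤ F.real (Metric.closedBall x r))
    {c : ℝ} (hc0 : 0 ≤ c) (hc1 : c ≤ 1)
    (k : ℕ) {s : ℝ} (hs : 0 < s) (hcard : 2 ≤ Fintype.card ι) (hsn : s ^ d = Fintype.card ι)
    {R : ℕ} (hR : 1 ≤ R) {w : ℝ → ℝ} (hw : BddMeas w)
    (hwR : ∀ t, 0 ≤ t → t ≤ s * Δ → |w t| ≤ if (R : ℝ) < t then t else 0) :
    Var[fun z => graphSum c k w (fun a => s • z a) Finset.univ; Measure.pi fun _ : ι => F] ≤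
      Fintype.card ι * (tailConst d k * ∑' t, tailTerm γ (t + R)) := by
  set P := (Measure.pi fun _ : ι => F)
  have hrm : ∀ S : Finset ι, BddMeas fun z : ι → Pt d => graphSum c k w (fun a => s • z a) S :=
    fun S => bddMeas_graphSum hc0 hc1 k hw (φ := fun a (z : ι → Pt d) => s • z a)
      (fun a => by fun_prop) S
  have hes := efron_stein F (fun z : ι → Pt d => graphSum c k w (fun a => s • z a) Finset.univ)
    (hrm _) (fun l z => graphSum c k w (fun a => s • z a) (Finset.univ.erase l))
    (fun l => hrm _) (fun i x y => graphSum_erase_update c k w (fun y => s • y) _ i x y)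
  refine hes.trans ?_
  rw [← integral_finsetSum _ fun l _ => ((hrm _).sub (hrm _)).sq.integrable _]
  have hgp := ae_genPos_smul (ι := ι) F hd hac hs
  have hnm := fun i => bddMeas_nearSum (k + 1) hw.sq (φ := fun a (z : ι → Pt d) => s • z a)
    (fun a => by fun_prop) Finset.univ i
  refine (integral_mono_ae ((BddMeas.sum _ fun l _ => ((hrm _).sub (hrm _)).sq).integrable _)
    (((BddMeas.const (4 * (1 + coneNumber d * k) * (1 + k) * (k + 1))).mul
      (BddMeas.sum Finset.univ fun i _ => hnm i)).integrable _)
    (hgp.mono fun z hz => sum_sq_removal_le hc0 hc1 hz Finset.univ)).trans ?_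
  rw [integral_const_mul, integral_finsetSum _ fun i _ => (hnm i).integrable _]
  have hi := fun i => integral_nearSum_le F hd hac hC hΔ hγ hF k hs hcard hsn hR hw.sq
    (fun t ht0 ht => by
      have := hwR t ht0 ht
      split_ifs with h
      · rw [if_pos h] at this
        exact sq_le_sq' (by linarith [neg_abs_le (w t)]) (le_of_abs_le this)
      · rw [if_neg h] at this
        simp [abs_nonpos_iff.1 this]) i
  calc _ ≤ 4 * (1 + coneNumber d * k) * (1 + k) * (k + 1) *
        ∑ i : ι, (k + 1) * 2 ^ k * ∑' t, tailTerm γ (t + R) := by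
        gcongr with i _
        exact hi i
    _ = _ := by
        rw [Finset.sum_const, Finset.card_univ, nsmul_eq_mul, tailConst]
        ring

lemma tendsto_tail {γ : ℝ} : Tendsto (fun R : ℕ => ∑' t, tailTerm γ (t + R)) atTop (𝓝 0) :=
  tendsto_sum_nat_add (tailTerm γ)

end Tails

/-! ### Stability under a change of the density -/

section Coupling

variable {d : ℕ} {ι : Type*} [Fintype ι] [DecidableEq ι]

/-- If two coupled samples differ in few points, then so do their nearest neighbour graphs: a point
has the same effect in both samples unless it, or one of the points near to it, differs. -/
lemma variance_coupling_le (hd : 1 ≤ d) (π : Measure (Pt d × Pt d)) [IsProbabilityMeasure π]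
    (h1 : π.map Prod.fst ≪ volume) (h2 : π.map Prod.snd ≪ volume)
    {c : ℝ} (hc0 : 0 ≤ c) (hc1 : c ≤ 1) (k : ℕ) {s : ℝ} (hs : 0 < s)
    {w : ℝ → ℝ} {B r : ℝ} (hwm : Measurable w) (hwB : ∀ t, |w t| ≤ B) (hwr : ∀ t, r < t → w t = 0)
    {e q : ℝ} (he : π.real {p | p.1 ≠ p.2} ≤ e)
    (hq1 : (π.prod π).real {z | z.1.1 ≠ z.1.2 ∧ dist z.1.1 z.2.1 ≤ 3 * r / s} ≤ q)
    (hq2 : (π.prod π).real {z | z.1.1 ≠ z.1.2 ∧ dist z.1.2 z.2.2 ≤ 3 * r / s} ≤ q) :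
    Var[fun z : ι → Pt d × Pt d => graphSum c k w (fun a => s • (z a).1) Finset.univ -
        graphSum c k w (fun a => s • (z a).2) Finset.univ; Measure.pi fun _ => π] ≤
      (2 * (removalConst d k * B)) ^ 2 *
        (Fintype.card ι * (e + Fintype.card ι * (2 * q))) := by
  have hb : BddMeas w := ⟨hwm, B, hwB⟩
  have hB1 : ∀ S : Finset ι, BddMeas fun z : ι → Pt d × Pt d =>
      graphSum c k w (fun a => s • (z a).1) S := fun S =>
    bddMeas_graphSum hc0 hc1 k hb (φ := fun a (z : ι → Pt d × Pt d) => s • (z a).1)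
      (fun a => by fun_prop) S
  have hB2 : ∀ S : Finset ι, BddMeas fun z : ι → Pt d × Pt d =>
      graphSum c k w (fun a => s • (z a).2) S := fun S =>
    bddMeas_graphSum hc0 hc1 k hb (φ := fun a (z : ι → Pt d × Pt d) => s • (z a).2)
      (fun a => by fun_prop) S
  set N : Set (Pt d × Pt d) := {p | p.1 ≠ p.2} with hN
  have hNm : MeasurableSet N := (measurableSet_eq_fun measurable_fst measurable_snd).compl
  set R1 : Set ((Pt d × Pt d) × (Pt d × Pt d)) :=
    {z | z.1.1 ≠ z.1.2 ∧ dist z.1.1 z.2.1 ≤ 3 * r / s} with hR1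
  set R2 : Set ((Pt d × Pt d) × (Pt d × Pt d)) :=
    {z | z.1.1 ≠ z.1.2 ∧ dist z.1.2 z.2.2 ≤ 3 * r / s} with hR2
  have hR1m : MeasurableSet R1 := (hNm.preimage measurable_fst).inter (measurableSet_le
    (f := fun z : (Pt d × Pt d) × (Pt d × Pt d) => dist z.1.1 z.2.1) (by fun_prop) measurable_const)
  have hR2m : MeasurableSet R2 := (hNm.preimage measurable_fst).inter (measurableSet_le
    (f := fun z : (Pt d × Pt d) × (Pt d × Pt d) => dist z.1.2 z.2.2) (by fun_prop) measurable_const)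
  -- off the event `A l`, the point `l` and all the points near to it in either sample are common to
  -- both samples
  let A : ι → Set (ι → Pt d × Pt d) := fun l => {z | z l ∈ N} ∪
    ⋃ i ∈ Finset.univ.erase l, ({z | (z i, z l) ∈ R1} ∪ {z | (z i, z l) ∈ R2})
  have hA : ∀ l, MeasurableSet (A l) := fun l => by
    refine (hNm.preimage (measurable_pi_apply l)).union
      (Finset.measurableSet_biUnion _ fun i _ => ?_)
    have hm : Measurable fun z : ι → Pt d × Pt d => (z i, z l) := by fun_prop
    exact (hR1m.preimage hm).union (hR2m.preimage hm)
  have hgp1 : ∀ᵐ z ∂(Measure.pi fun _ : ι => π), GenPos (fun a => s • (z a).1) :=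
    ae_genPos π hd (φ := fun p => s • p.1) (by fun_prop) (by
      have : (fun p : Pt d × Pt d => s • p.1) = (fun y : Pt d => s • y) ∘ Prod.fst := rfl
      rw [this, ← Measure.map_map (by fun_prop) (by fun_prop)]
      refine (h1.map (by fun_prop)).trans ?_
      rw [Measure.map_addHaar_smul volume hs.ne']
      exact Measure.smul_absolutelyContinuous)
  have hgp2 : ∀ᵐ z ∂(Measure.pi fun _ : ι => π), GenPos (fun a => s • (z a).2) :=
    ae_genPos π hd (φ := fun p => s • p.2) (by fun_prop) (by
      have : (fun p : Pt d × Pt d => s • p.2) = (fun y : Pt d => s • y) ∘ Prod.snd := rfl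
      rw [this, ← Measure.map_map (by fun_prop) (by fun_prop)]
      refine (h2.map (by fun_prop)).trans ?_
      rw [Measure.map_addHaar_smul volume hs.ne']
      exact Measure.smul_absolutelyContinuous)
  have hdist : ∀ x y : Pt d, dist (s • x) (s • y) ≤ 3 * r ↔ dist x y ≤ 3 * r / s := fun x y => by
    rw [dist_smul₀, Real.norm_of_nonneg hs.le, le_div_iff₀ hs, mul_comm]
  have hes := efron_stein_event π
    (fun z : ι → Pt d × Pt d => graphSum c k w (fun a => s • (z a).1) Finset.univ -
        graphSum c k w (fun a => s • (z a).2) Finset.univ) ((hB1 _).sub (hB2 _))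
    (fun l z => graphSum c k w (fun a => s • (z a).1) (Finset.univ.erase l) -
        graphSum c k w (fun a => s • (z a).2) (Finset.univ.erase l))
    (fun l => (hB1 _).sub (hB2 _))
    (fun i x y => by
      rw [graphSum_erase_update c k w (fun p : Pt d × Pt d => s • p.1) _ i x y,
        graphSum_erase_update c k w (fun p : Pt d × Pt d => s • p.2) _ i x y])
    (2 * (removalConst d k * B)) A hA (fun l => by
      filter_upwards [hgp1, hgp2] with z hz1 hz2
      have hrw : graphSum c k w (fun a => s • (z a).1) Finset.univ -
          graphSum c k w (fun a => s • (z a).2) Finset.univ -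
          (graphSum c k w (fun a => s • (z a).1) (Finset.univ.erase l) -
            graphSum c k w (fun a => s • (z a).2) (Finset.univ.erase l)) =
          removal c k w (fun a => s • (z a).1) Finset.univ l -
            removal c k w (fun a => s • (z a).2) Finset.univ l := by
        unfold removal; ring
      rw [hrw]
      by_cases hz : z ∈ A l
      · rw [Set.indicator_of_mem hz]
        have b1 := abs_removal_le_const hc0 hc1 (k := k) hwB hz1 Finset.univ l
        have b2 := abs_removal_le_const hc0 hc1 (k := k) hwB hz2 Finset.univ l
        exact (abs_sub _ _).trans (by linarith)
      · rw [Set.indicator_of_notMem hz]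
        simp only [A, Set.mem_union, Set.mem_iUnion, not_or, not_exists] at hz
        obtain ⟨hzl, hzi⟩ := hz
        -- both effects only depend on the set `S0` of the common points
        set S0 : Finset ι := Finset.univ.filter fun i => (z i).1 = (z i).2 with hS0
        have hl : (z l).1 = (z l).2 := not_not.1 hzl
        have e1 : removal c k w (fun a => s • (z a).1) Finset.univ l =
            removal c k w (fun a => s • (z a).1) S0 l :=
          removal_congr_of_near hwr fun i hi => by
            simp only [Finset.mem_univ, true_iff, hS0, Finset.mem_filter, true_and]
            by_cases hil : i = l
            · rw [hil]; exact hl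
            · by_contra hne
              exact (hzi i (Finset.mem_erase.2 ⟨hil, Finset.mem_univ _⟩)).1
                ⟨hne, (hdist _ _).1 hi⟩
        have e2 : removal c k w (fun a => s • (z a).2) Finset.univ l =
            removal c k w (fun a => s • (z a).2) S0 l :=
          removal_congr_of_near hwr fun i hi => by
            simp only [Finset.mem_univ, true_iff, hS0, Finset.mem_filter, true_and]
            by_cases hil : i = l
            · rw [hil]; exact hl
            · by_contra hne
              exact (hzi i (Finset.mem_erase.2 ⟨hil, Finset.mem_univ _⟩)).2
                ⟨hne, (hdist _ _).1 hi⟩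
        have e3 : removal c k w (fun a => s • (z a).1) S0 l =
            removal c k w (fun a => s • (z a).2) S0 l := by
          unfold removal
          rw [graphSum_congr (x := fun a => s • (z a).1) (y := fun a => s • (z a).2)
              (fun i hi => by simp only [(Finset.mem_filter.1 hi).2]),
            graphSum_congr (x := fun a => s • (z a).1) (y := fun a => s • (z a).2) (S := S0.erase l)
              (fun i hi => by simp only [(Finset.mem_filter.1 (Finset.mem_of_mem_erase hi)).2])]
        rw [e1, e2, e3, sub_self, abs_zero])
  refine hes.trans (mul_le_mul_of_nonneg_left ?_ (sq_nonneg _))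
  have hPA : ∀ l, (Measure.pi fun _ : ι => π).real (A l) ≤
      e + Fintype.card ι * (2 * q) := fun l => by
    refine (measureReal_union_le _ _).trans (add_le_add ?_ ?_)
    · rw [pi_real_single π l hNm]; exact he
    · have hq0 : 0 ≤ q := measureReal_nonneg.trans hq1
      refine (measureReal_biUnion_finset_le _ _).trans ?_
      refine (Finset.sum_le_card_nsmul _ _ (2 * q) fun i hi => ?_).trans ?_
      · refine (measureReal_union_le _ _).trans ?_
        rw [pi_real_pair π (Finset.ne_of_mem_erase hi) hR1m,
          pi_real_pair π (Finset.ne_of_mem_erase hi) hR2m]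
        linarith
      · rw [nsmul_eq_mul]
        refine mul_le_mul_of_nonneg_right ?_ (by positivity)
        exact_mod_cast (Finset.card_le_univ _)
  refine (Finset.sum_le_card_nsmul _ _ _ fun l _ => hPA l).trans ?_
  rw [nsmul_eq_mul, Finset.card_univ]

end Coupling

section MaximalCoupling

variable {d : ℕ}

/-- The **maximal coupling** of two distributions with densities `f` and `g`: the coupled points
differ only where the densities do. -/
lemma exists_maximal_coupling {X : Type*} [MeasurableSpace X] [MeasurableEq X] (ν : Measure X)
    [SFinite ν] {f g : X → ℝ} (hf : Measurable f) (hg : Measurable g)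
    [IsProbabilityMeasure (ν.withDensity fun x => ENNReal.ofReal (f x))]
    [IsProbabilityMeasure (ν.withDensity fun x => ENNReal.ofReal (g x))]
    (hf0 : ∀ x, 0 ≤ f x) (hg0 : ∀ x, 0 ≤ g x) :
    ∃ π : Measure (X × X), IsProbabilityMeasure π ∧
      π.map Prod.fst = ν.withDensity (fun x => ENNReal.ofReal (f x)) ∧
      π.map Prod.snd = ν.withDensity (fun x => ENNReal.ofReal (g x)) ∧
      (π.restrict {p | p.1 ≠ p.2}).map Prod.fst ≤
        ν.withDensity (fun x => ENNReal.ofReal (f x - g x)) ∧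
      (π.restrict {p | p.1 ≠ p.2}).map Prod.snd ≤
        ν.withDensity (fun x => ENNReal.ofReal (g x - f x)) := by
  set m : X → ℝ≥0∞ := fun x => ENNReal.ofReal (min (f x) (g x)) with hm
  set a : X → ℝ≥0∞ := fun x => ENNReal.ofReal (f x - g x) with ha
  set b : X → ℝ≥0∞ := fun x => ENNReal.ofReal (g x - f x) with hb
  have hmm : Measurable m := by fun_prop
  have ham : Measurable a := by fun_prop
  have hbm : Measurable b := by fun_prop
  have hfa : (fun x => ENNReal.ofReal (f x)) = m + a := by
    funext x
    simp only [hm, ha, Pi.add_apply]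
    rcases le_total (f x) (g x) with h | h
    · rw [min_eq_left h, ENNReal.ofReal_of_nonpos (by linarith : f x - g x ≤ 0), add_zero]
    · rw [min_eq_right h, ← ENNReal.ofReal_add (hg0 x) (by linarith)]; congr 1; ring
  have hgb : (fun x => ENNReal.ofReal (g x)) = m + b := by
    funext x
    simp only [hm, hb, Pi.add_apply]
    rcases le_total (f x) (g x) with h | h
    · rw [min_eq_left h, ← ENNReal.ofReal_add (hf0 x) (by linarith)]; congr 1; ring
    · rw [min_eq_right h, ENNReal.ofReal_of_nonpos (by linarith : g x - f x ≤ 0), add_zero]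
  have hμf : ν.withDensity (fun x => ENNReal.ofReal (f x)) = ν.withDensity m + ν.withDensity a := by
    rw [hfa, withDensity_add_left hmm]
  have hμg : ν.withDensity (fun x => ENNReal.ofReal (g x)) = ν.withDensity m + ν.withDensity b := by
    rw [hgb, withDensity_add_left hmm]
  have h1f : ν.withDensity m Set.univ + ν.withDensity a Set.univ = 1 := by
    rw [← Measure.add_apply, ← hμf]; exact measure_univ
  have h1g : ν.withDensity m Set.univ + ν.withDensity b Set.univ = 1 := by
    rw [← Measure.add_apply, ← hμg]; exact measure_univ
  have hmtop : ν.withDensity m Set.univ ≠ ∞ := fun h => by rw [h] at h1f; simp at h1f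
  have hab : ν.withDensity a Set.univ = ν.withDensity b Set.univ :=
    (ENNReal.add_right_inj hmtop).1 (h1f.trans h1g.symm)
  set κ := ν.withDensity a Set.univ with hκ
  have hκtop : κ ≠ ∞ := fun h => by rw [h] at h1f; simp at h1f
  -- the coupling puts the common part of the two distributions on the diagonal, and couples the
  -- remaining parts, of equal mass `κ`, independently; if `κ = 0` then `κ⁻¹ = ∞` multiplies the
  -- zero measure
  set ρ : Measure (X × X) := κ⁻¹ • (ν.withDensity a).prod (ν.withDensity b) with hρ
  set D : Measure (X × X) := (ν.withDensity m).map fun x => (x, x) with hD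
  have hρ1 : ρ.map Prod.fst = ν.withDensity a := by
    rw [hρ, Measure.map_smul, Measure.map_fst_prod, ← hab]
    by_cases h0 : κ = 0
    · have : ν.withDensity a = 0 := Measure.measure_univ_eq_zero.1 h0
      simp [this]
    · rw [smul_smul, ENNReal.inv_mul_cancel h0 hκtop, one_smul]
  have hρ2 : ρ.map Prod.snd = ν.withDensity b := by
    rw [hρ, Measure.map_smul, Measure.map_snd_prod, ← hκ]
    by_cases h0 : κ = 0
    · have : ν.withDensity b = 0 := Measure.measure_univ_eq_zero.1 (hab ▸ h0)
      simp [this]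
    · rw [smul_smul, ENNReal.inv_mul_cancel h0 hκtop, one_smul]
  have hD1 : D.map Prod.fst = ν.withDensity m := by
    rw [hD, Measure.map_map measurable_fst (by fun_prop)]
    exact Measure.map_id
  have hD2 : D.map Prod.snd = ν.withDensity m := by
    rw [hD, Measure.map_map measurable_snd (by fun_prop)]
    exact Measure.map_id
  have hNm : MeasurableSet {p : X × X | p.1 ≠ p.2} :=
    (measurableSet_eq_fun measurable_fst measurable_snd).compl
  have hDN : D.restrict {p | p.1 ≠ p.2} = 0 := by
    rw [Measure.restrict_eq_zero, hD, Measure.map_apply (by fun_prop) hNm]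
    convert measure_empty (μ := ν.withDensity m)
    ext x; simp
  have hm1 : (D + ρ).map Prod.fst = ν.withDensity (fun x => ENNReal.ofReal (f x)) := by
    rw [Measure.map_add _ _ measurable_fst, hD1, hρ1, hμf]
  refine ⟨D + ρ, ?_, hm1, ?_, ?_, ?_⟩
  · constructor
    have := congrArg (fun μ => μ Set.univ) hm1
    simp only [Measure.map_apply measurable_fst MeasurableSet.univ, Set.preimage_univ] at this
    rw [this]; exact measure_univ
  · rw [Measure.map_add _ _ measurable_snd, hD2, hρ2, hμg]
  · rw [Measure.restrict_add, hDN, zero_add, ← hρ1]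
    exact Measure.map_mono Measure.restrict_le_self measurable_fst
  · rw [Measure.restrict_add, hDN, zero_add, ← hρ2]
    exact Measure.map_mono Measure.restrict_le_self measurable_snd

lemma lintegral_kernel_left {X Y : Type*} [MeasurableSpace X] [MeasurableSpace Y] (μ : Measure X)
    (ν : Measure Y) [SFinite μ] [SFinite ν] {I : X → Y → ℝ≥0∞}
    (hI : Measurable (Function.uncurry I))
    {u : X → ℝ≥0∞} (hu : Measurable u) {V : ℝ≥0∞} (hV : ∀ x, ∫⁻ y, I x y ∂ν = V) :
    ∫⁻ y, ∫⁻ x, u x * I x y ∂μ ∂ν = (∫⁻ x, u x ∂μ) * V := by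
  rw [lintegral_lintegral_swap]
  · rw [← lintegral_mul_const _ hu]
    refine lintegral_congr fun x => ?_
    have hIx : Measurable fun y => I x y := hI.comp measurable_prodMk_left
    rw [lintegral_const_mul _ hIx, hV]
  · exact ((hu.comp measurable_snd).mul (hI.comp measurable_swap)).aemeasurable

lemma lintegral_kernel_right {X Y : Type*} [MeasurableSpace X] [MeasurableSpace Y] (μ : Measure X)
    (ν : Measure Y) {I : X → Y → ℝ≥0∞} (hI : Measurable (Function.uncurry I))
    {v : Y → ℝ≥0∞} (hv : Measurable v) {V : ℝ≥0∞} (hV : ∀ y, ∫⁻ x, I x y ∂μ = V) :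
    ∫⁻ y, ∫⁻ x, v y * I x y ∂μ ∂ν = (∫⁻ y, v y ∂ν) * V := by
  rw [← lintegral_mul_const _ hv]
  refine lintegral_congr fun y => ?_
  have hIy : Measurable fun x => I x y := hI.comp measurable_prodMk_right
  rw [lintegral_const_mul _ hIy, hV]

/-- The probability that two points with densities `a` and `b` are within distance `ρ`, bounded in
terms of the `L²` norms. -/
lemma lintegral_near_le {a b : Pt d → ℝ} (ha : Measurable a) (hb : Measurable b)
    (ha0 : ∀ x, 0 ≤ a x) (hb0 : ∀ x, 0 ≤ b x) {δ M : ℝ} (hδ : 0 < δ) (hM : 0 ≤ M)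
    (hA : ∫⁻ x, ENNReal.ofReal (a x ^ 2) ≤ ENNReal.ofReal (δ ^ 2))
    (hB : ∫⁻ x, ENNReal.ofReal (b x ^ 2) ≤ ENNReal.ofReal M) (ρ : ℝ) :
    ∫⁻ y, ENNReal.ofReal (b y) * ∫⁻ x in Metric.closedBall y ρ, ENNReal.ofReal (a x) ≤
      ENNReal.ofReal (δ * (1 + M)) * volume (Metric.closedBall (0 : Pt d) ρ) := by
  obtain ⟨V, hV⟩ : ∃ V, V = volume (Metric.closedBall (0 : Pt d) ρ) := ⟨_, rfl⟩
  obtain ⟨I, hI⟩ : ∃ I : Pt d → Pt d → ℝ≥0∞, I = fun x y =>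
    (Metric.closedBall y ρ).indicator 1 x := ⟨_, rfl⟩
  have hIm : Measurable (Function.uncurry I) := by
    have : Function.uncurry I = {p : Pt d × Pt d | dist p.1 p.2 ≤ ρ}.indicator 1 := by
      funext p
      simp only [hI, Function.uncurry, Set.indicator, Metric.mem_closedBall]
      rfl
    rw [this]
    exact measurable_one.indicator (measurableSet_le (by fun_prop) measurable_const)
  have hIx : ∀ x, ∫⁻ y, I x y = V := fun x => by
    have : ∀ y, I x y = (Metric.closedBall x ρ).indicator 1 y := fun y => by
      simp only [hI, Set.indicator, Metric.mem_closedBall, dist_comm, Pi.one_apply]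
    simp_rw [this]
    rw [hV, lintegral_indicator_one Metric.isClosed_closedBall.measurableSet,
      Measure.addHaar_closedBall_center]
  have hIy : ∀ y, ∫⁻ x, I x y = V := fun y => by
    rw [hI, hV, lintegral_indicator_one Metric.isClosed_closedBall.measurableSet,
      Measure.addHaar_closedBall_center]
  have hIym : ∀ y, Measurable fun x => I x y := fun y => hIm.comp measurable_prodMk_right
  obtain ⟨u, hu'⟩ : ∃ u : Pt d → ℝ≥0∞, u = fun x => ENNReal.ofReal (δ⁻¹ * a x ^ 2) := ⟨_, rfl⟩
  obtain ⟨v, hv'⟩ : ∃ v : Pt d → ℝ≥0∞, v = fun y => ENNReal.ofReal (δ * b y ^ 2) := ⟨_, rfl⟩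
  have hum : Measurable u := by rw [hu']; fun_prop
  have hvm : Measurable v := by rw [hv']; fun_prop
  -- from `b * a ≤ δ⁻¹ * a ^ 2 + δ * b ^ 2`
  have hpt : ∀ x y, ENNReal.ofReal (b y) * (I x y * ENNReal.ofReal (a x)) ≤
      u x * I x y + v y * I x y := fun x y => by
    rw [← add_mul, hu', hv', ← ENNReal.ofReal_add (mul_nonneg (inv_nonneg.2 hδ.le) (sq_nonneg _))
      (mul_nonneg hδ.le (sq_nonneg _)), mul_comm (I x y),
      ← mul_assoc, ← ENNReal.ofReal_mul (hb0 y)]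
    refine mul_le_mul_left (ENNReal.ofReal_le_ofReal ?_) _
    have h1 : 0 ≤ (δ⁻¹ * a x - b y) ^ 2 * δ := mul_nonneg (sq_nonneg _) hδ.le
    have h2 : (δ⁻¹ * a x - b y) ^ 2 * δ = δ⁻¹ * a x ^ 2 - 2 * (b y * a x) + δ * b y ^ 2 := by
      field_simp
      ring
    have h3 := mul_nonneg (hb0 y) (ha0 x)
    linarith
  have hstep : ∀ y, ENNReal.ofReal (b y) * ∫⁻ x in Metric.closedBall y ρ, ENNReal.ofReal (a x) ≤
      (∫⁻ x, u x * I x y) + ∫⁻ x, v y * I x y := fun y => by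
    rw [← lintegral_indicator Metric.isClosed_closedBall.measurableSet,
      ← lintegral_const_mul _ (Measurable.indicator (by fun_prop)
        Metric.isClosed_closedBall.measurableSet),
      ← lintegral_add_left (f := fun x => u x * I x y) (hum.mul (hIym y))]
    refine lintegral_mono fun x => le_trans (le_of_eq ?_) (hpt x y)
    simp only [hI, Set.indicator, Pi.one_apply]
    split_ifs <;> simp
  have hu : ∫⁻ x, u x ≤ ENNReal.ofReal (δ⁻¹ * δ ^ 2) := by
    simp only [hu', ENNReal.ofReal_mul (inv_nonneg.2 hδ.le)]
    rw [lintegral_const_mul _ (by fun_prop)]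
    exact mul_le_mul_right hA _
  have hv : ∫⁻ x, v x ≤ ENNReal.ofReal (δ * M) := by
    simp only [hv', ENNReal.ofReal_mul hδ.le]
    rw [lintegral_const_mul _ (by fun_prop)]
    exact mul_le_mul_right hB _
  have hmeas : Measurable fun y => ∫⁻ x, u x * I x y :=
    Measurable.lintegral_prod_right (f := fun y x => u x * I x y)
      ((hum.comp measurable_snd).mul (hIm.comp measurable_swap))
  refine (lintegral_mono hstep).trans ?_
  rw [lintegral_add_left hmeas, lintegral_kernel_left _ _ hIm hum hIx,
    lintegral_kernel_right _ _ hIm hvm hIy, ← add_mul, hV]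
  refine mul_le_mul_left ((add_le_add hu hv).trans (le_of_eq ?_)) _
  rw [← ENNReal.ofReal_add (by positivity) (by positivity)]
  congr 1
  field_simp

/-- The volume of the unit ball of `ℝ ^ d`. -/
noncomputable def unitBallVolume (d : ℕ) : ℝ := (volume (Metric.ball (0 : Pt d) 1)).toReal

lemma volume_closedBall_eq {ρ : ℝ} (hρ : 0 ≤ ρ) (x : Pt d) :
    volume (Metric.closedBall x ρ) = ENNReal.ofReal (ρ ^ d * unitBallVolume d) := by
  rw [Measure.addHaar_closedBall volume x hρ, ENNReal.ofReal_mul (by positivity), unitBallVolume,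
    ENNReal.ofReal_toReal (measure_ball_lt_top).ne, finrank_euclideanSpace, Fintype.card_fin]

/-- The probability that, of two independent coupled pairs, the first one consists of different
points and lies near the second one, distances being measured after a projection `φ`. The bound is
of the order of the volume of a ball, as in the case of a bounded density, times the `L²` distance
of the two densities. -/
lemma coupling_near_le {f g b : Pt d → ℝ} (π : Measure (Pt d × Pt d)) [IsProbabilityMeasure π]
    (φ : Pt d × Pt d → Pt d) (hφ : Measurable φ)
    (hb : Measurable b) (hb0 : ∀ x, 0 ≤ b x)
    (hπb : π.map φ = volume.withDensity (fun x => ENNReal.ofReal (b x)))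
    (hf : Measurable f) (hg : Measurable g)
    (hle : (π.restrict {p | p.1 ≠ p.2}).map φ ≤
      volume.withDensity (fun x => ENNReal.ofReal (f x - g x)))
    {δ M : ℝ} (hδ : 0 < δ) (hM : 0 ≤ M)
    (hA : ∫⁻ x, ENNReal.ofReal ((f x - g x) ^ 2) ≤ ENNReal.ofReal (δ ^ 2))
    (hB : ∫⁻ x, ENNReal.ofReal (b x ^ 2) ≤ ENNReal.ofReal M) {ρ : ℝ} (hρ : 0 ≤ ρ) :
    (π.prod π).real {z | z.1.1 ≠ z.1.2 ∧ dist (φ z.1) (φ z.2) ≤ ρ} ≤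
      δ * (1 + M) * (ρ ^ d * unitBallVolume d) := by
  have hNm : MeasurableSet {p : Pt d × Pt d | p.1 ≠ p.2} :=
    (measurableSet_eq_fun measurable_fst measurable_snd).compl
  have hRm : MeasurableSet
      {z : (Pt d × Pt d) × (Pt d × Pt d) | z.1.1 ≠ z.1.2 ∧ dist (φ z.1) (φ z.2) ≤ ρ} :=
    (hNm.preimage measurable_fst).inter (measurableSet_le
      (f := fun z : (Pt d × Pt d) × (Pt d × Pt d) => dist (φ z.1) (φ z.2))
      (by fun_prop) measurable_const)
  refine ENNReal.toReal_le_of_le_ofReal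
    (mul_nonneg (by positivity) (mul_nonneg (by positivity) ENNReal.toReal_nonneg)) ?_
  rw [Measure.prod_apply_symm hRm]
  set a : Pt d → ℝ := fun x => max (f x - g x) 0 with ha
  have haa : ∀ x, ENNReal.ofReal (a x) = ENNReal.ofReal (f x - g x) := fun x => by
    rcases le_total (f x - g x) 0 with h | h
    · rw [ha]; simp only [max_eq_right h, ENNReal.ofReal_zero, ENNReal.ofReal_of_nonpos h]
    · rw [ha]; simp only [max_eq_left h]
  have hstep : ∀ q, π ((fun p => (p, q)) ⁻¹' {z : (Pt d × Pt d) × (Pt d × Pt d) |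
      z.1.1 ≠ z.1.2 ∧ dist (φ z.1) (φ z.2) ≤ ρ}) ≤
      ∫⁻ x in Metric.closedBall (φ q) ρ, ENNReal.ofReal (a x) := fun q => by
    simp_rw [haa]
    rw [← withDensity_apply _ Metric.isClosed_closedBall.measurableSet]
    refine le_trans (le_of_eq ?_) (hle _)
    rw [Measure.map_apply hφ Metric.isClosed_closedBall.measurableSet,
      Measure.restrict_apply (hφ Metric.isClosed_closedBall.measurableSet)]
    congr 1
    ext p
    exact and_comm
  refine (lintegral_mono hstep).trans ?_
  have hmeas : Measurable fun y => ∫⁻ x in Metric.closedBall y ρ, ENNReal.ofReal (a x) := by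
    have h1 : (fun y : Pt d => ∫⁻ x in Metric.closedBall y ρ, ENNReal.ofReal (a x)) =
        fun y => ∫⁻ x, {p : Pt d × Pt d | dist p.2 p.1 ≤ ρ}.indicator
          (fun p => ENNReal.ofReal (a p.2)) (y, x) := by
      funext y
      rw [← lintegral_indicator Metric.isClosed_closedBall.measurableSet]
      rfl
    rw [h1]
    exact Measurable.lintegral_prod_right' (f := {p : Pt d × Pt d | dist p.2 p.1 ≤ ρ}.indicator
      (fun p => ENNReal.ofReal (a p.2))) (Measurable.indicator (by fun_prop)
        (measurableSet_le (by fun_prop) measurable_const))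
  rw [← lintegral_map (μ := π) hmeas hφ, hπb,
    lintegral_withDensity_eq_lintegral_mul _ (by fun_prop) hmeas]
  refine (lintegral_near_le (by fun_prop) hb (fun x => le_max_right _ _) hb0 hδ hM ?_ hB ρ).trans ?_
  · refine le_trans (lintegral_mono fun x => ENNReal.ofReal_le_ofReal ?_) hA
    rcases le_total (f x - g x) 0 with h | h
    · rw [max_eq_right h, zero_pow two_ne_zero]; exact sq_nonneg _
    · rw [max_eq_left h]
  · rw [volume_closedBall_eq hρ, ← ENNReal.ofReal_mul (by positivity)]

end MaximalCoupling

/-! ### Variances of sums over blocks -/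

section Blocks

variable {d : ℕ}

lemma measurableSet_near {ι : Type*} (s ρ : ℝ) (i l : ι) :
    MeasurableSet {z : ι → Pt d | dist (s • z i) (s • z l) ≤ ρ} :=
  measurableSet_le (by fun_prop) measurable_const

lemma prob_near_le {ι : Type*} [Fintype ι] (μ : Measure (Pt d)) [IsProbabilityMeasure μ]
    {s ρ : ℝ} (hs : 0 < s) {q : ℝ} (hq : ∀ y, μ.real (Metric.closedBall y (ρ / s)) ≤ q)
    {i l : ι} (hil : i ≠ l) :
    (Measure.pi fun _ : ι => μ).real {z : ι → Pt d | dist (s • z i) (s • z l) ≤ ρ} ≤ q := by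
  have hRm : MeasurableSet {p : Pt d × Pt d | dist p.1 p.2 ≤ ρ / s} :=
    measurableSet_le (by fun_prop) measurable_const
  have h1 : {z : ι → Pt d | dist (s • z i) (s • z l) ≤ ρ} =
      {z | (z i, z l) ∈ {p : Pt d × Pt d | dist p.1 p.2 ≤ ρ / s}} := by
    ext z
    simp only [Set.mem_ofPred_eq]
    rw [dist_smul₀, Real.norm_of_nonneg hs.le, le_div_iff₀ hs, mul_comm]
  rw [h1, pi_real_pair μ hil hRm]
  have hq0 : 0 ≤ q := measureReal_nonneg.trans (hq 0)
  refine ENNReal.toReal_le_of_le_ofReal hq0 ?_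
  rw [Measure.prod_apply_symm hRm]
  refine (lintegral_mono (g := fun _ => ENNReal.ofReal q) fun y => ?_).trans (by simp)
  rw [← ENNReal.ofReal_toReal (measure_ne_top μ _)]
  exact ENNReal.ofReal_le_ofReal (hq y)

variable {ι A : Type*} [Fintype ι] [DecidableEq ι] [Fintype A] [DecidableEq A]

/-- Changing the label sets of disjoint blocks of an i.i.d. sample by few points changes the sum of
the graph functionals of the blocks by a random variable of small variance. -/
lemma variance_blocks_le (hd : 1 ≤ d) (μ : Measure (Pt d)) [IsProbabilityMeasure μ]
    (hac : μ ≪ volume) {c : ℝ} (hc0 : 0 ≤ c) (hc1 : c ≤ 1) (k : ℕ) {s : ℝ} (hs : 0 < s)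
    {w : ℝ → ℝ} {B r : ℝ} (hwm : Measurable w) (hwB : ∀ t, |w t| ≤ B) (hwr : ∀ t, r < t → w t = 0)
    {q : ℝ} (hq : ∀ y, μ.real (Metric.closedBall y (3 * r / s)) ≤ q)
    (cls : ι → A) (S S' : A → Finset ι) (hS : ∀ a, ∀ l ∈ S a, cls l = a)
    (hS' : ∀ a, ∀ l ∈ S' a, cls l = a) :
    Var[fun z : ι → Pt d => ∑ a, graphSum c k w (fun i => s • z i) (S a) -
        ∑ a, graphSum c k w (fun i => s • z i) (S' a); Measure.pi fun _ => μ] ≤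
      (2 * (removalConst d k * B)) ^ 2 *
        ∑ a, ((S a \ S' a ∪ S' a \ S a).card : ℝ) * (1 + (S' a).card * q) := by
  have hb : BddMeas w := ⟨hwm, B, hwB⟩
  have hBm : ∀ T : A → Finset ι, BddMeas fun z : ι → Pt d =>
      ∑ a, graphSum c k w (fun i => s • z i) (T a) := fun T =>
    BddMeas.sum _ fun a _ => bddMeas_graphSum hc0 hc1 k hb
      (φ := fun i (z : ι → Pt d) => s • z i) (fun i => by fun_prop) (T a)
  have hCB : 0 ≤ removalConst d k * B :=
    mul_nonneg (removalConst_nonneg d k) ((abs_nonneg _).trans (hwB 0))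
  have hq0 : 0 ≤ q := measureReal_nonneg.trans (hq 0)
  let D : A → Finset ι := fun a => S a \ S' a ∪ S' a \ S a
  -- off the event `E l`, the point `l` either belongs to neither block of its class, or belongs to
  -- both and has no point of their symmetric difference `D (cls l)` near to it; in both cases its
  -- removal has the same effect on the two blocks
  let E : ι → Set (ι → Pt d) := fun l =>
    if l ∈ D (cls l) then Set.univ
    else if l ∈ S' (cls l) then ⋃ i ∈ D (cls l), {z | dist (s • z i) (s • z l) ≤ 3 * r}
    else ∅
  have hE : ∀ l, MeasurableSet (E l) := fun l => by
    simp only [E]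
    split_ifs
    · exact MeasurableSet.univ
    · exact Finset.measurableSet_biUnion _ fun i _ => measurableSet_near s _ i l
    · exact MeasurableSet.empty
  have hes := efron_stein_event μ _ ((hBm S).sub (hBm S'))
    (fun l z => ∑ a, graphSum c k w (fun i => s • z i) ((S a).erase l) -
        ∑ a, graphSum c k w (fun i => s • z i) ((S' a).erase l))
    (fun l => (hBm fun a => (S a).erase l).sub (hBm fun a => (S' a).erase l))
    (fun i x y => by
      congr 1 <;> exact Finset.sum_congr rfl fun a _ =>
        graphSum_erase_update c k w (fun p : Pt d => s • p) _ i x y)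
    (2 * (removalConst d k * B)) E hE (fun l => by
      filter_upwards [ae_genPos_smul (ι := ι) μ hd hac hs] with z hz
      have hrw : (∑ a, graphSum c k w (fun i => s • z i) (S a) -
          ∑ a, graphSum c k w (fun i => s • z i) (S' a)) -
          (∑ a, graphSum c k w (fun i => s • z i) ((S a).erase l) -
            ∑ a, graphSum c k w (fun i => s • z i) ((S' a).erase l)) =
          removal c k w (fun i => s • z i) (S (cls l)) l -
            removal c k w (fun i => s • z i) (S' (cls l)) l := by
        rw [← Finset.sum_eq_single_of_mem (f := fun a => removal c k w (fun i => s • z i) (S a) l)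
          (cls l) (Finset.mem_univ _)
            (fun a _ ha => removal_of_notMem fun hl => ha (hS a l hl).symm),
          ← Finset.sum_eq_single_of_mem (f := fun a => removal c k w (fun i => s • z i) (S' a) l)
          (cls l) (Finset.mem_univ _)
            (fun a _ ha => removal_of_notMem fun hl => ha (hS' a l hl).symm)]
        simp only [removal, Finset.sum_sub_distrib]
        ring
      rw [hrw]
      have b1 := abs_removal_le_const hc0 hc1 (k := k) hwB hz (S (cls l)) l
      have b2 := abs_removal_le_const hc0 hc1 (k := k) hwB hz (S' (cls l)) l
      have hle : |removal c k w (fun i => s • z i) (S (cls l)) l -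
          removal c k w (fun i => s • z i) (S' (cls l)) l| ≤ 2 * (removalConst d k * B) :=
        (abs_sub _ _).trans (by linarith)
      by_cases hz' : z ∈ E l
      · rwa [Set.indicator_of_mem hz']
      rw [Set.indicator_of_notMem hz']
      simp only [E] at hz'
      split_ifs at hz' with h1 h2
      · exact absurd (Set.mem_univ _) hz'
      · simp only [Set.mem_iUnion, not_exists] at hz'
        rw [removal_congr_of_near (S' := S' (cls l)) hwr, sub_self, abs_zero]
        intro i hi
        by_contra hne
        refine hz' i ?_ hi
        simp only [D, Finset.mem_union, Finset.mem_sdiff]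
        tauto
      · simp only [D, Finset.mem_union, Finset.mem_sdiff] at h1
        rw [removal_of_notMem h2, removal_of_notMem (by tauto), sub_zero, abs_zero])
  refine hes.trans (mul_le_mul_of_nonneg_left ?_ (sq_nonneg _))
  set P := Measure.pi fun _ : ι => μ
  have hterm : ∀ l, P.real (E l) ≤
      (if l ∈ D (cls l) then 1 else 0) +
        if l ∈ S' (cls l) then ((D (cls l)).card : ℝ) * q else 0 := fun l => by
    simp only [E]
    split_ifs with h1 h2 h2
    · exact (measureReal_le_one).trans (le_add_of_nonneg_right (by positivity))
    · exact (measureReal_le_one).trans (by simp)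
    · rw [zero_add]
      refine (measureReal_biUnion_finset_le _ _).trans ?_
      rw [← nsmul_eq_mul]
      refine Finset.sum_le_card_nsmul _ _ _ fun i hi => prob_near_le μ hs hq ?_
      rintro rfl
      exact h1 hi
    · simp
  refine (Finset.sum_le_sum fun l _ => hterm l).trans ?_
  rw [Finset.sum_add_distrib]
  have hD : ∀ a, ∀ l ∈ D a, cls l = a := fun a l hl => by
    simp only [D, Finset.mem_union, Finset.mem_sdiff] at hl
    rcases hl with hl | hl
    · exact hS a l hl.1
    · exact hS' a l hl.1
  have hfib : ∀ (T : A → Finset ι) (hT : ∀ a, ∀ l ∈ T a, cls l = a) (f : A → ℝ),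
      ∑ l, (if l ∈ T (cls l) then f (cls l) else 0) = ∑ a, ((T a).card : ℝ) * f a :=
    fun T hT f => by
      rw [← Finset.sum_fiberwise Finset.univ cls]
      refine Finset.sum_congr rfl fun a _ => ?_
      rw [← nsmul_eq_mul, ← Finset.sum_const, Finset.sum_filter,
        ← Finset.sum_subset (Finset.subset_univ (T a)) fun l _ hl => ?_]
      · exact Finset.sum_congr rfl fun l hl => by
          rw [if_pos (hT a l hl), if_pos (by rwa [hT a l hl]), hT a l hl]
      · by_cases hla : cls l = a
        · rw [if_pos hla, if_neg (by rwa [hla])]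
        · rw [if_neg hla]
  have e1 := hfib D hD (fun _ => 1)
  have e2 := hfib S' hS' (fun a => ((D a).card : ℝ) * q)
  rw [e1, e2, ← Finset.sum_add_distrib]
  refine le_of_eq (Finset.sum_congr rfl fun a _ => ?_)
  simp only [D]
  ring

end Blocks

section Means

variable {d : ℕ} (μ : Measure (Pt d)) [IsProbabilityMeasure μ]

/-- The expectation of the graph functional of an i.i.d. sample of `m` points, dilated by `s`. -/
noncomputable def meanSum (c : ℝ) (k : ℕ) (w : ℝ → ℝ) (s : ℝ) (m : ℕ) : ℝ :=
  ∫ z, graphSum c k w (fun i => s • z i) Finset.univ ∂(Measure.pi fun _ : Fin m => μ)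

/-- The points with labels in `S` can be relabelled by `Fin S.card`. -/
lemma exists_embedding_map_univ {ι : Type*} (S : Finset ι) :
    ∃ e : Fin S.card ↪ ι, Finset.univ.map e = S := by
  refine ⟨S.equivFin.symm.toEmbedding.trans (Function.Embedding.subtype _), ?_⟩
  ext i
  simp only [Finset.mem_map, Finset.mem_univ, true_and]
  constructor
  · rintro ⟨j, rfl⟩
    exact (S.equivFin.symm j).2
  · intro hi
    exact ⟨S.equivFin ⟨i, hi⟩, by simp⟩

lemma integral_graphSum_eq_meanSum {ι : Type*} [Fintype ι] {c : ℝ} {k : ℕ} {w : ℝ → ℝ}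
    (hw : Measurable w) (s : ℝ) (S : Finset ι) :
    ∫ z, graphSum c k w (fun i => s • z i) S ∂(Measure.pi fun _ : ι => μ) =
      meanSum μ c k w s S.card := by
  obtain ⟨e, he⟩ := exists_embedding_map_univ S
  have hmp := measurePreserving_pi_comp μ e e.injective
  unfold meanSum
  rw [← hmp.map_eq, integral_map hmp.measurable.aemeasurable]
  · refine integral_congr_ae (Eventually.of_forall fun z => ?_)
    have := graphSum_map (c := c) (k := k) (w := w) (x := fun i => s • z i) e Finset.univ
    rw [he] at this
    exact this
  · exact (measurable_graphSum c k hw (φ := fun i (z : Fin S.card → Pt d) => s • z i)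
      (fun i => by fun_prop) _).aestronglyMeasurable

/-- The expected effect of adding a point to a sample of `m` points. -/
noncomputable def meanStep (c : ℝ) (k : ℕ) (w : ℝ → ℝ) (s : ℝ) (m : ℕ) : ℝ :=
  meanSum μ c k w s (m + 1) - meanSum μ c k w s m

variable (hd : 1 ≤ d) (hac : μ ≪ volume) {c : ℝ} (hc0 : 0 ≤ c) (hc1 : c ≤ 1) (k : ℕ) {s : ℝ}
  (hs : 0 < s) {w : ℝ → ℝ} {B r : ℝ} (hwm : Measurable w) (hwB : ∀ t, |w t| ≤ B)

include hc0 hc1 hwm hwB in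
lemma meanStep_eq {ι : Type*} [Fintype ι] [DecidableEq ι] {S : Finset ι} {l : ι} (hl : l ∈ S) :
    meanStep μ c k w s (S.card - 1) =
      ∫ z, removal c k w (fun i => s • z i) S l ∂(Measure.pi fun _ : ι => μ) := by
  have hb : ∀ T : Finset ι, BddMeas fun z : ι → Pt d => graphSum c k w (fun i => s • z i) T :=
    fun T => bddMeas_graphSum hc0 hc1 k ⟨hwm, B, hwB⟩
      (φ := fun i (z : ι → Pt d) => s • z i) (fun i => by fun_prop) T
  unfold removal meanStep
  rw [integral_sub ((hb _).integrable _) ((hb _).integrable _),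
    integral_graphSum_eq_meanSum μ hwm, integral_graphSum_eq_meanSum μ hwm,
    Finset.card_erase_of_mem hl, Nat.sub_add_cancel (Finset.card_pos.2 ⟨l, hl⟩)]

include hd hac hc0 hc1 hs hwm hwB in
lemma abs_meanStep_le (m : ℕ) : |meanStep μ c k w s m| ≤ removalConst d k * B := by
  have h := meanStep_eq μ hc0 hc1 k (s := s) hwm hwB (Finset.mem_univ (0 : Fin (m + 1)))
  rw [Finset.card_univ, Fintype.card_fin, Nat.add_sub_cancel] at h
  rw [h, ← Real.norm_eq_abs]
  refine (norm_integral_le_of_norm_le_const (C := removalConst d k * B) ?_).trans (by simp)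
  filter_upwards [ae_genPos_smul (ι := Fin (m + 1)) μ hd hac hs] with z hz
  exact abs_removal_le_const hc0 hc1 hwB hz _ _

include hd hac hc0 hc1 hs hwm hwB in
/-- The second differences of the mean are small: adding a point matters for the effect of adding
another one only if the two are close to each other. -/
lemma abs_meanStep_succ_sub_le (hwr : ∀ t, r < t → w t = 0) {q : ℝ}
    (hq : ∀ y, μ.real (Metric.closedBall y (3 * r / s)) ≤ q) (m : ℕ) :
    |meanStep μ c k w s (m + 1) - meanStep μ c k w s m| ≤ 2 * (removalConst d k * B) * q := by
  have h1 := meanStep_eq μ hc0 hc1 k (s := s) hwm hwB (Finset.mem_univ (0 : Fin (m + 2)))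
  have hmem : (0 : Fin (m + 2)) ∈ Finset.univ.erase (1 : Fin (m + 2)) := by simp
  have h2 := meanStep_eq μ hc0 hc1 k (s := s) hwm hwB hmem
  rw [Finset.card_univ, Fintype.card_fin, show m + 2 - 1 = m + 1 by omega] at h1
  rw [Finset.card_erase_of_mem (Finset.mem_univ _), Finset.card_univ, Fintype.card_fin,
    show m + 2 - 1 - 1 = m by omega] at h2
  set P := Measure.pi fun _ : Fin (m + 2) => μ
  have hb : ∀ T : Finset (Fin (m + 2)), BddMeas fun z : Fin (m + 2) → Pt d =>
      removal c k w (fun i => s • z i) T 0 := fun T => by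
    have := fun T => bddMeas_graphSum hc0 hc1 k ⟨hwm, B, hwB⟩
      (φ := fun i (z : Fin (m + 2) → Pt d) => s • z i) (fun i => by fun_prop) T
    exact (this T).sub (this _)
  have hnm := measurableSet_near (d := d) s (3 * r) (1 : Fin (m + 2)) 0
  rw [h1, h2, ← integral_sub ((hb _).integrable _) ((hb _).integrable _), ← Real.norm_eq_abs]
  refine (norm_integral_le_integral_norm _).trans ?_
  calc ∫ z, ‖removal c k w (fun i => s • z i) Finset.univ 0 -
        removal c k w (fun i => s • z i) (Finset.univ.erase 1) 0‖ ∂P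
      ≤ ∫ z, {z : Fin (m + 2) → Pt d | dist (s • z 1) (s • z 0) ≤ 3 * r}.indicator
          (fun _ => 2 * (removalConst d k * B)) z ∂P := by
        refine integral_mono_ae (((hb _).sub (hb _)).integrable _).norm
          ((integrable_const _).indicator hnm) ?_
        filter_upwards [ae_genPos_smul (ι := Fin (m + 2)) μ hd hac hs] with z hz
        have b1 := abs_removal_le_const hc0 hc1 (k := k) hwB hz Finset.univ 0
        have b2 := abs_removal_le_const hc0 hc1 (k := k) hwB hz (Finset.univ.erase 1) 0
        by_cases hz' : dist (s • z 1) (s • z 0) ≤ 3 * r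
        · rw [Set.indicator_of_mem (by exact hz')]
          exact (abs_sub _ _).trans (by linarith)
        · rw [Set.indicator_of_notMem (by exact hz'),
            removal_congr_of_near (S' := Finset.univ.erase 1) hwr, sub_self, norm_zero]
          intro i hi
          simp only [Finset.mem_univ, true_iff, Finset.mem_erase, and_true]
          rintro rfl
          exact hz' hi
    _ = P.real {z : Fin (m + 2) → Pt d | dist (s • z 1) (s • z 0) ≤ 3 * r} *
          (2 * (removalConst d k * B)) := by
        rw [integral_indicator_const _ hnm, smul_eq_mul]
    _ ≤ q * (2 * (removalConst d k * B)) := by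
        refine mul_le_mul_of_nonneg_right (prob_near_le μ hs hq (by simp)) ?_
        have := mul_nonneg (removalConst_nonneg d k) ((abs_nonneg _).trans (hwB 0))
        linarith
    _ = _ := mul_comm _ _

include hd hac hc0 hc1 hs hwm hwB in
/-- The mean is close to a linear function of the sample size. -/
lemma abs_meanStep_sub_le (hwr : ∀ t, r < t → w t = 0) {q : ℝ}
    (hq : ∀ y, μ.real (Metric.closedBall y (3 * r / s)) ≤ q) (m n : ℕ) :
    |meanStep μ c k w s m - meanStep μ c k w s n| ≤
      2 * (removalConst d k * B) * q * |(m : ℝ) - n| := by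
  have key : ∀ a b : ℕ, |meanStep μ c k w s (a + b) - meanStep μ c k w s a| ≤
      2 * (removalConst d k * B) * q * b := fun a b => by
    induction b with
    | zero => simp
    | succ b ih =>
      have h1 := abs_meanStep_succ_sub_le μ hd hac hc0 hc1 k hs hwm hwB hwr hq (a + b)
      have h2 := abs_add_le (meanStep μ c k w s (a + b + 1) - meanStep μ c k w s (a + b))
        (meanStep μ c k w s (a + b) - meanStep μ c k w s a)
      rw [sub_add_sub_cancel] at h2
      rw [← add_assoc]
      push_cast
      linarith
  rcases le_total n m with h | h
  · obtain ⟨b, rfl⟩ := Nat.exists_eq_add_of_le h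
    have := key n b
    rwa [Nat.cast_add, add_sub_cancel_left, Nat.abs_cast]
  · obtain ⟨b, rfl⟩ := Nat.exists_eq_add_of_le h
    have := key m b
    rwa [Nat.cast_add, abs_sub_comm, abs_sub_comm (m : ℝ), add_sub_cancel_left,
      Nat.abs_cast]

end Means

section Labels

lemma BddMeas.of_finite {α : Type*} [Finite α] [MeasurableSpace α] [MeasurableSingletonClass α]
    (f : α → ℝ) : BddMeas f := by
  refine ⟨measurable_of_finite f, ?_⟩
  obtain ⟨B, hB⟩ := (Set.finite_range fun x => |f x|).bddAbove
  exact ⟨B, fun x => hB ⟨x, rfl⟩⟩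

variable {A : Type*} [DecidableEq A] {N : ℕ}

/-- The number of indices with label `a`. -/
def labelCount (c : Fin N → A) (a : A) : ℕ := (Finset.univ.filter fun i => c i = a).card

/-- The number of indices other than `i` with label `a`. -/
def labelCountErase (i : Fin N) (c : Fin N → A) (a : A) : ℕ :=
  ((Finset.univ.erase i).filter fun j => c j = a).card

lemma labelCount_eq (i : Fin N) (c : Fin N → A) (a : A) :
    labelCount c a = labelCountErase i c a + if c i = a then 1 else 0 := by
  unfold labelCount labelCountErase
  rw [Finset.filter_erase]
  split_ifs with h
  · rw [Finset.card_erase_add_one]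
    simp [h]
  · rw [Finset.erase_eq_of_notMem (by simp [h]), add_zero]

lemma labelCountErase_update (i : Fin N) (c : Fin N → A) (a b : A) :
    labelCountErase i (Function.update c i b) a = labelCountErase i c a := by
  unfold labelCountErase
  congr 1
  refine Finset.filter_congr fun j hj => ?_
  rw [Function.update_of_ne (Finset.ne_of_mem_erase hj)]

variable [MeasurableSpace A] [MeasurableSingletonClass A]
  (ν : Measure A) [IsProbabilityMeasure ν]

lemma integral_labelCount (a : A) :
    ∫ c, (labelCount c a : ℝ) ∂(Measure.pi fun _ : Fin N => ν) = N * ν.real {a} := by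
  have h1 : ∀ c : Fin N → A, (labelCount c a : ℝ) =
      ∑ i, ({c : Fin N → A | c i ∈ ({a} : Set A)}.indicator (fun _ => (1 : ℝ))) c := fun c => by
    unfold labelCount
    rw [Finset.card_filter]
    push_cast
    refine Finset.sum_congr rfl fun i _ => ?_
    simp [Set.indicator]
  have hm : ∀ i : Fin N, MeasurableSet {c : Fin N → A | c i ∈ ({a} : Set A)} := fun i =>
    (measurableSet_singleton a).preimage (measurable_pi_apply i)
  simp_rw [h1]
  rw [integral_finsetSum _ fun i _ => (integrable_const _).indicator (hm i)]
  have : ∀ i : Fin N, ∫ c, ({c : Fin N → A | c i ∈ ({a} : Set A)}.indicator (fun _ => (1 : ℝ))) c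
      ∂(Measure.pi fun _ : Fin N => ν) = ν.real {a} := fun i => by
    rw [integral_indicator_const _ (hm i), smul_eq_mul, mul_one,
      pi_real_single ν i (measurableSet_singleton a)]
  rw [Finset.sum_congr rfl fun i _ => this i]
  simp

variable [Fintype A]

/-- The mean square deviation of a class size from `n`, bounded by variance plus squared bias. -/
lemma integral_sq_labelCount_sub_le (a : A) (n : ℝ) :
    ∫ c, ((labelCount c a : ℝ) - n) ^ 2 ∂(Measure.pi fun _ : Fin N => ν) ≤
      N * ν.real {a} + (N * ν.real {a} - n) ^ 2 := by
  set P := Measure.pi fun _ : Fin N => ν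
  have hb : BddMeas fun c : Fin N → A => (labelCount c a : ℝ) := BddMeas.of_finite _
  have hv : Var[fun c : Fin N → A => (labelCount c a : ℝ); P] ≤ N * ν.real {a} := by
    refine (efron_stein_event ν _ hb (fun i c => (labelCountErase i c a : ℝ))
      (fun i => BddMeas.of_finite _) (fun i x y => by rw [labelCountErase_update]) 1
      (fun i => {c | c i ∈ ({a} : Set A)})
      (fun i => (measurableSet_singleton a).preimage (measurable_pi_apply i))
      (fun i => Eventually.of_forall fun c => ?_)).trans ?_
    · rw [labelCount_eq i c a]
      by_cases h : c i = a <;> simp [h, Set.indicator]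
    · simp_rw [pi_real_single ν _ (measurableSet_singleton a)]
      simp
  have h1 := variance_eq_sq_sub (hb.sub (BddMeas.const n)) P
  rw [variance_sub_const hb.1.aestronglyMeasurable,
    integral_sub (hb.integrable _) (integrable_const _), integral_labelCount ν a] at h1
  simp only [integral_const, probReal_univ, smul_eq_mul, one_mul] at h1
  linarith

end Labels

/-! ### Characteristic functions with small argument, independence and random labels -/

section Taylor

lemma norm_exp_mul_I_taylor_le (x : ℝ) :
    ‖Complex.exp ((x : ℂ) * Complex.I) - (1 + (x : ℂ) * Complex.I - ((x ^ 2 / 2 : ℝ) : ℂ))‖ ≤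
      3 * min (x ^ 2) (|x| ^ 3) := by
  have hn : ‖(x : ℂ) * Complex.I‖ = |x| := by simp
  rcases le_total |x| 1 with h | h
  · have h1 := Complex.exp_bound (x := (x : ℂ) * Complex.I) (by rwa [hn]) (n := 3) (by norm_num)
    have h2 : ∑ m ∈ Finset.range 3, ((x : ℂ) * Complex.I) ^ m / (m.factorial : ℂ) =
        1 + (x : ℂ) * Complex.I - ((x ^ 2 / 2 : ℝ) : ℂ) := by
      simp [Finset.sum_range_succ, mul_pow, Nat.factorial]
      ring
    rw [h2, hn] at h1
    have h3 : |x| ^ 3 ≤ x ^ 2 := by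
      rw [← sq_abs x]
      exact pow_le_pow_of_le_one (abs_nonneg x) h (by norm_num)
    rw [min_eq_right h3]
    refine h1.trans ?_
    rw [mul_comm]
    exact mul_le_mul_of_nonneg_right (by norm_num [Nat.factorial]) (by positivity)
  · have h3 : x ^ 2 ≤ |x| ^ 3 := by
      rw [← sq_abs x]
      exact pow_le_pow_right₀ h (by norm_num)
    rw [min_eq_left h3]
    have h4 := norm_exp_mul_I_sub_le x 0
    simp only [Complex.ofReal_zero, zero_mul, Complex.exp_zero, sub_zero] at h4
    calc ‖Complex.exp ((x : ℂ) * Complex.I) - (1 + (x : ℂ) * Complex.I - ((x ^ 2 / 2 : ℝ) : ℂ))‖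
        = ‖(Complex.exp ((x : ℂ) * Complex.I) - 1) - (x : ℂ) * Complex.I
            + ((x ^ 2 / 2 : ℝ) : ℂ)‖ := by congr 1; ring
      _ ≤ |x| + |x| + x ^ 2 / 2 := by
          refine (norm_add_le _ _).trans (add_le_add ((norm_sub_le _ _).trans ?_) (le_of_eq ?_))
          · rw [hn]; gcongr
          · rw [Complex.norm_real, Real.norm_of_nonneg (by positivity)]
      _ ≤ 3 * x ^ 2 := by
          rw [← sq_abs x]; nlinarith

variable {α : Type*} [MeasurableSpace α] {f : α → ℝ} (hf : BddMeas f) (μ : Measure α)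
  [IsProbabilityMeasure μ]

include hf in
lemma norm_centredChar_sub_taylor_le_integral (u : ℝ) :
    ‖centredChar μ f u - ((1 - u ^ 2 * Var[f; μ] / 2 : ℝ) : ℂ)‖ ≤
      ∫ x, 3 * min ((u * (f x - ∫ y, f y ∂μ)) ^ 2) (|u * (f x - ∫ y, f y ∂μ)| ^ 3) ∂μ := by
  obtain ⟨g, hg⟩ : ∃ g : α → ℝ, g = fun x => u * (f x - ∫ y, f y ∂μ) := ⟨_, rfl⟩
  have hgb : BddMeas g := by rw [hg]; exact (BddMeas.const u).mul (hf.sub (BddMeas.const _))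
  have hg0 : ∫ x, g x ∂μ = 0 := by
    rw [hg, integral_const_mul, integral_sub (hf.integrable μ) (integrable_const _)]
    simp
  have hg2 : ∫ x, g x ^ 2 ∂μ = u ^ 2 * Var[f; μ] := by
    rw [variance_eq_integral hf.1.aemeasurable, ← integral_const_mul]
    exact integral_congr_ae (Eventually.of_forall fun x => by simp only [hg]; ring)
  have hgm := hgb.1
  have hi1 := integrable_exp_mul_I hgm μ
  have hi2 : Integrable (fun x => 1 + (g x : ℂ) * Complex.I - ((g x ^ 2 / 2 : ℝ) : ℂ)) μ :=
    ((integrable_const _).add ((hgb.integrable μ).ofReal.mul_const _)).sub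
      ((hgb.sq.integrable μ).div_const 2).ofReal
  have hval : ∫ x, (1 + (g x : ℂ) * Complex.I - ((g x ^ 2 / 2 : ℝ) : ℂ)) ∂μ =
      ((1 - u ^ 2 * Var[f; μ] / 2 : ℝ) : ℂ) := by
    rw [integral_sub ((integrable_const _).add ((hgb.integrable μ).ofReal.mul_const _))
      ((hgb.sq.integrable μ).div_const 2).ofReal,
      integral_add (integrable_const _) ((hgb.integrable μ).ofReal.mul_const _),
      integral_mul_const, integral_complex_ofReal, integral_complex_ofReal, hg0,
      integral_div, hg2]
    simp
  have hval' : centredChar μ f u = ∫ x, Complex.exp ((g x : ℂ) * Complex.I) ∂μ := by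
    rw [hg]; rfl
  rw [hval', ← hval, ← integral_sub hi1 hi2]
  refine (norm_integral_le_integral_norm _).trans ?_
  have hb : BddMeas fun x => 3 * min (g x ^ 2) (|g x| ^ 3) := by
    obtain ⟨B, hB⟩ := hgb.sq.2
    refine ⟨by fun_prop, 3 * B, fun x => ?_⟩
    have h0 : 0 ≤ min (g x ^ 2) (|g x| ^ 3) := le_min (sq_nonneg _) (by positivity)
    rw [abs_of_nonneg (by positivity)]
    have := (min_le_left (g x ^ 2) (|g x| ^ 3)).trans ((le_abs_self _).trans (hB x))
    linarith
  have hle := integral_mono_ae (hi1.sub hi2).norm (hb.integrable μ)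
    (Eventually.of_forall fun x => norm_exp_mul_I_taylor_le (g x))
  rw [hg] at hle ⊢
  exact hle

include hf in
/-- The Taylor expansion of a characteristic function, with an error that is of the order of the
variance; the size of a bound for `f` does not enter. -/
lemma norm_centredChar_sub_taylor_le_variance (u : ℝ) :
    ‖centredChar μ f u - ((1 - u ^ 2 * Var[f; μ] / 2 : ℝ) : ℂ)‖ ≤ 3 * u ^ 2 * Var[f; μ] := by
  refine (norm_centredChar_sub_taylor_le_integral hf μ u).trans ?_
  rw [variance_eq_integral hf.1.aemeasurable, ← integral_const_mul]
  refine integral_mono_of_nonneg (Eventually.of_forall fun x => ?_) ?_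
    (Eventually.of_forall fun x => ?_)
  · exact mul_nonneg (by norm_num) (le_min (sq_nonneg _) (by positivity))
  · exact ((BddMeas.const (3 * u ^ 2)).mul (hf.sub (BddMeas.const _)).sq).integrable μ
  · have := min_le_left ((u * (f x - ∫ y, f y ∂μ)) ^ 2) (|u * (f x - ∫ y, f y ∂μ)| ^ 3)
    simp only
    linarith

include hf in
/-- The Taylor expansion of the characteristic function of a bounded variable, with a cubic error.
-/
lemma norm_centredChar_sub_taylor_le_cube (u : ℝ) {M : ℝ} (hM : ∀ x, |f x| ≤ M) :
    ‖centredChar μ f u - ((1 - u ^ 2 * Var[f; μ] / 2 : ℝ) : ℂ)‖ ≤ 3 * (|u| * (2 * M)) ^ 3 := by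
  refine (norm_centredChar_sub_taylor_le_integral hf μ u).trans ?_
  have hm : |∫ y, f y ∂μ| ≤ M := by
    rw [← Real.norm_eq_abs]
    exact (norm_integral_le_of_norm_le_const (Eventually.of_forall hM)).trans (by simp)
  have : ∫ _, 3 * (|u| * (2 * M)) ^ 3 ∂μ = 3 * (|u| * (2 * M)) ^ 3 := by simp
  rw [← this]
  refine integral_mono_of_nonneg (Eventually.of_forall fun x => ?_) (integrable_const _)
    (Eventually.of_forall fun x => ?_)
  · exact mul_nonneg (by norm_num) (le_min (sq_nonneg _) (by positivity))
  · refine mul_le_mul_of_nonneg_left ((min_le_right _ _).trans ?_) (by norm_num)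
    refine pow_le_pow_left₀ (abs_nonneg _) ?_ 3
    rw [abs_mul]
    refine mul_le_mul_of_nonneg_left ?_ (abs_nonneg u)
    exact (abs_sub _ _).trans (by linarith [hM x])

include hf in
/-- A quantitative continuity of the variance. -/
lemma abs_variance_sub_le {g : α → ℝ} (hg : BddMeas g) {θ : ℝ} (hθ : 0 < θ) :
    |Var[f; μ] - Var[g; μ]| ≤
      Var[fun x => f x - g x; μ] / (2 * θ) + θ * (Var[f; μ] + Var[g; μ]) := by
  obtain ⟨F, hF⟩ : ∃ F : α → ℝ, F = fun x => f x - ∫ y, f y ∂μ := ⟨_, rfl⟩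
  obtain ⟨G, hG⟩ : ∃ G : α → ℝ, G = fun x => g x - ∫ y, g y ∂μ := ⟨_, rfl⟩
  have hFb : BddMeas F := by rw [hF]; exact hf.sub (BddMeas.const _)
  have hGb : BddMeas G := by rw [hG]; exact hg.sub (BddMeas.const _)
  have h1 : Var[f; μ] = ∫ x, F x ^ 2 ∂μ := by
    rw [variance_eq_integral hf.1.aemeasurable, hF]
  have h2 : Var[g; μ] = ∫ x, G x ^ 2 ∂μ := by
    rw [variance_eq_integral hg.1.aemeasurable, hG]
  have h3 : Var[fun x => f x - g x; μ] = ∫ x, (F x - G x) ^ 2 ∂μ := by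
    rw [variance_eq_integral (hf.sub hg).1.aemeasurable, hF, hG,
      integral_sub (hf.integrable μ) (hg.integrable μ)]
    exact integral_congr_ae (Eventually.of_forall fun x => by simp only; ring)
  have hi : Integrable (fun x => θ * (F x ^ 2 + G x ^ 2)) μ :=
    ((hFb.sq.add hGb.sq).integrable μ).const_mul θ
  rw [h3, h1, h2, ← integral_sub (hFb.sq.integrable μ) (hGb.sq.integrable μ),
    ← integral_add (hFb.sq.integrable μ) (hGb.sq.integrable μ), ← integral_const_mul,
    ← integral_div, ← integral_add (((hFb.sub hGb).sq.integrable μ).div_const _) hi,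
    ← Real.norm_eq_abs]
  refine (norm_integral_le_integral_norm _).trans ?_
  refine integral_mono_of_nonneg (Eventually.of_forall fun x => norm_nonneg _)
    ((((hFb.sub hGb).sq.integrable μ).div_const _).add hi)
    (Eventually.of_forall fun x => ?_)
  simp only [Real.norm_eq_abs]
  have key : ∀ a b : ℝ, |a * b| ≤ a ^ 2 / (2 * θ) + θ / 2 * b ^ 2 := fun a b => by
    rw [abs_mul, ← sq_abs a, ← sq_abs b]
    have h4 : 0 ≤ (|a| - θ * |b|) ^ 2 / (2 * θ) := by positivity
    have h5 : (|a| - θ * |b|) ^ 2 / (2 * θ) =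
        |a| ^ 2 / (2 * θ) + θ / 2 * |b| ^ 2 - |a| * |b| := by
      field_simp; ring
    linarith
  have h6 := key (F x - G x) (F x + G x)
  rw [show (F x - G x) * (F x + G x) = F x ^ 2 - G x ^ 2 by ring] at h6
  have h7 : θ / 2 * (F x + G x) ^ 2 ≤ θ * (F x ^ 2 + G x ^ 2) := by
    nlinarith [mul_nonneg hθ.le (sq_nonneg (F x - G x))]
  linarith

lemma norm_exp_neg_sub_le {y : ℝ} (hy : 0 ≤ y) :
    ‖((Real.exp (-y) : ℝ) : ℂ) - ((1 - y : ℝ) : ℂ)‖ ≤ y ^ 2 := by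
  rw [← Complex.ofReal_sub, Complex.norm_real, Real.norm_eq_abs, abs_le]
  have h1 := Real.add_one_le_exp (-y)
  refine ⟨by nlinarith, ?_⟩
  have h2 := Real.add_one_le_exp y
  have h3 : Real.exp (-y) * Real.exp y = 1 := by rw [← Real.exp_add]; simp
  have h4 : Real.exp (-y) * (1 + y) ≤ 1 := by
    rw [← h3]; gcongr; linarith
  nlinarith [Real.exp_pos (-y)]

/-- Replacing the factors of a product of numbers in the unit disc one at a time. -/
lemma norm_prod_sub_pow_le {A : Type*} (T : Finset A) (f : A → ℂ) (b : ℂ)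
    (hf : ∀ a ∈ T, ‖f a‖ ≤ 1) (hb : ‖b‖ ≤ 1) :
    ‖∏ a ∈ T, f a - b ^ T.card‖ ≤ ∑ a ∈ T, ‖f a - b‖ := by
  classical
  induction T using Finset.induction_on with
  | empty => simp
  | insert a T ha ih =>
    rw [Finset.prod_insert ha, Finset.sum_insert ha, Finset.card_insert_of_notMem ha]
    have ih := ih fun a' ha' => hf a' (Finset.mem_insert_of_mem ha')
    have h1 : f a * ∏ a ∈ T, f a - b ^ (T.card + 1) =
        f a * (∏ a ∈ T, f a - b ^ T.card) + (f a - b) * b ^ T.card := by ring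
    rw [h1]
    refine (norm_add_le _ _).trans ?_
    rw [norm_mul, norm_mul, norm_pow, add_comm]
    have h2 := hf a (Finset.mem_insert_self _ _)
    refine add_le_add ?_ ?_
    · exact mul_le_of_le_one_right (norm_nonneg _) (pow_le_one₀ (norm_nonneg _) hb)
    · exact (mul_le_of_le_one_left (norm_nonneg _) h2).trans ih

lemma norm_centredChar_le (f : α → ℝ) (u : ℝ) : ‖centredChar μ f u‖ ≤ 1 := by
  unfold centredChar
  refine (norm_integral_le_of_norm_le_const (C := 1) (Eventually.of_forall fun x => ?_)).trans
    (by simp)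
  rw [Complex.norm_exp_ofReal_mul_I]

end Taylor

section Independence

variable {ι E : Type*} [Fintype ι] [DecidableEq ι] [MeasurableSpace E] (μ : Measure E)
  [IsProbabilityMeasure μ]

/-- Functions of disjoint sets of coordinates are independent. -/
lemma integral_mul_of_dependsOn {f g : (ι → E) → ℂ} (hf : Measurable f) (hg : Measurable g)
    {S T : Finset ι} (hST : Disjoint S T) (hfS : DependsOn f (S : Set ι))
    (hgT : DependsOn g (T : Set ι)) :
    ∫ z, f z * g z ∂(Measure.pi fun _ => μ) =
      (∫ z, f z ∂(Measure.pi fun _ => μ)) * ∫ z, g z ∂(Measure.pi fun _ => μ) := by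
  obtain ⟨y⟩ : Nonempty E := nonempty_of_isProbabilityMeasure μ
  have hind := (iIndepFun_pi (μ := fun _ : ι => μ) (X := fun _ => (id : E → E))
    fun _ => aemeasurable_id).indepFun_finset S T hST fun i => measurable_pi_apply i
  have hext : ∀ U : Finset ι, Measurable fun (v : U → E) (i : ι) =>
      if h : i ∈ U then v ⟨i, h⟩ else y := fun U => by
    refine measurable_pi_lambda _ fun i => ?_
    by_cases h : i ∈ U
    · simp only [h, dite_true]; fun_prop
    · simp only [h, dite_false]; fun_prop
  have hfe : ∀ z : ι → E, f z = f fun i => if h : i ∈ S then (fun j : S => z j) ⟨i, h⟩ else y :=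
    fun z => hfS fun i hi => by rw [dif_pos (by exact_mod_cast hi)]
  have hge : ∀ z : ι → E, g z = g fun i => if h : i ∈ T then (fun j : T => z j) ⟨i, h⟩ else y :=
    fun z => hgT fun i hi => by rw [dif_pos (by exact_mod_cast hi)]
  have := IndepFun.integral_fun_comp_mul_comp (𝕜 := ℂ)
    (X := fun (z : ι → E) (i : S) => z i) (Y := fun (z : ι → E) (i : T) => z i)
    (f := f ∘ fun (v : S → E) (i : ι) => if h : i ∈ S then v ⟨i, h⟩ else y)
    (g := g ∘ fun (v : T → E) (i : ι) => if h : i ∈ T then v ⟨i, h⟩ else y) hind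
    (measurable_pi_lambda _ fun i => measurable_pi_apply _).aemeasurable
    (measurable_pi_lambda _ fun i => measurable_pi_apply _).aemeasurable
    (hf.comp (hext S)).aestronglyMeasurable (hg.comp (hext T)).aestronglyMeasurable
  calc _ = _ := integral_congr_ae (Eventually.of_forall fun z =>
        congrArg₂ (· * ·) (hfe z) (hge z))
    _ = _ := this
    _ = _ := by
      congr 1
      · exact integral_congr_ae (Eventually.of_forall fun z => (hfe z).symm)
      · exact integral_congr_ae (Eventually.of_forall fun z => (hge z).symm)

/-- Functions that depend on different classes of coordinates are independent. -/
lemma integral_prod_of_dependsOn {A : Type*} [DecidableEq A] (cls : ι → A) (T : Finset A)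
    {f : A → (ι → E) → ℂ} (hf : ∀ a, Measurable (f a))
    (hfS : ∀ a, DependsOn (f a) {i | cls i = a}) :
    ∫ z, ∏ a ∈ T, f a z ∂(Measure.pi fun _ => μ) =
      ∏ a ∈ T, ∫ z, f a z ∂(Measure.pi fun _ => μ) := by
  induction T using Finset.induction_on with
  | empty => simp
  | insert a T ha ih =>
    simp_rw [Finset.prod_insert ha]
    rw [integral_mul_of_dependsOn μ (S := Finset.univ.filter fun i => cls i = a)
      (T := Finset.univ.filter fun i => cls i ∈ T) (hf a)
      (Finset.measurable_prod _ fun a _ => hf a), ih]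
    · rw [Finset.disjoint_left]
      intro i hi hi'
      simp only [Finset.mem_filter, Finset.mem_univ, true_and] at hi hi'
      exact ha (hi ▸ hi')
    · intro x y h
      exact hfS a fun i hi => h i (by simpa using hi)
    · intro x y h
      refine Finset.prod_congr rfl fun b hb => hfS b fun i hi => h i ?_
      have : cls i = b := hi
      simpa [this] using hb

end Independence

section LabelMeans

variable {A : Type*} [DecidableEq A] {N : ℕ} [Fintype A] [MeasurableSpace A]
  [MeasurableSingletonClass A] (ν : Measure A) [IsProbabilityMeasure ν]

/-- A sum over the classes of a function of the class size has a small variance when the function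
is close to linear. -/
lemma variance_sum_labelCount_le {ℓ : ℕ → ℝ} {D q Q : ℝ} {n : ℕ} (hn : 0 < n)
    (h1 : ∀ m, |ℓ (m + 1) - ℓ m - (ℓ (n + 1) - ℓ n)| ≤ D)
    (h2 : ∀ m : ℕ, |ℓ (m + 1) - ℓ m - (ℓ (n + 1) - ℓ n)| ≤ D * q * |(m : ℝ) - n|)
    (hq0 : 0 ≤ q) (hQ : q * n ≤ Q) :
    Var[fun c : Fin N → A => ∑ a, ℓ (labelCount c a); Measure.pi fun _ : Fin N => ν] ≤
      D ^ 2 * (4 * Q ^ 2 + 2) / n *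
        ∑ a, (N * ν.real {a} + (N * ν.real {a} - n) ^ 2 + 1) := by
  -- `p` measures the deviation of `ℓ` from the linear function of slope `ℓ (n + 1) - ℓ n`; it is
  -- estimated by `h2` for `m ≤ 2 * n` and by `h1` for larger `m`
  obtain ⟨p, hp⟩ : ∃ p : ℕ → ℝ, p = fun m => ℓ (m + 1) - ℓ m - (ℓ (n + 1) - ℓ n) := ⟨_, rfl⟩
  have hp1 : ∀ m, |p m| ≤ D := fun m => by rw [hp]; exact h1 m
  have hp2 : ∀ m : ℕ, |p m| ≤ D * q * |(m : ℝ) - n| := fun m => by rw [hp]; exact h2 m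
  have hn' : (0 : ℝ) < n := by exact_mod_cast hn
  have hpt : ∀ m : ℕ, (m : ℝ) * p (m - 1) ^ 2 ≤
      D ^ 2 * (4 * Q ^ 2 + 2) / n * (((m : ℝ) - n) ^ 2 + 1) := fun m => by
    rcases Nat.eq_zero_or_pos m with rfl | hm
    · simp only [Nat.cast_zero, zero_mul]; positivity
    have hm1 : ((m - 1 : ℕ) : ℝ) = m - 1 := by rw [Nat.cast_sub hm, Nat.cast_one]
    have e1 : D ^ 2 * (4 * Q ^ 2 + 2) / n * (((m : ℝ) - n) ^ 2 + 1) =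
        (D ^ 2 * (4 * Q ^ 2 + 2) * (((m : ℝ) - n) ^ 2 + 1)) / n := by ring
    rw [e1, le_div_iff₀ hn']
    have hm0 : (0 : ℝ) ≤ m := Nat.cast_nonneg m
    rcases le_total (m : ℝ) (2 * n) with h | h
    · have h3 : p (m - 1) ^ 2 ≤ (D * q) ^ 2 * (2 * (((m : ℝ) - n) ^ 2 + 1)) := by
        have h4 := hp2 (m - 1)
        rw [hm1] at h4
        rw [← sq_abs]
        refine (pow_le_pow_left₀ (abs_nonneg _) h4 2).trans ?_
        rw [mul_pow, sq_abs]
        refine mul_le_mul_of_nonneg_left ?_ (sq_nonneg _)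
        nlinarith [sq_nonneg ((m : ℝ) - n + 1)]
      have h5 : (m : ℝ) * p (m - 1) ^ 2 * n ≤
          2 * n * ((D * q) ^ 2 * (2 * (((m : ℝ) - n) ^ 2 + 1))) * n := by gcongr
      refine h5.trans ?_
      have h6 : (q * n) ^ 2 ≤ Q ^ 2 := pow_le_pow_left₀ (by positivity) hQ 2
      have h7 : 2 * n * ((D * q) ^ 2 * (2 * (((m : ℝ) - n) ^ 2 + 1))) * n =
          D ^ 2 * (4 * (q * n) ^ 2) * (((m : ℝ) - n) ^ 2 + 1) := by ring
      rw [h7]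
      gcongr
      linarith
    · have h3 : p (m - 1) ^ 2 ≤ D ^ 2 := by
        rw [← sq_abs]; exact pow_le_pow_left₀ (abs_nonneg _) (hp1 _) 2
      have h5 : (m : ℝ) * p (m - 1) ^ 2 * n ≤ D ^ 2 * (m * n) := by
        have := mul_le_mul_of_nonneg_left h3 (mul_nonneg hm0 hn'.le)
        linarith
      refine h5.trans ?_
      rw [mul_assoc]
      refine mul_le_mul_of_nonneg_left ?_ (sq_nonneg D)
      have h6 : (m : ℝ) * n ≤ 2 * ((m : ℝ) - n) ^ 2 := by nlinarith
      nlinarith [sq_nonneg ((m : ℝ) - n), sq_nonneg Q,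
        mul_nonneg (sq_nonneg Q) (sq_nonneg ((m : ℝ) - n))]
  have hes := efron_stein ν (fun c : Fin N → A => ∑ a, ℓ (labelCount c a)) (BddMeas.of_finite _)
    (fun i c => ∑ a, ℓ (labelCountErase i c a) + (ℓ (n + 1) - ℓ n)) (fun i => BddMeas.of_finite _)
    (fun i x y => by simp only [labelCountErase_update])
  refine hes.trans ?_
  rw [← integral_finsetSum _ fun i _ => (BddMeas.of_finite _).integrable _, Finset.mul_sum]
  calc ∫ c : Fin N → A, ∑ i, (∑ a, ℓ (labelCount c a) -
        (∑ a, ℓ (labelCountErase i c a) + (ℓ (n + 1) - ℓ n))) ^ 2 ∂(Measure.pi fun _ => ν)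
      = ∫ c : Fin N → A, ∑ a, (labelCount c a : ℝ) * p (labelCount c a - 1) ^ 2
          ∂(Measure.pi fun _ => ν) := by
        refine integral_congr_ae (Eventually.of_forall fun c => ?_)
        simp only
        have hterm : ∀ i, (∑ a, ℓ (labelCount c a) -
            (∑ a, ℓ (labelCountErase i c a) + (ℓ (n + 1) - ℓ n))) ^ 2 =
            p (labelCount c (c i) - 1) ^ 2 := fun i => by
          congr 1
          rw [← sub_sub, ← Finset.sum_sub_distrib,
            Finset.sum_eq_single_of_mem (c i) (Finset.mem_univ _) fun a _ ha => by
              rw [labelCount_eq i c a, if_neg (Ne.symm ha), add_zero, sub_self],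
            labelCount_eq i c (c i), if_pos rfl, Nat.add_sub_cancel, hp]
        rw [Finset.sum_congr rfl fun i _ => hterm i, ← Finset.sum_fiberwise Finset.univ c]
        refine Finset.sum_congr rfl fun a _ => ?_
        rw [labelCount, ← nsmul_eq_mul, ← Finset.sum_const]
        refine Finset.sum_congr rfl fun i hi => ?_
        rw [(Finset.mem_filter.1 hi).2, labelCount]
    _ = ∑ a, ∫ c : Fin N → A, (labelCount c a : ℝ) * p (labelCount c a - 1) ^ 2
          ∂(Measure.pi fun _ => ν) :=
        integral_finsetSum _ fun a _ => (BddMeas.of_finite _).integrable _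
    _ ≤ ∑ a, D ^ 2 * (4 * Q ^ 2 + 2) / n * (N * ν.real {a} + (N * ν.real {a} - n) ^ 2 + 1) := by
        refine Finset.sum_le_sum fun a _ => ?_
        have hb : BddMeas fun c : Fin N → A => ((labelCount c a : ℝ) - n) ^ 2 :=
          BddMeas.of_finite _
        refine (integral_mono ((BddMeas.of_finite _).integrable _)
          (((hb.integrable _).add (integrable_const 1)).const_mul _)
          fun c => hpt (labelCount c a)).trans ?_
        rw [integral_const_mul]
        refine mul_le_mul_of_nonneg_left ?_ (by positivity)
        have h8 := integral_add (hb.integrable (Measure.pi fun _ : Fin N => ν))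
          (integrable_const (1 : ℝ))
        simp only [integral_const, probReal_univ, smul_eq_mul, mul_one] at h8
        have h9 := integral_sq_labelCount_sub_le (N := N) ν a n
        calc _ = _ := h8
          _ ≤ _ := by linarith

end LabelMeans

/-! ### The total length of a sample as a function of the sample size -/

section SumVariance

variable {d : ℕ} (μ : Measure (Pt d))

/-- The variance of the graph functional of an i.i.d. sample of `m` points, dilated by `s`. -/
noncomputable def sumVar (c : ℝ) (k : ℕ) (w : ℝ → ℝ) (s : ℝ) (m : ℕ) : ℝ :=
  Var[fun z => graphSum c k w (fun i => s • z i) Finset.univ; Measure.pi fun _ : Fin m => μ]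

/-- The characteristic function of the centred graph functional of an i.i.d. sample of `m` points,
dilated by `s`. -/
noncomputable def sumChar (c : ℝ) (k : ℕ) (w : ℝ → ℝ) (s : ℝ) (m : ℕ) (u : ℝ) : ℂ :=
  centredChar (Measure.pi fun _ : Fin m => μ)
    (fun z => graphSum c k w (fun i => s • z i) Finset.univ) u

variable {c : ℝ} {k : ℕ} {s : ℝ} {w : ℝ → ℝ}

lemma sumVar_nonneg (m : ℕ) : 0 ≤ sumVar μ c k w s m := variance_nonneg _ _

lemma measurable_graphSum_smul {ι : Type*} (hwm : Measurable w) (S : Finset ι) :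
    Measurable fun z : ι → Pt d => graphSum c k w (fun i => s • z i) S :=
  measurable_graphSum c k hwm (φ := fun i (z : ι → Pt d) => s • z i) (fun i => by fun_prop) S

lemma bddMeas_graphSum_smul {ι : Type*} (hc0 : 0 ≤ c) (hc1 : c ≤ 1) (hw : BddMeas w)
    (S : Finset ι) :
    BddMeas fun z : ι → Pt d => graphSum c k w (fun i => s • z i) S :=
  bddMeas_graphSum hc0 hc1 k hw (φ := fun i (z : ι → Pt d) => s • z i) (fun i => by fun_prop) S

variable [IsProbabilityMeasure μ] {ι : Type*} [Fintype ι]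

lemma exists_measurePreserving_graphSum_eq (S : Finset ι) :
    ∃ φ : (ι → Pt d) → (Fin S.card → Pt d),
      MeasurePreserving φ (Measure.pi fun _ => μ) (Measure.pi fun _ => μ) ∧
      ∀ (c : ℝ) (k : ℕ) (w : ℝ → ℝ) (s : ℝ) (z : ι → Pt d), graphSum c k w (fun i => s • z i) S =
        graphSum c k w (fun i => s • φ z i) Finset.univ := by
  obtain ⟨e, he⟩ := exists_embedding_map_univ S
  refine ⟨fun z j => z (e j), measurePreserving_pi_comp μ e e.injective, fun c k w s z => ?_⟩
  have := graphSum_map (c := c) (k := k) (w := w) (x := fun i => s • z i) e Finset.univ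
  rwa [he] at this

lemma variance_graphSum_eq_sumVar (hw : Measurable w) (S : Finset ι) :
    Var[fun z => graphSum c k w (fun i => s • z i) S; Measure.pi fun _ : ι => μ] =
      sumVar μ c k w s S.card := by
  obtain ⟨φ, hφ, h⟩ := exists_measurePreserving_graphSum_eq μ S
  unfold sumVar
  simp_rw [h]
  rw [← hφ.map_eq, variance_map (measurable_graphSum_smul hw _).aemeasurable
    hφ.measurable.aemeasurable]
  rfl

lemma centredChar_graphSum_eq_sumChar (hw : Measurable w) (S : Finset ι) (u : ℝ) :
    centredChar (Measure.pi fun _ : ι => μ) (fun z => graphSum c k w (fun i => s • z i) S) u =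
      sumChar μ c k w s S.card u := by
  obtain ⟨φ, hφ, h⟩ := exists_measurePreserving_graphSum_eq μ S
  unfold sumChar
  simp_rw [h]
  rw [← hφ.map_eq, centredChar_map hφ.measurable (measurable_graphSum_smul hw _)]

variable (hd : 1 ≤ d) (hac : μ ≪ volume) (hc0 : 0 ≤ c) (hc1 : c ≤ 1)
  (hs : 0 < s) {B r : ℝ} (hwm : Measurable w) (hwB : ∀ t, |w t| ≤ B) (hwr : ∀ t, r < t → w t = 0)

include hd hac hc0 hc1 hs hwm hwB hwr in
/-- The variance grows at most linearly in the sample size. -/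
lemma sumVar_le (m : ℕ) : sumVar μ c k w s m ≤ (2 * (removalConst d k * B)) ^ 2 * m := by
  have h := variance_blocks_le (A := Unit) (ι := Fin m) hd μ hac hc0 hc1 k hs hwm hwB hwr
    (q := 1) (fun _ => measureReal_le_one) (fun _ => ()) (fun _ => Finset.univ) (fun _ => ∅)
    (fun _ _ _ => rfl) (fun _ _ _ => rfl)
  have h0 : ∀ x : Fin m → Pt d, graphSum c k w x ∅ = 0 := fun x => by simp [graphSum]
  simpa [h0, sumVar] using h

include hd hac hc0 hc1 hs hwm hwB hwr in
/-- Samples of similar sizes have similar variances: take one to be a part of the other. -/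
lemma abs_sumVar_sub_le {q : ℝ} (hq : ∀ y, μ.real (Metric.closedBall y (3 * r / s)) ≤ q)
    {θ : ℝ} (hθ : 0 < θ) (m n : ℕ) :
    |sumVar μ c k w s m - sumVar μ c k w s n| ≤ (2 * (removalConst d k * B)) ^ 2 *
      ((1 + n * q) * |(m : ℝ) - n| / (2 * θ) + θ * (m + n)) := by
  obtain ⟨S, hS⟩ : ∃ S : ℕ → Finset (Fin (m + n)),
      S = fun a => Finset.univ.filter fun i : Fin (m + n) => (i : ℕ) < a := ⟨_, rfl⟩
  have hcard : ∀ a ≤ m + n, (S a).card = a := fun a ha => by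
    rw [hS]; exact Fin.card_filter_val_lt.trans (min_eq_right ha)
  have hmono : ∀ a b, a ≤ b → S a ⊆ S b := fun a b hab i hi => by
    rw [hS] at hi ⊢
    simp only [Finset.mem_filter, Finset.mem_univ, true_and] at hi ⊢
    omega
  have hsd : ((S m \ S n ∪ S n \ S m).card : ℝ) = |(m : ℝ) - n| := by
    have key : ∀ a b, a ≤ b → b ≤ m + n → ((S b \ S a ∪ S a \ S b).card : ℝ) = (b : ℝ) - a :=
      fun a b hab hb => by
        rw [Finset.sdiff_eq_empty_iff_subset.2 (hmono a b hab), Finset.union_empty,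
          Finset.card_sdiff_of_subset (hmono a b hab), hcard b hb, hcard a (hab.trans hb),
          Nat.cast_sub hab]
    rcases le_total n m with h | h
    · rw [key n m h (by omega), abs_of_nonneg (by simpa using h)]
    · rw [Finset.union_comm, key m n h (by omega), abs_sub_comm, abs_of_nonneg (by simpa using h)]
  have hb : BddMeas w := ⟨hwm, B, hwB⟩
  have hv := variance_blocks_le (A := Unit) (ι := Fin (m + n)) hd μ hac hc0 hc1 k hs hwm hwB hwr
    hq (fun _ => ()) (fun _ => S m) (fun _ => S n) (fun _ _ _ => rfl) (fun _ _ _ => rfl)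
  simp only [Finset.univ_unique, Finset.sum_singleton, hsd, hcard n (by omega)] at hv
  have h1 := abs_variance_sub_le
    (bddMeas_graphSum_smul (s := s) (k := k) (d := d) hc0 hc1 hb (S m))
    (Measure.pi fun _ : Fin (m + n) => μ)
    (bddMeas_graphSum_smul (s := s) (k := k) hc0 hc1 hb (S n)) hθ
  rw [variance_graphSum_eq_sumVar μ hwm, variance_graphSum_eq_sumVar μ hwm, hcard m (by omega),
    hcard n (by omega)] at h1
  refine h1.trans ?_
  have h2 := sumVar_le (k := k) μ hd hac hc0 hc1 hs hwm hwB hwr m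
  have h3 := sumVar_le (k := k) μ hd hac hc0 hc1 hs hwm hwB hwr n
  have h4 := div_le_div_of_nonneg_right hv (by positivity : 0 ≤ 2 * θ)
  have h5 := mul_le_mul_of_nonneg_left (add_le_add h2 h3) hθ.le
  refine (add_le_add h4 h5).trans (le_of_eq ?_)
  ring

set_option maxHeartbeats 800000 in
include hd hac hc0 hc1 hs hwm hwB hwr in
/-- The characteristic function of a block of `m` points is close to that of a Gaussian variable
whose variance is that of a block of `n = j ^ 4` points. -/
lemma norm_sumChar_sub_le {q Q : ℝ} (hq : ∀ y, μ.real (Metric.closedBall y (3 * r / s)) ≤ q)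
    {j : ℕ} (hj : 0 < j) (hQ : q * (j ^ 4 : ℕ) ≤ Q) (m : ℕ) (u : ℝ) :
    ‖sumChar μ c k w s m u - ((Real.exp (-(u ^ 2 * sumVar μ c k w s (j ^ 4) / 2)) : ℝ) : ℂ)‖ ≤
      (3 * (|u| * (2 * (2 * j ^ 4 * (2 * j ^ 4 * B)))) ^ 3 +
        (u ^ 2 * ((2 * (removalConst d k * B)) ^ 2 * j ^ 4) / 2) ^ 2 +
        2 * u ^ 2 * (2 * (removalConst d k * B)) ^ 2 * (1 + Q) * j ^ 3) +
      10 * u ^ 2 * (2 * (removalConst d k * B)) ^ 2 * (1 + Q) / j *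
        ((m : ℝ) - (j ^ 4 : ℕ)) ^ 2 := by
  have hb : BddMeas w := ⟨hwm, B, hwB⟩
  have hB0 : 0 ≤ B := (abs_nonneg _).trans (hwB 0)
  obtain ⟨D, hD⟩ : ∃ D : ℝ, D = (2 * (removalConst d k * B)) ^ 2 := ⟨_, rfl⟩
  have hD0 : 0 ≤ D := by rw [hD]; positivity
  obtain ⟨n, hn⟩ : ∃ n : ℕ, n = j ^ 4 := ⟨_, rfl⟩
  have hnR : (n : ℝ) = (j : ℝ) ^ 4 := by rw [hn]; push_cast; ring
  have hj1 : (1 : ℝ) ≤ j := by exact_mod_cast hj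
  have hj0 : (0 : ℝ) < j := by linarith
  have hq0 : 0 ≤ q := measureReal_nonneg.trans (hq 0)
  rw [← hn] at hQ ⊢
  rw [← hD]
  have hQ0 : 0 ≤ Q := le_trans (by positivity) hQ
  have hVn := sumVar_le (k := k) μ hd hac hc0 hc1 hs hwm hwB hwr n
  have hVm := sumVar_le (k := k) μ hd hac hc0 hc1 hs hwm hwB hwr m
  have hVn0 := sumVar_nonneg μ (c := c) (k := k) (w := w) (s := s) n
  -- `θ = 1 / j` balances the two terms for `|m - n|` of order `j ^ 2`, the standard deviation of
  -- `m`
  have hdiff := abs_sumVar_sub_le (k := k) μ hd hac hc0 hc1 hs hwm hwB hwr hq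
    (θ := 1 / j) (by positivity) m n
  rw [← hD] at hVn hVm hdiff
  set Vn := sumVar μ c k w s n
  set Vm := sumVar μ c k w s m with hVmdef
  set x : ℝ := (m : ℝ) - n
  have hx : |x| ≤ (x ^ 2 / j ^ 2 + j ^ 2) / 2 := by
    have h1 : 0 ≤ (|x| - j ^ 2) ^ 2 / j ^ 2 := by positivity
    have h2 : (|x| - j ^ 2) ^ 2 / j ^ 2 = x ^ 2 / j ^ 2 + j ^ 2 - 2 * |x| := by
      rw [← sq_abs x]; field_simp; ring
    linarith
  have hx2 : x ^ 2 / j ^ 2 * j = x ^ 2 / j := by field_simp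
  have hxj : x ^ 2 / j ^ 2 / j ≤ x ^ 2 / j := by
    rw [div_div]
    exact div_le_div_of_nonneg_left (sq_nonneg x) hj0 (by nlinarith)
  have hX0 : 0 ≤ x ^ 2 / j := by positivity
  have e1 : ‖sumChar μ c k w s m u - ((1 - u ^ 2 * Vm / 2 : ℝ) : ℂ)‖ ≤
      3 * (|u| * (2 * (2 * j ^ 4 * (2 * j ^ 4 * B)))) ^ 3 + 6 * u ^ 2 * D * (x ^ 2 / j) := by
    have hbd := bddMeas_graphSum_smul (ι := Fin m) (s := s) (k := k) (d := d) hc0 hc1 hb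
      Finset.univ
    -- blocks of at most twice the typical size are bounded variables; the variance of larger ones
    -- is absorbed by `x ^ 2`
    rcases le_total (m : ℝ) (2 * n) with h | h
    · have h1 := norm_centredChar_sub_taylor_le_cube hbd (Measure.pi fun _ => μ) u
        (M := 2 * j ^ 4 * (2 * j ^ 4 * B)) (fun z => by
          refine (abs_graphSum_le hc0 hc1 hwB _ _).trans ?_
          rw [Finset.card_univ, Fintype.card_fin, ← hnR]
          gcongr)
      refine h1.trans (le_add_of_nonneg_right (by positivity))
    · have h1 := norm_centredChar_sub_taylor_le_variance hbd (Measure.pi fun _ => μ) u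
      refine h1.trans (le_trans ?_ (le_add_of_nonneg_left (by positivity)))
      have h2 : (m : ℝ) ≤ 2 * (x ^ 2 / j) := by
        have hn1 : (j : ℝ) ≤ n := by
          rw [hnR]; nlinarith [pow_le_pow_right₀ hj1 (show 1 ≤ 4 by norm_num)]
        rw [← mul_div_assoc, le_div_iff₀ hj0]
        have : (m : ℝ) * j ≤ m * n := by gcongr
        refine this.trans ?_
        simp only [x]
        nlinarith
      have h3 := hVm.trans (mul_le_mul_of_nonneg_left h2 hD0)
      have h4 := mul_le_mul_of_nonneg_left h3 (by positivity : 0 ≤ 3 * u ^ 2)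
      refine le_trans (le_of_eq ?_) (h4.trans (le_of_eq (by ring)))
      rfl
  have e2 : ‖((1 - u ^ 2 * Vm / 2 : ℝ) : ℂ) - ((1 - u ^ 2 * Vn / 2 : ℝ) : ℂ)‖ ≤
      u ^ 2 / 2 * (D * ((1 + Q) * ((x ^ 2 / j + j ^ 3) / 4) +
        (2 * j ^ 3 + (x ^ 2 / j + j) / 2))) := by
    rw [← Complex.ofReal_sub, Complex.norm_real, Real.norm_eq_abs,
      show 1 - u ^ 2 * Vm / 2 - (1 - u ^ 2 * Vn / 2) = -(u ^ 2 / 2 * (Vm - Vn)) by ring, abs_neg,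
      abs_mul, abs_of_nonneg (by positivity : 0 ≤ u ^ 2 / 2)]
    refine mul_le_mul_of_nonneg_left (hdiff.trans (mul_le_mul_of_nonneg_left ?_ hD0))
      (by positivity)
    refine add_le_add ?_ ?_
    · have h1 : (1 + n * q) * |x| / (2 * (1 / j)) = (1 + n * q) * (|x| * j / 2) := by
        field_simp
      rw [h1]
      have h2 : |x| * j ≤ (x ^ 2 / j + j ^ 3) / 2 := by
        refine (mul_le_mul_of_nonneg_right hx hj0.le).trans (le_of_eq ?_)
        rw [← hx2]; ring
      refine mul_le_mul (by linarith) (by linarith) (by positivity) (by linarith)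
    · have hm : (m : ℝ) + n ≤ 2 * j ^ 4 + |x| := by
        have := le_abs_self x
        simp only [x] at this ⊢
        linarith
      have h3 : 1 / (j : ℝ) * (m + n) ≤ 1 / j * (2 * j ^ 4 + (x ^ 2 / j ^ 2 + j ^ 2) / 2) :=
        mul_le_mul_of_nonneg_left (hm.trans (by linarith)) (by positivity)
      refine h3.trans ?_
      have h4 : 1 / (j : ℝ) * (2 * j ^ 4 + (x ^ 2 / j ^ 2 + j ^ 2) / 2) =
          2 * j ^ 3 + (x ^ 2 / j ^ 2 / j + j) / 2 := by field_simp
      rw [h4]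
      linarith
  have e3 := norm_exp_neg_sub_le (y := u ^ 2 * Vn / 2) (by positivity)
  rw [norm_sub_rev] at e3
  have e4 : (u ^ 2 * Vn / 2) ^ 2 ≤ (u ^ 2 * (D * j ^ 4) / 2) ^ 2 := by
    rw [hnR] at hVn
    gcongr
  have htri : sumChar μ c k w s m u - ((Real.exp (-(u ^ 2 * Vn / 2)) : ℝ) : ℂ) =
      (sumChar μ c k w s m u - ((1 - u ^ 2 * Vm / 2 : ℝ) : ℂ)) +
      (((1 - u ^ 2 * Vm / 2 : ℝ) : ℂ) - ((1 - u ^ 2 * Vn / 2 : ℝ) : ℂ)) +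
      (((1 - u ^ 2 * Vn / 2 : ℝ) : ℂ) - ((Real.exp (-(u ^ 2 * Vn / 2)) : ℝ) : ℂ)) := by ring
  rw [htri]
  refine ((norm_add_le _ _).trans (add_le_add ((norm_add_le _ _).trans (add_le_add e1 e2))
    (e3.trans e4))).trans ?_
  have hj3 : (j : ℝ) ≤ j ^ 3 := by nlinarith [pow_le_pow_right₀ hj1 (show 1 ≤ 3 by norm_num)]
  have e5 : (1 + Q) * ((x ^ 2 / j + j ^ 3) / 4) + (2 * j ^ 3 + (x ^ 2 / j + j) / 2) ≤
      (1 + Q) * (4 * j ^ 3) + (1 + Q) * (2 * (x ^ 2 / j)) := by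
    have h1 := mul_nonneg hQ0 hX0
    have h2 := mul_nonneg hQ0 (pow_nonneg hj0.le 3)
    linarith
  have hu : 0 ≤ u ^ 2 / 2 * D := by positivity
  have e6 := mul_le_mul_of_nonneg_left e5 hu
  have e7 : 6 * u ^ 2 * D * (x ^ 2 / j) ≤ 6 * u ^ 2 * D * ((1 + Q) * (x ^ 2 / j)) := by
    gcongr; nlinarith
  have e8 : 10 * u ^ 2 * D * (1 + Q) / j * x ^ 2 = 10 * u ^ 2 * D * ((1 + Q) * (x ^ 2 / j)) := by
    ring
  have e9 : 0 ≤ u ^ 2 * D * ((1 + Q) * (x ^ 2 / j)) := by positivity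
  rw [e8]
  linarith

end SumVariance

/-! ### Sums over independently labelled samples -/

section LabelledSum

lemma BddMeas.of_finite_left {α β : Type*} [Finite α] [MeasurableSpace α]
    [MeasurableSingletonClass α] [MeasurableSpace β] {f : α × β → ℝ}
    (hf : ∀ a, BddMeas fun b => f (a, b)) : BddMeas f := by
  refine ⟨measurable_from_prod_countable_right fun a => (hf a).1, ?_⟩
  choose B hB using fun a => (hf a).2
  obtain ⟨M, hM⟩ := (Set.finite_range B).bddAbove
  exact ⟨M, fun x => (hB x.1 x.2).trans (hM ⟨x.1, rfl⟩)⟩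

variable {d : ℕ} (μ : Measure (Pt d)) [IsProbabilityMeasure μ]
  {A : Type*} [DecidableEq A] [Fintype A]

/-- The sum of the graph functionals of the classes of a labelled sample. -/
noncomputable def labelledSum {N : ℕ} (c : ℝ) (k : ℕ) (w : ℝ → ℝ) (s : ℝ) (lab : Fin N → A)
    (z : Fin N → Pt d) : ℝ :=
  ∑ a, graphSum c k w (fun i => s • z i) (Finset.univ.filter fun i => lab i = a)

variable {N k : ℕ} {c s : ℝ} {w : ℝ → ℝ}

lemma integral_labelledSum (hc0 : 0 ≤ c) (hc1 : c ≤ 1) (hw : BddMeas w) (lab : Fin N → A) :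
    ∫ z, labelledSum c k w s lab z ∂(Measure.pi fun _ => μ) =
      ∑ a, meanSum μ c k w s (labelCount lab a) := by
  unfold labelledSum
  rw [integral_finsetSum _ fun a _ => (bddMeas_graphSum_smul hc0 hc1 hw _).integrable _]
  exact Finset.sum_congr rfl fun a _ => integral_graphSum_eq_meanSum μ hw.1 s _

/-- Given the labels, the classes of a labelled sample are independent. -/
lemma integral_exp_labelledSum (hw : BddMeas w) (lab : Fin N → A)
    (u e : ℝ) :
    ∫ z, Complex.exp (((u * (labelledSum c k w s lab z - e) : ℝ) : ℂ) * Complex.I)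
        ∂(Measure.pi fun _ => μ) =
      Complex.exp (((u * (∑ a, meanSum μ c k w s (labelCount lab a) - e) : ℝ) : ℂ) * Complex.I) *
        ∏ a, sumChar μ c k w s (labelCount lab a) u := by
  obtain ⟨S, hS⟩ : ∃ S : A → Finset (Fin N), S = fun a => Finset.univ.filter fun i => lab i = a :=
    ⟨_, rfl⟩
  obtain ⟨f, hf⟩ : ∃ f : A → (Fin N → Pt d) → ℂ, f = fun a z =>
      Complex.exp (((u * (graphSum c k w (fun i => s • z i) (S a) -
        meanSum μ c k w s (labelCount lab a)) : ℝ) : ℂ) * Complex.I) := ⟨_, rfl⟩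
  have hfm : ∀ a, Measurable (f a) := fun a => by
    have := measurable_graphSum_smul (d := d) (c := c) (k := k) (s := s) hw.1 (S a)
    rw [hf]
    fun_prop
  have hdep : ∀ a, DependsOn (f a) {i | lab i = a} := fun a x y h => by
    simp only [hf]
    rw [graphSum_congr (y := fun i => s • y i) fun i hi => ?_]
    rw [hS] at hi
    rw [h i (Finset.mem_filter.1 hi).2]
  have hprod := integral_prod_of_dependsOn μ lab Finset.univ hfm hdep
  have hone : ∀ a, ∫ z, f a z ∂(Measure.pi fun _ => μ) =
      sumChar μ c k w s (labelCount lab a) u := fun a => by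
    have h1 : labelCount lab a = (S a).card := by rw [hS]; rfl
    rw [h1, ← centredChar_graphSum_eq_sumChar μ hw.1 (S a) u, centredChar,
      integral_graphSum_eq_meanSum μ hw.1 s (S a)]
    simp only [hf, h1]
  rw [Finset.prod_congr rfl fun a _ => hone a] at hprod
  rw [← hprod, ← integral_const_mul]
  refine integral_congr_ae (Eventually.of_forall fun z => ?_)
  simp only [hf]
  rw [← Complex.exp_sum, ← Complex.exp_add, ← Finset.sum_mul, ← add_mul, ← Complex.ofReal_sum,
    ← Complex.ofReal_add, ← Finset.mul_sum, ← mul_add, Finset.sum_sub_distrib]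
  have : labelledSum c k w s lab z = ∑ a, graphSum c k w (fun i => s • z i) (S a) := by
    rw [hS]; rfl
  rw [this]
  congr 4
  ring

variable [MeasurableSpace A] [MeasurableSingletonClass A] (ν : Measure A) [IsProbabilityMeasure ν]

lemma bddMeas_labelledSum (hc0 : 0 ≤ c) (hc1 : c ≤ 1) (hw : BddMeas w) :
    BddMeas fun y : (Fin N → A) × (Fin N → Pt d) => labelledSum c k w s y.1 y.2 := by
  refine BddMeas.of_finite_left fun lab => ?_
  simp only [labelledSum]
  exact BddMeas.sum _ fun a _ => bddMeas_graphSum_smul hc0 hc1 hw _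

variable (hd : 1 ≤ d) (hac : μ ≪ volume) (hc0 : 0 ≤ c) (hc1 : c ≤ 1)
  (hs : 0 < s) {B r : ℝ} (hwm : Measurable w) (hwB : ∀ t, |w t| ≤ B) (hwr : ∀ t, r < t → w t = 0)

set_option maxHeartbeats 800000 in
include hd hac hc0 hc1 hs hwm hwB hwr in
/-- The sum over the classes of a labelled sample is approximately Gaussian when there are many
classes and their expected sizes are close to the large number `j ^ 4`. -/
lemma norm_centredChar_labelledSum_sub_le {q Q : ℝ}
    (hq : ∀ y, μ.real (Metric.closedBall y (3 * r / s)) ≤ q)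
    {j : ℕ} (hj : 0 < j) (hQ : q * (j ^ 4 : ℕ) ≤ Q) {κ x2 : ℝ} (hν : ∀ a, ν.real {a} = κ)
    (hx2 : N * κ + (N * κ - (j ^ 4 : ℕ)) ^ 2 = x2) (u : ℝ) :
    ‖centredChar ((Measure.pi fun _ : Fin N => ν).prod (Measure.pi fun _ : Fin N => μ))
        (fun y => labelledSum c k w s y.1 y.2) u -
        ((Real.exp (-(u ^ 2 * sumVar μ c k w s (j ^ 4) / 2)) : ℝ) : ℂ) ^ Fintype.card A‖ ≤
      |u| * √((2 * (removalConst d k * B)) ^ 2 * (4 * Q ^ 2 + 2) / (j ^ 4 : ℕ) *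
        (Fintype.card A * (x2 + 1))) +
      Fintype.card A * ((3 * (|u| * (2 * (2 * j ^ 4 * (2 * j ^ 4 * B)))) ^ 3 +
        (u ^ 2 * ((2 * (removalConst d k * B)) ^ 2 * j ^ 4) / 2) ^ 2 +
        2 * u ^ 2 * (2 * (removalConst d k * B)) ^ 2 * (1 + Q) * j ^ 3) +
      10 * u ^ 2 * (2 * (removalConst d k * B)) ^ 2 * (1 + Q) / j * x2) := by
  have hb : BddMeas w := ⟨hwm, B, hwB⟩
  have hB0 : 0 ≤ B := (abs_nonneg _).trans (hwB 0)
  have hq0 : 0 ≤ q := measureReal_nonneg.trans (hq 0)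
  have hQ0 : 0 ≤ Q := le_trans (by positivity) hQ
  have hn : 0 < j ^ 4 := by positivity
  have hm1 := fun m => norm_sumChar_sub_le (k := k) μ hd hac hc0 hc1 hs hwm hwB hwr hq hj hQ m u
  have hstep := abs_meanStep_sub_le μ hd hac hc0 hc1 k hs hwm hwB hwr hq
  have hstep' := abs_meanStep_le μ hd hac hc0 hc1 k hs hwm hwB
  have hvar := variance_sum_labelCount_le (N := N) ν (ℓ := meanSum μ c k w s) hn
    (fun m => (abs_sub _ _).trans ((add_le_add (hstep' m) (hstep' (j ^ 4))).trans
      (le_of_eq (two_mul _).symm))) (fun m => hstep m (j ^ 4)) hq0 hQ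
  simp only [hν, Finset.sum_const, Finset.card_univ, nsmul_eq_mul, hx2] at hvar
  have hβ : ‖((Real.exp (-(u ^ 2 * sumVar μ c k w s (j ^ 4) / 2)) : ℝ) : ℂ)‖ ≤ 1 := by
    rw [Complex.norm_real, Real.norm_of_nonneg (Real.exp_pos _).le, Real.exp_le_one_iff]
    have := sumVar_nonneg μ (c := c) (k := k) (w := w) (s := s) (j ^ 4)
    have : 0 ≤ u ^ 2 * sumVar μ c k w s (j ^ 4) / 2 := by positivity
    linarith
  -- the explicit constants play no role in what follows
  revert hm1 hvar hβ
  generalize ((Real.exp (-(u ^ 2 * sumVar μ c k w s (j ^ 4) / 2)) : ℝ) : ℂ) = β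
  generalize (3 * (|u| * (2 * (2 * j ^ 4 * (2 * j ^ 4 * B)))) ^ 3 +
        (u ^ 2 * ((2 * (removalConst d k * B)) ^ 2 * j ^ 4) / 2) ^ 2 +
        2 * u ^ 2 * (2 * (removalConst d k * B)) ^ 2 * (1 + Q) * j ^ 3 : ℝ) = a0
  obtain ⟨a1, ha1⟩ : ∃ a1 : ℝ, a1 = 10 * u ^ 2 * (2 * (removalConst d k * B)) ^ 2 * (1 + Q) / j :=
    ⟨_, rfl⟩
  have ha1' : 0 ≤ a1 := by rw [ha1]; positivity
  rw [← ha1]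
  generalize (2 * (removalConst d k * B)) ^ 2 * (4 * Q ^ 2 + 2) / (j ^ 4 : ℕ) *
        (Fintype.card A * (x2 + 1)) = v
  intro hm1 hvar hβ
  set PA := Measure.pi fun _ : Fin N => ν
  set PX := Measure.pi fun _ : Fin N => μ
  have hΘ := bddMeas_labelledSum (N := N) (k := k) (s := s) (d := d) (A := A) hc0 hc1 hb
  obtain ⟨L, hL⟩ : ∃ L : (Fin N → A) → ℝ,
      L = fun lab => ∑ a, meanSum μ c k w s (labelCount lab a) := ⟨_, rfl⟩
  have hLb : BddMeas L := BddMeas.of_finite L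
  have hE : ∫ y, labelledSum c k w s y.1 y.2 ∂(PA.prod PX) = ∫ lab, L lab ∂PA := by
    rw [integral_prod _ (hΘ.integrable _), hL]
    exact integral_congr_ae (Eventually.of_forall fun lab =>
      integral_labelledSum μ hc0 hc1 hb lab)
  -- conditionally on the labels the classes are independent, and the conditional mean is `L`
  have hchar : centredChar (PA.prod PX) (fun y => labelledSum c k w s y.1 y.2) u =
      ∫ lab, Complex.exp (((u * (L lab - ∫ l, L l ∂PA) : ℝ) : ℂ) * Complex.I) *
        ∏ a, sumChar μ c k w s (labelCount lab a) u ∂PA := by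
    unfold centredChar
    rw [hE, integral_prod _ (integrable_exp_mul_I ((BddMeas.const u).mul
      (hΘ.sub (BddMeas.const _))).1 _)]
    refine integral_congr_ae (Eventually.of_forall fun lab => ?_)
    simp only
    rw [integral_exp_labelledSum μ hb lab u, hL]
  have hconst : ∫ _, β ^ Fintype.card A ∂PA = β ^ Fintype.card A := by simp
  have hint : ∀ f : (Fin N → A) → ℂ, Integrable f PA := fun f => Integrable.of_finite
  rw [hchar, ← hconst, ← integral_sub (hint _) (hint _)]
  refine (norm_integral_le_integral_norm _).trans ?_
  have hpt : ∀ lab : Fin N → A,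
      ‖Complex.exp (((u * (L lab - ∫ l, L l ∂PA) : ℝ) : ℂ) * Complex.I) *
        ∏ a, sumChar μ c k w s (labelCount lab a) u - β ^ Fintype.card A‖ ≤
      |u| * |L lab - ∫ l, L l ∂PA| +
        ∑ a, (a0 + a1 * ((labelCount lab a : ℝ) - (j ^ 4 : ℕ)) ^ 2) := fun lab => by
    have hψ : ∀ a ∈ Finset.univ, ‖sumChar μ c k w s (labelCount lab a) u‖ ≤ 1 :=
      fun a _ => norm_centredChar_le _ _ _
    obtain ⟨E, hE⟩ : ∃ E, E = Complex.exp (((u * (L lab - ∫ l, L l ∂PA) : ℝ) : ℂ) * Complex.I) :=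
      ⟨_, rfl⟩
    have hE1 : ‖E - 1‖ ≤ |u| * |L lab - ∫ l, L l ∂PA| := by
      have := norm_exp_mul_I_sub_le (u * (L lab - ∫ l, L l ∂PA)) 0
      rw [sub_zero, abs_mul] at this
      rw [hE]
      simpa using this
    have hP1 : ‖∏ a, sumChar μ c k w s (labelCount lab a) u‖ ≤ 1 := by
      rw [norm_prod]
      exact Finset.prod_le_one (fun _ _ => norm_nonneg _) hψ
    have h1 := norm_prod_sub_pow_le Finset.univ _ β hψ hβ
    rw [Finset.card_univ] at h1
    rw [← hE]
    have h2 : E * ∏ a, sumChar μ c k w s (labelCount lab a) u - β ^ Fintype.card A =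
        (E - 1) * ∏ a, sumChar μ c k w s (labelCount lab a) u +
        (∏ a, sumChar μ c k w s (labelCount lab a) u - β ^ Fintype.card A) := by ring
    rw [h2]
    refine (norm_add_le _ _).trans (add_le_add ?_ (h1.trans ?_))
    · rw [norm_mul]
      exact (mul_le_of_le_one_right (norm_nonneg _) hP1).trans hE1
    · exact Finset.sum_le_sum fun a _ => hm1 _
  have hintR : ∀ f : (Fin N → A) → ℝ, Integrable f PA := fun f => Integrable.of_finite
  refine (integral_mono (hintR _) (hintR _) hpt).trans ?_
  rw [integral_add (hintR _) (hintR _), integral_const_mul, integral_finsetSum _ fun a _ => hintR _]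
  refine add_le_add (mul_le_mul_of_nonneg_left ?_ (abs_nonneg u)) ?_
  · refine (integral_abs_sub_mean_le hLb PA).trans (Real.sqrt_le_sqrt ?_)
    rw [hL]
    exact hvar
  · rw [← Finset.card_univ, ← nsmul_eq_mul]
    refine Finset.sum_le_card_nsmul _ _ _ fun a _ => ?_
    rw [integral_add (hintR _) (hintR _), integral_const_mul]
    simp only [integral_const, probReal_univ, smul_eq_mul, one_mul]
    have h9 := integral_sq_labelCount_sub_le (N := N) ν a (j ^ 4 : ℕ)
    rw [hν a, hx2] at h9
    have := mul_le_mul_of_nonneg_left h9 ha1'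
    linarith

end LabelledSum

/-! ### Deleting the edges between the cells of a partition -/

section BlockComparison

variable {d : ℕ} (μ : Measure (Pt d)) [IsProbabilityMeasure μ]
  {A : Type*}

variable {k : ℕ} {c s σ : ℝ} {w : ℝ → ℝ} {Ψ : A × Pt d → Pt d} {γ : Type*} {cell : Pt d → γ} {L : ℝ}
  {bad : Set (Pt d)} {r : ℝ}

/-- The map `Ψ (a, ·)` contracts each cell by the factor `L⁻¹`, and the points outside `bad` have
no other cell near to them. Then the removal of such a point has the same effect on the cloud of
the points `Ψ (z i)`, dilated by `s = L * σ`, and on the block of the points with the same label,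
dilated by `σ`. -/
lemma removal_eq_removal_of_cell [DecidableEq A] {ι : Type*} [DecidableEq ι] [Fintype ι]
    (hL : 0 < L) (hσ : 0 < σ) (hs : s = L * σ) (hwr : ∀ t, r < t → w t = 0)
    (hΨi : Function.Injective Ψ)
    (hΨ : ∀ a y y', cell y' = cell y → Ψ (a, y') - Ψ (a, y) = L⁻¹ • (y' - y))
    (hbad : ∀ y, y ∉ bad → ∀ y', dist y' y ≤ 3 * r / σ → cell y' = cell y)
    (z : ι → A × Pt d) {l : ι} (hl : (z l).2 ∉ bad) :
    removal c k w (fun i => s • Ψ (z i)) Finset.univ l =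
      removal c k w (fun i => σ • (z i).2) (Finset.univ.filter fun i => (z i).1 = (z l).1) l := by
  classical
  have hs0 : 0 < s := by rw [hs]; positivity
  obtain ⟨S, hS⟩ : ∃ S : Finset ι, S =
      Finset.univ.filter fun i => (z i).1 = (z l).1 ∧ cell (z i).2 = cell (z l).2 := ⟨_, rfl⟩
  have h1 : removal c k w (fun i => s • Ψ (z i)) Finset.univ l =
      removal c k w (fun i => s • Ψ (z i)) S l := by
    refine removal_congr_of_near hwr fun i hi => ?_
    rw [hS]
    simp only [Finset.mem_univ, Finset.mem_filter, true_and, true_iff]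
    -- `y'` is the point of the cell of `l` that `Ψ` would have to send to `Ψ (z i)`
    obtain ⟨y', hy'⟩ : ∃ y', y' = (z l).2 + L • (Ψ (z i) - Ψ (z l)) := ⟨_, rfl⟩
    have hd : dist y' (z l).2 ≤ 3 * r / σ := by
      rw [hy', dist_eq_norm, add_sub_cancel_left, norm_smul, Real.norm_of_nonneg hL.le,
        le_div_iff₀ hσ]
      rw [dist_smul₀, Real.norm_of_nonneg hs0.le, hs, dist_eq_norm] at hi
      linarith
    have hc := hbad _ hl y' hd
    have h2 := hΨ (z l).1 (z l).2 y' hc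
    rw [hy', add_sub_cancel_left, smul_smul, inv_mul_cancel₀ hL.ne', one_smul, ← hy'] at h2
    have h3 : ((z l).1, y') = z i := hΨi (sub_left_injective h2)
    rw [← h3]
    exact ⟨rfl, hc⟩
  have h2 : removal c k w (fun i => σ • (z i).2) (Finset.univ.filter fun i => (z i).1 = (z l).1) l =
      removal c k w (fun i => σ • (z i).2) S l := by
    refine removal_congr_of_near hwr fun i hi => ?_
    rw [hS]
    simp only [Finset.mem_univ, Finset.mem_filter, true_and]
    refine ⟨fun h => ⟨h, hbad _ hl _ ?_⟩, fun h => h.1⟩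
    rw [dist_smul₀, Real.norm_of_nonneg hσ.le] at hi
    rw [le_div_iff₀ hσ]
    linarith
  have hdist : ∀ i ∈ S, ∀ j ∈ S, dist (s • Ψ (z i)) (s • Ψ (z j)) =
      dist (σ • (z i).2) (σ • (z j).2) := fun i hi j hj => by
    rw [hS] at hi hj
    simp only [Finset.mem_univ, Finset.mem_filter, true_and] at hi hj
    have h3 := hΨ (z l).1 (z j).2 (z i).2 (hi.2.trans hj.2.symm)
    have hi' : ((z l).1, (z i).2) = z i := by rw [← hi.1]
    have hj' : ((z l).1, (z j).2) = z j := by rw [← hj.1]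
    rw [hi', hj'] at h3
    rw [dist_smul₀, dist_smul₀, dist_eq_norm, h3, norm_smul, Real.norm_of_nonneg hs0.le,
      Real.norm_of_nonneg hσ.le, norm_inv, Real.norm_of_nonneg hL.le, hs, dist_eq_norm]
    field_simp
  rw [h1, h2]
  unfold removal
  rw [graphSum_congr_dist hdist, graphSum_congr_dist fun i hi j hj =>
    hdist i (Finset.mem_of_mem_erase hi) j (Finset.mem_of_mem_erase hj)]

variable (hd : 1 ≤ d) (hac : μ ≪ volume) (hc0 : 0 ≤ c) (hc1 : c ≤ 1)
  {B : ℝ} (hwm : Measurable w) (hwB : ∀ t, |w t| ≤ B)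

lemma map_smul_absolutelyContinuous {μ : Measure (Pt d)} (hac : μ ≪ volume) (hs : 0 < s) :
    μ.map (fun x => s • x) ≪ volume :=
  (hac.map (by fun_prop)).trans (by
    rw [Measure.map_addHaar_smul _ hs.ne']
    exact Measure.smul_absolutelyContinuous)

variable [MeasurableSpace A] (ν : Measure A) [IsProbabilityMeasure ν]

lemma measurePreserving_unzip (N : ℕ) :
    MeasurePreserving (fun z : Fin N → A × Pt d => (fun i => (z i).1, fun i => (z i).2))
      (Measure.pi fun _ => ν.prod μ)
      ((Measure.pi fun _ : Fin N => ν).prod (Measure.pi fun _ : Fin N => μ)) :=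
  measurePreserving_arrowProdEquivProdArrow A (Pt d) (Fin N) (fun _ => ν) (fun _ => μ)

variable [DecidableEq A] [Fintype A] [MeasurableSingletonClass A]

set_option maxHeartbeats 400000 in
include hd hac hc0 hc1 hwm hwB in
/-- A sample whose law is a mixture of scaled copies of itself behaves like the disjoint union of
its blocks, up to an error caused by the points near the boundaries of the cells. -/
lemma norm_sumChar_sub_labelledSum_le (hL : 0 < L) (hσ : 0 < σ)
    (hs : s = L * σ) (hwr : ∀ t, r < t → w t = 0) (hΨm : Measurable Ψ)
    (hΨi : Function.Injective Ψ) (hΨμ : (ν.prod μ).map Ψ = μ)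
    (hΨ : ∀ a y y', cell y' = cell y → Ψ (a, y') - Ψ (a, y) = L⁻¹ • (y' - y))
    (hbm : MeasurableSet bad)
    (hbad : ∀ y, y ∉ bad → ∀ y', dist y' y ≤ 3 * r / σ → cell y' = cell y) (N : ℕ) (u : ℝ) :
    ‖sumChar μ c k w s N u -
        centredChar ((Measure.pi fun _ : Fin N => ν).prod (Measure.pi fun _ : Fin N => μ))
          (fun y => labelledSum c k w σ y.1 y.2) u‖ ≤
      |u| * √((2 * (removalConst d k * B)) ^ 2 * (N * μ.real bad)) := by
  have hb : BddMeas w := ⟨hwm, B, hwB⟩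
  have hs0 : 0 < s := by rw [hs]; positivity
  have hunz := measurePreserving_unzip μ ν N
  have hrescale : MeasurePreserving (fun (z : Fin N → A × Pt d) i => Ψ (z i))
      (Measure.pi fun _ => ν.prod μ) (Measure.pi fun _ => μ) :=
    measurePreserving_pi _ _ fun _ => ⟨hΨm, hΨμ⟩
  have hf1 : BddMeas fun z : Fin N → A × Pt d =>
      graphSum c k w (fun i => s • Ψ (z i)) Finset.univ :=
    (bddMeas_graphSum_smul (ι := Fin N) (d := d) (s := s) (k := k) hc0 hc1 hb _).comp
      hrescale.measurable
  have hf2 : BddMeas fun z : Fin N → A × Pt d =>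
      labelledSum c k w σ (fun i => (z i).1) (fun i => (z i).2) := by
    have h := (bddMeas_labelledSum (N := N) (d := d) (A := A) (s := σ) (k := k) hc0 hc1 hb).comp
      hunz.measurable
    exact h
  have hg1 : ∀ l, BddMeas fun z : Fin N → A × Pt d =>
      graphSum c k w (fun i => s • Ψ (z i)) (Finset.univ.erase l) := fun l =>
    (bddMeas_graphSum_smul (ι := Fin N) (d := d) (s := s) (k := k) hc0 hc1 hb _).comp
      hrescale.measurable
  have hg2' : ∀ l, BddMeas fun y : (Fin N → A) × (Fin N → Pt d) =>
      ∑ a, graphSum c k w (fun i => σ • y.2 i)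
        ((Finset.univ.filter fun i => y.1 i = a).erase l) := fun l => by
    refine BddMeas.of_finite_left fun lab => ?_
    have h : ∀ a ∈ Finset.univ, BddMeas fun z : Fin N → Pt d => graphSum c k w (fun i => σ • z i)
        ((Finset.univ.filter fun i => lab i = a).erase l) := fun a _ =>
      bddMeas_graphSum_smul (s := σ) (k := k) hc0 hc1 hb _
    exact BddMeas.sum _ h
  have hg2 : ∀ l, BddMeas fun z : Fin N → A × Pt d =>
      ∑ a, graphSum c k w (fun i => σ • (z i).2)
        ((Finset.univ.filter fun i => (z i).1 = a).erase l) := fun l => by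
    have h := (hg2' l).comp hunz.measurable
    exact h
  have e1 : sumChar μ c k w s N u = centredChar (Measure.pi fun _ => ν.prod μ)
      (fun z : Fin N → A × Pt d => graphSum c k w (fun i => s • Ψ (z i)) Finset.univ) u := by
    rw [sumChar, ← hrescale.map_eq, centredChar_map hrescale.measurable
      (measurable_graphSum_smul hwm _)]
  have e2 : centredChar ((Measure.pi fun _ : Fin N => ν).prod (Measure.pi fun _ : Fin N => μ))
        (fun y => labelledSum c k w σ y.1 y.2) u =
      centredChar (Measure.pi fun _ => ν.prod μ) (fun z : Fin N → A × Pt d =>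
        labelledSum c k w σ (fun i => (z i).1) (fun i => (z i).2)) u := by
    have h := bddMeas_labelledSum (N := N) (d := d) (A := A) (s := σ) (k := k) hc0 hc1 hb
    have h2 := centredChar_map (μ := Measure.pi fun _ : Fin N => ν.prod μ) hunz.measurable h.1 u
    rw [hunz.map_eq] at h2
    exact h2
  rw [e1, e2]
  refine (norm_centredChar_sub_le hf1 hf2 _ u).trans
    (mul_le_mul_of_nonneg_left (Real.sqrt_le_sqrt ?_) (abs_nonneg u))
  refine (efron_stein_event (ν.prod μ) _ (hf1.sub hf2) (fun l z =>
      graphSum c k w (fun i => s • Ψ (z i)) (Finset.univ.erase l) -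
        ∑ a, graphSum c k w (fun i => σ • (z i).2)
          ((Finset.univ.filter fun i => (z i).1 = a).erase l))
    (fun l => (hg1 l).sub (hg2 l)) (fun l z y => ?_) (2 * (removalConst d k * B))
    (fun l => {z | z l ∈ (Prod.snd ⁻¹' bad : Set (A × Pt d))})
    (fun l => measurable_pi_apply l (measurable_snd hbm)) (fun l => ?_)).trans ?_
  · congr 1
    · exact graphSum_erase_update c k w (fun p => s • Ψ p) _ l z y
    · refine Finset.sum_congr rfl fun a _ => ?_
      have hset : (Finset.univ.filter fun i => (Function.update z l y i).1 = a).erase l =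
          (Finset.univ.filter fun i => (z i).1 = a).erase l := by
        ext i
        simp only [Finset.mem_erase, Finset.mem_filter, Finset.mem_univ, true_and]
        refine and_congr_right fun hi => ?_
        rw [Function.update_of_ne hi]
      rw [hset]
      exact graphSum_erase_update c k w (fun p : A × Pt d => σ • p.2) _ l z y
  · have hac1 : (ν.prod μ).map (fun p => s • Ψ p) ≪ (volume : Measure (Pt d)) := by
      have : (ν.prod μ).map (fun p => s • Ψ p) = μ.map fun x => s • x := by
        conv_rhs => rw [← hΨμ]
        rw [Measure.map_map (by fun_prop) hΨm]
        rfl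
      rw [this]
      exact map_smul_absolutelyContinuous hac hs0
    have hac2 : (ν.prod μ).map (fun p => σ • p.2) ≪ (volume : Measure (Pt d)) := by
      have : (ν.prod μ).map (fun p => σ • p.2) = μ.map fun x => σ • x := by
        have h := (measurePreserving_snd (μ := ν) (ν := μ)).map_eq
        conv_rhs => rw [← h]
        rw [Measure.map_map (by fun_prop) measurable_snd]
        rfl
      rw [this]
      exact map_smul_absolutelyContinuous hac hσ
    filter_upwards [ae_genPos (ι := Fin N) (ν.prod μ) hd (φ := fun p => s • Ψ p)
      (by fun_prop) hac1, ae_genPos (ι := Fin N) (ν.prod μ) hd (φ := fun p => σ • p.2)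
      (by fun_prop) hac2] with z hz1 hz2
    have hrw : graphSum c k w (fun i => s • Ψ (z i)) Finset.univ -
        labelledSum c k w σ (fun i => (z i).1) (fun i => (z i).2) -
        (graphSum c k w (fun i => s • Ψ (z i)) (Finset.univ.erase l) -
          ∑ a, graphSum c k w (fun i => σ • (z i).2)
            ((Finset.univ.filter fun i => (z i).1 = a).erase l)) =
        removal c k w (fun i => s • Ψ (z i)) Finset.univ l -
        removal c k w (fun i => σ • (z i).2)
          (Finset.univ.filter fun i => (z i).1 = (z l).1) l := by
      rw [← Finset.sum_eq_single_of_mem (f := fun a => removal c k w (fun i => σ • (z i).2)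
          (Finset.univ.filter fun i => (z i).1 = a) l) (z l).1 (Finset.mem_univ _)
          (fun a _ ha => removal_of_notMem fun hl => ha (Finset.mem_filter.1 hl).2.symm)]
      simp only [removal, Finset.sum_sub_distrib, labelledSum]
      ring
    rw [hrw]
    by_cases hl : z l ∈ (Prod.snd ⁻¹' bad : Set (A × Pt d))
    · rw [Set.indicator_of_mem (by exact hl)]
      have b1 := abs_removal_le_const hc0 hc1 (k := k) hwB hz1 Finset.univ l
      have b2 := abs_removal_le_const hc0 hc1 (k := k) hwB hz2
        (Finset.univ.filter fun i => (z i).1 = (z l).1) l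
      exact (abs_sub _ _).trans (by linarith)
    · rw [Set.indicator_of_notMem (by exact hl),
        removal_eq_removal_of_cell hL hσ hs hwr hΨi hΨ hbad z hl, sub_self, abs_zero]
  · refine mul_le_mul_of_nonneg_left (le_of_eq ?_) (sq_nonneg _)
    have h1 : ∀ l : Fin N, (Measure.pi fun _ : Fin N => ν.prod μ).real
        {z | z l ∈ (Prod.snd ⁻¹' bad : Set (A × Pt d))} = μ.real bad := fun l => by
      rw [pi_real_single _ l (measurable_snd hbm),
        ← map_measureReal_apply measurable_snd hbm,
        (measurePreserving_snd (μ := ν) (ν := μ)).map_eq]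
    rw [Finset.sum_congr rfl fun l _ => h1 l]
    simp

end BlockComparison

/-! ### Grids in Euclidean space -/

section Grid

variable {d : ℕ}

/-- The index of the cell of the grid of mesh `h` that contains `y`. -/
noncomputable def gridCell (h : ℝ) (y : Pt d) (i : Fin d) : ℤ := ⌊y i / h⌋

/-- The affine map of ratio `1 / L` that sends the cell `m` of the grid of mesh `h` onto its
subcell `a`, when the cell is divided into `L ^ d` subcells. -/
noncomputable def subcellAffine (h : ℝ) (L : ℕ) (a : Fin d → Fin L) (m : Fin d → ℤ) (y : Pt d) :
    Pt d :=
  (L : ℝ)⁻¹ • y + WithLp.toLp 2 (fun i => (L : ℝ)⁻¹ * (h * (m i * ((L : ℝ) - 1) + (a i : ℕ))))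

/-- The map that contracts each cell of the grid of mesh `h` onto its subcell `a`. -/
noncomputable def subcellMap (h : ℝ) (L : ℕ) (p : (Fin d → Fin L) × Pt d) : Pt d :=
  subcellAffine h L p.1 (gridCell h p.2) p.2

/-- The set of points that lie in the subcell `a` of their cell. -/
def subcell (h : ℝ) (L : ℕ) (a : Fin d → Fin L) : Set (Pt d) :=
  {x | ∀ i, ⌊(L : ℝ) * (x i / h)⌋ = L * ⌊x i / h⌋ + (a i : ℕ)}

variable {h : ℝ} {L : ℕ}

lemma measurable_gridCell (h : ℝ) : Measurable (gridCell h : Pt d → Fin d → ℤ) := by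
  refine measurable_pi_lambda _ fun i => Int.measurable_floor.comp ?_
  fun_prop

lemma measurable_subcellMap : Measurable (subcellMap h L : (Fin d → Fin L) × Pt d → Pt d) := by
  refine measurable_from_prod_countable_right fun a => ?_
  unfold subcellMap subcellAffine
  have hm := measurable_gridCell (d := d) h
  have : Measurable fun y : Pt d => WithLp.toLp 2 (fun i : Fin d =>
      (L : ℝ)⁻¹ * (h * ((gridCell h y i : ℝ) * ((L : ℝ) - 1) + (a i : ℕ)))) := by
    refine (WithLp.measurable_toLp 2 (Fin d → ℝ)).comp (measurable_pi_lambda _ fun i => ?_)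
    have h1 : Measurable fun y : Pt d => ((gridCell h y i : ℤ) : ℝ) :=
      (measurable_of_countable (fun z : ℤ => (z : ℝ))).comp ((measurable_pi_apply i).comp hm)
    fun_prop
  exact (measurable_const_smul _).add this

lemma measurableSet_subcell (a : Fin d → Fin L) : MeasurableSet (subcell h L a) := by
  have : subcell h L a = ⋂ i, {x : Pt d | ⌊(L : ℝ) * (x i / h)⌋ = L * ⌊x i / h⌋ + (a i : ℕ)} := by
    ext x; simp [subcell]
  rw [this]
  refine MeasurableSet.iInter fun i => measurableSet_eq_fun ?_ ?_
  · exact Int.measurable_floor.comp (by fun_prop)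
  · have : Measurable fun x : Pt d => ⌊x i / h⌋ := Int.measurable_floor.comp (by fun_prop)
    exact (measurable_of_countable (fun z : ℤ => (L : ℤ) * z + (a i : ℕ))).comp this

/-- A point lies in the cell `m` if and only if its image lies in the subcell `a` of the cell `m`.
-/
lemma subcellAffine_mem_iff (hh : 0 < h) (a : Fin d → Fin L) (m : Fin d → ℤ) (y : Pt d) :
    (subcellAffine h L a m y ∈ subcell h L a ∧ gridCell h (subcellAffine h L a m y) = m) ↔
      gridCell h y = m := by
  have hL : ∀ _ : Fin d, (0 : ℝ) < L := fun i => by exact_mod_cast (a i).pos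
  have hx : ∀ i, (L : ℝ) * (subcellAffine h L a m y i / h) =
      y i / h + ((m i * ((L : ℤ) - 1) + (a i : ℕ) : ℤ) : ℝ) := fun i => by
    have := hL i
    simp only [subcellAffine, PiLp.add_apply, PiLp.smul_apply, smul_eq_mul]
    push_cast
    field_simp
  constructor
  · rintro ⟨h1, h2⟩
    funext i
    have h3 := h1 i
    rw [hx, Int.floor_add_intCast] at h3
    have h4 : ⌊subcellAffine h L a m y i / h⌋ = m i := congrFun h2 i
    rw [h4] at h3
    unfold gridCell
    linarith
  · intro hy
    have hyi : ∀ i, ⌊y i / h⌋ = m i := fun i => congrFun hy i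
    have hcell : ∀ i, ⌊subcellAffine h L a m y i / h⌋ = m i := fun i => by
      have h1 := hx i
      have hLi := hL i
      have h2 := Int.floor_le (y i / h)
      have h3 := Int.lt_floor_add_one (y i / h)
      rw [hyi i] at h2 h3
      have ha : ((a i : ℕ) : ℝ) + 1 ≤ L := by exact_mod_cast (a i).isLt
      have ha0 : (0 : ℝ) ≤ ((a i : ℕ) : ℝ) := Nat.cast_nonneg _
      push_cast at h1
      rw [Int.floor_eq_iff]
      constructor
      · refine le_of_mul_le_mul_left ?_ hLi
        rw [h1]; linarith
      · refine lt_of_mul_lt_mul_left ?_ hLi.le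
        rw [h1]; linarith
    refine ⟨fun i => ?_, funext hcell⟩
    rw [hx, Int.floor_add_intCast, hyi, hcell]
    ring

lemma subcellMap_mem (hh : 0 < h) (a : Fin d → Fin L) (y : Pt d) :
    subcellMap h L (a, y) ∈ subcell h L a ∧ gridCell h (subcellMap h L (a, y)) = gridCell h y :=
  (subcellAffine_mem_iff hh a _ y).2 rfl

lemma subcell_eq_of_mem {a b : Fin d → Fin L} {x : Pt d} (ha : x ∈ subcell h L a)
    (hb : x ∈ subcell h L b) : a = b := by
  funext i
  have h1 := ha i
  have h2 := hb i
  rw [h1] at h2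
  exact Fin.ext (by simpa using h2)

lemma exists_mem_subcell (hL : 0 < L) (x : Pt d) : ∃ a : Fin d → Fin L, x ∈ subcell h L a := by
  have hL' : (0 : ℝ) < L := by exact_mod_cast hL
  have key : ∀ i, 0 ≤ ⌊(L : ℝ) * (x i / h)⌋ - L * ⌊x i / h⌋ ∧
      ⌊(L : ℝ) * (x i / h)⌋ - L * ⌊x i / h⌋ < L := fun i => by
    have h2 := Int.floor_le (x i / h)
    have h3 := Int.lt_floor_add_one (x i / h)
    constructor
    · rw [sub_nonneg, Int.le_floor]
      push_cast
      exact mul_le_mul_of_nonneg_left h2 hL'.le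
    · rw [sub_lt_iff_lt_add, Int.floor_lt]
      push_cast
      nlinarith
  refine ⟨fun i => ⟨(⌊(L : ℝ) * (x i / h)⌋ - L * ⌊x i / h⌋).toNat, ?_⟩, fun i => ?_⟩
  · have := key i; omega
  · have := key i
    simp only [Int.toNat_of_nonneg this.1]
    ring

lemma subcellMap_sub (a : Fin d → Fin L) {y y' : Pt d} (hy : gridCell h y' = gridCell h y) :
    subcellMap h L (a, y') - subcellMap h L (a, y) = (L : ℝ)⁻¹ • (y' - y) := by
  simp only [subcellMap, subcellAffine, hy]
  rw [add_sub_add_right_eq_sub, smul_sub]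

lemma subcellMap_injective (hh : 0 < h) (hL : 0 < L) :
    Function.Injective (subcellMap h L : (Fin d → Fin L) × Pt d → Pt d) := by
  rintro ⟨a, y⟩ ⟨b, z⟩ hab
  have h1 := subcellMap_mem hh a y
  have h2 := subcellMap_mem hh b z
  rw [hab] at h1
  obtain rfl := subcell_eq_of_mem h1.1 h2.1
  have h3 := subcellMap_sub a (h1.2.symm.trans h2.2)
  have hL' : (L : ℝ) ≠ 0 := by exact_mod_cast hL.ne'
  rw [hab, sub_self, eq_comm, smul_eq_zero_iff_right (inv_ne_zero hL'), sub_eq_zero] at h3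
  rw [h3]

lemma volume_preimage_subcellAffine (hL : 0 < L) (a : Fin d → Fin L) (m : Fin d → ℤ)
    (B : Set (Pt d)) :
    volume (subcellAffine h L a m ⁻¹' B) = (L : ℝ≥0∞) ^ d * volume B := by
  have hL' : (0 : ℝ) < L := by exact_mod_cast hL
  have : subcellAffine h L a m ⁻¹' B = (fun y => (L : ℝ)⁻¹ • y) ⁻¹' ((fun y => y +
      WithLp.toLp 2 (fun i => (L : ℝ)⁻¹ * (h * (m i * ((L : ℝ) - 1) + (a i : ℕ))))) ⁻¹' B) := rfl
  rw [this, Measure.addHaar_preimage_smul _ (inv_ne_zero hL'.ne'), measure_preimage_add_right,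
    finrank_euclideanSpace, Fintype.card_fin, abs_of_nonneg (by positivity), inv_pow, inv_inv,
    ENNReal.ofReal_pow hL'.le, ENNReal.ofReal_natCast]

/-- The image of Lebesgue measure under the contraction onto the subcells `a`. -/
lemma map_volume_subcellMap (hh : 0 < h) (hL : 0 < L) (a : Fin d → Fin L) :
    (volume : Measure (Pt d)).map (fun y => subcellMap h L (a, y)) =
      (L : ℝ≥0∞) ^ d • (volume : Measure (Pt d)).restrict (subcell h L a) := by
  have hΨ : Measurable fun y : Pt d => subcellMap h L (a, y) :=
    measurable_subcellMap.comp measurable_prodMk_left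
  have hcm := measurable_gridCell (d := d) h
  have hsplit : ∀ (ρ : Measure (Pt d)), ρ Set.univ = ∑' m : Fin d → ℤ, ρ (gridCell h ⁻¹' {m}) :=
    fun ρ => by
      have := tsum_measure_preimage_singleton (μ := ρ) (Set.countable_univ (α := Fin d → ℤ))
        (f := gridCell h) (fun m _ => hcm (measurableSet_singleton m))
      rw [Set.preimage_univ] at this
      rw [← this, tsum_univ fun m => ρ (gridCell h ⁻¹' {m})]
  ext B hB
  rw [Measure.map_apply hΨ hB, Measure.smul_apply, Measure.restrict_apply hB, smul_eq_mul]
  have e1 := hsplit (volume.restrict ((fun y : Pt d => subcellMap h L (a, y)) ⁻¹' B))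
  have e2 := hsplit (volume.restrict (B ∩ subcell h L a))
  rw [Measure.restrict_apply MeasurableSet.univ, Set.univ_inter] at e1 e2
  rw [e1, e2, ← ENNReal.tsum_mul_left]
  refine tsum_congr fun m => ?_
  rw [Measure.restrict_apply (hcm (measurableSet_singleton m)),
    Measure.restrict_apply (hcm (measurableSet_singleton m)),
    ← volume_preimage_subcellAffine (h := h) hL a m]
  congr 1
  ext y
  have h1 := subcellAffine_mem_iff hh a m y
  simp only [Set.mem_inter_iff, Set.mem_preimage, Set.mem_singleton_iff, subcellMap]
  constructor
  · rintro ⟨h2, h3⟩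
    rw [h2] at h3
    have h4 := h1.2 h2
    exact ⟨h4.2, h3, h4.1⟩
  · rintro ⟨h2, h3, h4⟩
    have h5 := h1.1 ⟨h4, h2⟩
    rw [h5]
    exact ⟨rfl, h3⟩

lemma sum_measure_inter_subcell (hL : 0 < L) (ρ : Measure (Pt d)) {B : Set (Pt d)}
    (hB : MeasurableSet B) :
    ∑ a : Fin d → Fin L, ρ (B ∩ subcell h L a) = ρ B := by
  have h1 : B = ⋃ a ∈ (Finset.univ : Finset (Fin d → Fin L)), B ∩ subcell h L a := by
    ext x
    simp only [Finset.mem_univ, Set.iUnion_true, Set.mem_iUnion, Set.mem_inter_iff]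
    exact ⟨fun hx => (exists_mem_subcell (h := h) hL x).imp fun a ha => ⟨hx, ha⟩,
      fun ⟨_, hx, _⟩ => hx⟩
  conv_rhs => rw [h1]
  rw [measure_biUnion_finset _ fun a _ => hB.inter (measurableSet_subcell a)]
  intro a _ b _ hab
  rw [Function.onFun, Set.disjoint_left]
  exact fun x hx hx' => hab (subcell_eq_of_mem hx.2 hx'.2)

instance isProbabilityMeasure_uniformOn_labels [NeZero L] :
    IsProbabilityMeasure (uniformOn (Set.univ : Set (Fin d → Fin L))) :=
  isProbabilityMeasure_uniformOn Set.finite_univ Set.univ_nonempty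

lemma uniformOn_univ_singleton (a : Fin d → Fin L) :
    uniformOn (Set.univ : Set (Fin d → Fin L)) {a} = ((L : ℝ≥0∞) ^ d)⁻¹ := by
  rw [uniformOn_univ, Measure.count_singleton, one_div, Fintype.card_fun, Fintype.card_fin,
    Fintype.card_fin, Nat.cast_pow]

/-- A distribution whose density is constant on the cells of a grid is the mixture of its scaled
copies living on the subcells. -/
lemma map_subcellMap (hh : 0 < h) (hL : 0 < L) {g : (Fin d → ℤ) → ℝ≥0∞}
    {μ : Measure (Pt d)} [SFinite μ] (hμ : μ = volume.withDensity fun x => g (gridCell h x)) :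
    ((uniformOn (Set.univ : Set (Fin d → Fin L))).prod μ).map (subcellMap h L) = μ := by
  have hgm : Measurable fun x : Pt d => g (gridCell h x) :=
    (measurable_of_countable g).comp (measurable_gridCell h)
  have hΨ : ∀ a, Measurable fun y : Pt d => subcellMap h L (a, y) := fun a =>
    measurable_subcellMap.comp measurable_prodMk_left
  have hone : ∀ (a : Fin d → Fin L) {B : Set (Pt d)}, MeasurableSet B →
      μ ((fun y : Pt d => subcellMap h L (a, y)) ⁻¹' B) =
        (L : ℝ≥0∞) ^ d * μ (B ∩ subcell h L a) := fun a B hB => by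
    have h1 : ∀ y, g (gridCell h y) = g (gridCell h (subcellMap h L (a, y))) := fun y => by
      rw [(subcellMap_mem hh a y).2]
    rw [hμ, withDensity_apply _ (hΨ a hB), withDensity_apply _ (hB.inter (measurableSet_subcell a)),
      lintegral_congr h1, ← setLIntegral_map hB hgm (hΨ a), map_volume_subcellMap hh hL,
      Measure.restrict_smul, Measure.restrict_restrict hB, lintegral_smul_measure, smul_eq_mul]
  have hK : ((L : ℝ≥0∞) ^ d) ≠ 0 := pow_ne_zero _ (by exact_mod_cast hL.ne')
  have hK' : ((L : ℝ≥0∞) ^ d) ≠ ∞ := ENNReal.pow_ne_top (ENNReal.natCast_ne_top L)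
  ext B hB
  rw [Measure.map_apply measurable_subcellMap hB,
    Measure.prod_apply (measurable_subcellMap hB), lintegral_fintype]
  simp_rw [uniformOn_univ_singleton]
  rw [← Finset.sum_mul]
  have h2 : ∀ a : Fin d → Fin L, μ (Prod.mk a ⁻¹' (subcellMap h L ⁻¹' B)) =
      (L : ℝ≥0∞) ^ d * μ (B ∩ subcell h L a) := fun a => hone a hB
  rw [Finset.sum_congr rfl fun a _ => h2 a, ← Finset.mul_sum, sum_measure_inter_subcell hL μ hB,
    mul_comm, ← mul_assoc, ENNReal.inv_mul_cancel hK hK', one_mul]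

/-- The points of which some coordinate is within `δ` of an end of the corresponding side of their
cell of the grid of mesh `h`. -/
def gridBoundary (d : ℕ) (h δ : ℝ) : Set (Pt d) :=
  {y | ∃ i, Int.fract (y i / h) < δ / h ∨ 1 - δ / h ≤ Int.fract (y i / h)}

lemma measurableSet_gridBoundary (h δ : ℝ) : MeasurableSet (gridBoundary d h δ) := by
  have : gridBoundary d h δ = ⋃ i, ({y : Pt d | Int.fract (y i / h) < δ / h} ∪
      {y | 1 - δ / h ≤ Int.fract (y i / h)}) := by
    ext y; simp [gridBoundary]
  rw [this]
  have hm : ∀ i : Fin d, Measurable fun y : Pt d => Int.fract (y i / h) := fun i =>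
    measurable_fract.comp (by fun_prop)
  exact MeasurableSet.iUnion fun i => (measurableSet_lt (hm i) measurable_const).union
    (measurableSet_le measurable_const (hm i))

lemma gridCell_eq_of_notMem (hh : 0 < h) {δ : ℝ} {y : Pt d} (hy : y ∉ gridBoundary d h δ)
    {y' : Pt d} (hd : dist y' y ≤ δ) : gridCell h y' = gridCell h y := by
  funext i
  have h1 : |y' i - y i| ≤ δ := by
    rw [← Real.norm_eq_abs, ← PiLp.sub_apply]
    exact (PiLp.norm_apply_le _ i).trans (by rwa [← dist_eq_norm])
  simp only [gridBoundary, Set.mem_ofPred_eq, not_exists, not_or, not_lt, not_le] at hy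
  obtain ⟨h2, h3⟩ := hy i
  have h4 : |y' i / h - y i / h| ≤ δ / h := by
    rw [← sub_div, abs_div, abs_of_pos hh]
    gcongr
  rw [abs_le] at h4
  have h5 := Int.floor_add_fract (y i / h)
  rw [gridCell, gridCell, Int.floor_eq_iff]
  constructor <;> linarith

lemma volume_coord_eq (i : Fin d) (t : ℝ) : (volume : Measure (Pt d)) {y | y i = t} = 0 := by
  have h1 := (PiLp.volume_preserving_ofLp (Fin d)).measure_preimage
    (s := {z : Fin d → ℝ | z i = t})
    ((measurableSet_eq_fun (measurable_pi_apply i) measurable_const).nullMeasurableSet)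
  have h2 : (volume : Measure (Fin d → ℝ)) {z | z i = t} = 0 :=
    Measure.pi_hyperplane (fun _ : Fin d => (volume : Measure ℝ)) i t
  rw [h2] at h1
  exact h1

/-- Few points of a sample lie close to the boundaries of the cells. -/
lemma tendsto_gridBoundary (hh : 0 < h) (μ : Measure (Pt d)) [IsFiniteMeasure μ]
    (hac : μ ≪ volume) {δ : ℕ → ℝ} (hδ : Tendsto δ atTop (𝓝 0)) :
    Tendsto (fun j => μ.real (gridBoundary d h (δ j))) atTop (𝓝 0) := by
  have hnull : ∀ᵐ y ∂μ, ∀ i, Int.fract (y i / h) ≠ 0 := by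
    refine ae_all_iff.2 fun i => hac ?_
    have h1 : {y : Pt d | ¬ Int.fract (y i / h) ≠ 0} ⊆ ⋃ m : ℤ, {y | y i = h * m} := by
      intro y hy
      simp only [ne_eq, not_not, Set.mem_ofPred_eq, Int.fract_eq_zero_iff] at hy
      obtain ⟨m, hm⟩ := hy
      rw [Set.mem_iUnion]
      refine ⟨m, ?_⟩
      simp only [Set.mem_ofPred_eq]
      rw [hm]; field_simp
    exact measure_mono_null h1 (measure_iUnion_null fun m => volume_coord_eq i _)
  have hlim : Tendsto (fun j => ∫ y, (gridBoundary d h (δ j)).indicator (fun _ => (1 : ℝ)) y ∂μ)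
      atTop (𝓝 (∫ _, (0 : ℝ) ∂μ)) := by
    refine tendsto_integral_of_dominated_convergence (fun _ => 1)
      (fun j => (measurable_const.indicator (measurableSet_gridBoundary h _)).aestronglyMeasurable)
      (integrable_const _) (fun j => Eventually.of_forall fun y => ?_) ?_
    · by_cases hy : y ∈ gridBoundary d h (δ j) <;> simp [hy]
    · filter_upwards [hnull] with y hy
      refine tendsto_const_nhds.congr' ?_
      have hδ' : Tendsto (fun j => δ j / h) atTop (𝓝 0) := by simpa using hδ.div_const h
      have hev : ∀ i, ∀ᶠ j in atTop, ¬ (Int.fract (y i / h) < δ j / h ∨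
          1 - δ j / h ≤ Int.fract (y i / h)) := fun i => by
        have h1 : 0 < Int.fract (y i / h) := (Int.fract_nonneg _).lt_of_ne' (hy i)
        have h2 := Int.fract_lt_one (y i / h)
        filter_upwards [hδ'.eventually_lt_const h1,
          hδ'.eventually_lt_const (sub_pos.2 h2)] with j h3 h4
        rw [not_or]
        constructor <;> linarith
      filter_upwards [eventually_all.2 hev] with j hj
      rw [Set.indicator_of_notMem]
      rintro ⟨i, hi⟩
      exact hj i hi
  rw [integral_zero] at hlim
  refine hlim.congr fun j => ?_
  rw [integral_indicator_const _ (measurableSet_gridBoundary h _), smul_eq_mul, mul_one]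

end Grid

/-! ### The Gaussian limit for step densities -/

section ScaleChange

variable {d : ℕ}

lemma graphSum_sub_weight {ι : Type*} (c : ℝ) (k : ℕ) (w w' : ℝ → ℝ) (x : ι → Pt d)
    (S : Finset ι) :
    graphSum c k (fun t => w t - w' t) x S = graphSum c k w x S - graphSum c k w' x S := by
  simp only [graphSum, sub_mul, Finset.sum_sub_distrib]

lemma abs_trunc_mul_sub_le {R : ℝ} (hR : 0 ≤ R) {s s' : ℝ} (hs : 0 < s) (hss : s ≤ s') (t : ℝ) :
    |trunc R (s' * t) - trunc R (s * t)| ≤ 2 * R * (s' / s - 1) := by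
  have hs' : 0 < s' := hs.trans_le hss
  have h1 : 0 ≤ s' / s - 1 := by rw [sub_nonneg, le_div_iff₀ hs]; linarith
  rcases le_total t 0 with ht | ht
  · have : ∀ a : ℝ, 0 < a → trunc R (a * t) = 0 := fun a ha => by
      unfold trunc
      rw [max_eq_left]
      exact (min_le_left _ _).trans (mul_nonpos_of_nonneg_of_nonpos ha.le ht)
    rw [this _ hs, this _ hs', sub_self, abs_zero]
    positivity
  rcases le_or_gt (s * t) (2 * R) with h | h
  · refine (abs_trunc_sub_le R _ _).trans ?_
    have h2 : s' * t - s * t = s * t * (s' / s - 1) := by field_simp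
    rw [h2, abs_of_nonneg (by positivity)]
    exact mul_le_mul_of_nonneg_right h h1
  · have h2 : s * t ≤ s' * t := mul_le_mul_of_nonneg_right hss ht
    rw [trunc_eq_zero h, trunc_eq_zero (h.trans_le h2), sub_self, abs_zero]
    positivity

variable (μ : Measure (Pt d)) [IsProbabilityMeasure μ] (hd : 1 ≤ d) (hac : μ ≪ volume) {c : ℝ}
  (hc0 : 0 ≤ c) (hc1 : c ≤ 1) (k : ℕ)

include hd hac hc0 hc1 in
/-- A small change of the scale has a small effect on the truncated total length. -/
lemma norm_sumChar_trunc_sub_le {R : ℝ} (hR : 0 ≤ R) {s s' : ℝ} (hs : 0 < s) (hss : s ≤ s') (N : ℕ)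
    (u : ℝ) :
    ‖sumChar μ c k (trunc R) s' N u - sumChar μ c k (trunc R) s N u‖ ≤
      |u| * √((2 * (removalConst d k * (2 * R * (s' / s - 1)))) ^ 2 * N) := by
  have hb := bddMeas_trunc hR
  have hs' : 0 < s' := hs.trans_le hss
  have h1 := bddMeas_graphSum_smul (ι := Fin N) (d := d) (s := s') (k := k) hc0 hc1 hb Finset.univ
  have h2 := bddMeas_graphSum_smul (ι := Fin N) (d := d) (s := s) (k := k) hc0 hc1 hb Finset.univ
  refine (norm_centredChar_sub_le h1 h2 (Measure.pi fun _ => μ) u).trans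
    (mul_le_mul_of_nonneg_left (Real.sqrt_le_sqrt ?_) (abs_nonneg u))
  have hm := measurable_trunc R
  have h3 := sumVar_le (k := k) μ hd hac hc0 hc1 (s := 1) one_pos
    (w := fun t => trunc R (s' * t) - trunc R (s * t)) (r := 2 * R / s) (by fun_prop)
    (abs_trunc_mul_sub_le hR hs hss) (fun t ht => by
      rw [div_lt_iff₀ hs] at ht
      have h4 : 2 * R < s * t := by linarith
      have ht0 : 0 ≤ t := by
        by_contra! h
        nlinarith
      have h5 : s * t ≤ s' * t := mul_le_mul_of_nonneg_right hss ht0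
      rw [trunc_eq_zero h4, trunc_eq_zero (h4.trans_le h5), sub_self]) N
  refine le_trans (le_of_eq ?_) h3
  unfold sumVar
  congr 1
  funext z
  rw [graphSum_smul hs, graphSum_smul hs', ← graphSum_sub_weight]
  simp only [one_smul]

end ScaleChange

section GaussianApproximation

variable {d : ℕ} (μ : Measure (Pt d)) [IsProbabilityMeasure μ] (hd : 1 ≤ d) (hac : μ ≪ volume)
  {c : ℝ} (hc0 : 0 ≤ c) (hc1 : c ≤ 1) (k : ℕ)

/-- The upper bound for the distance to a Gaussian characteristic function, as a function of
the ratio `a` of the number of blocks to the number of points, its inverse `b`, the argument `u`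
and the ratio `l` of two scales. -/
noncomputable def blockError (t D Q C1 M3 V β : ℝ) (j : ℕ) (p : ℝ × ℝ × ℝ × ℝ) : ℝ :=
  |t| * (C1 * (p.2.2.2 - 1)) + |t| * √(D * β) +
    (|t| * √(D * (4 * Q ^ 2 + 2) / (j ^ 4 : ℕ) *
      (p.1 * (p.2.1 + (p.2.1 - (j ^ 4 : ℕ)) ^ 2 + 1))) +
    (p.1 * t ^ 2 * (3 * p.2.2.1 * M3 ^ 3 + p.2.2.1 ^ 2 * (D * j ^ 4 / 2) ^ 2 +
      2 * D * (1 + Q) * j ^ 3 +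
      10 * D * (1 + Q) / j * (p.2.1 + (p.2.1 - (j ^ 4 : ℕ)) ^ 2)))) +
    |Real.exp (-(p.1 * t ^ 2 * V / 2)) - Real.exp (-(V / (j ^ 4 : ℕ) * t ^ 2 / 2))|

lemma continuous_blockError (t D Q C1 M3 V β : ℝ) (j : ℕ) :
    Continuous (blockError t D Q C1 M3 V β j) := by
  unfold blockError
  fun_prop

/-- The limit of the error as the number of blocks of mean size `j ^ 4` tends to infinity: it
vanishes as `j → ∞`, provided that `β` does. -/
lemma blockError_limit_le {D Q : ℝ} (hD0 : 0 ≤ D) (hQ0 : 0 ≤ Q) {j : ℕ} (hj : 0 < j)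
    (t C1 M3 V β : ℝ) :
    blockError t D Q C1 M3 V β j (1 / (j ^ 4 : ℕ), (j ^ 4 : ℕ), 0, 1) ≤
      |t| * √(D * β) + |t| * √(D * (4 * Q ^ 2 + 2) * 2 / j) + 12 * D * (1 + Q) / j * t ^ 2 := by
  have hjR : (1 : ℝ) ≤ j := by exact_mod_cast hj
  obtain ⟨n, hn⟩ : ∃ n : ℕ, n = j ^ 4 := ⟨_, rfl⟩
  have hnR : (n : ℝ) = (j : ℝ) ^ 4 := by rw [hn]; push_cast; ring
  have hn0 : (0 : ℝ) < n := by rw [hnR]; positivity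
  have hjn : (j : ℝ) ≤ n := by
    rw [hnR]
    simpa using pow_le_pow_right₀ hjR (show 1 ≤ 4 by norm_num)
  have e1 : √(D * (4 * Q ^ 2 + 2) / n * (1 / n * (n + 1))) ≤ √(D * (4 * Q ^ 2 + 2) * 2 / j) := by
    refine Real.sqrt_le_sqrt ?_
    have h1 : 1 / (n : ℝ) * (n + 1) ≤ 2 := by
      rw [one_div, inv_mul_le_iff₀ hn0]; linarith
    calc D * (4 * Q ^ 2 + 2) / n * (1 / n * (n + 1)) ≤ D * (4 * Q ^ 2 + 2) / n * 2 := by gcongr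
      _ ≤ D * (4 * Q ^ 2 + 2) / j * 2 := by gcongr
      _ = _ := by ring
  have e2 : 1 / (n : ℝ) * t ^ 2 * (2 * D * (1 + Q) * j ^ 3 + 10 * D * (1 + Q) / j * n) =
      12 * D * (1 + Q) / j * t ^ 2 := by
    rw [hnR]; field_simp; ring
  have e3 : 1 / (n : ℝ) * t ^ 2 * V / 2 = V / n * t ^ 2 / 2 := by ring
  unfold blockError
  simp only [← hn, sub_self, mul_zero, zero_mul, add_zero, zero_add, ne_eq, OfNat.ofNat_ne_zero,
    not_false_eq_true, zero_pow, e2, e3, abs_zero]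
  have f2 := mul_le_mul_of_nonneg_left e1 (abs_nonneg t)
  linarith

include hd hac hc0 hc1 in
/-- A sample of `N` points from a step density, split into `L ^ d` blocks. The four errors come from
adjusting the scale to an integer multiple `L` of the scale of the blocks, from deleting the edges
between blocks, from the Gaussian approximation of the independent blocks, and from the difference
between `L ^ d * j ^ 4` and `N`. -/
lemma norm_sumChar_sub_le_blockError {h : ℝ} (hh : 0 < h) {g : (Fin d → ℤ) → ℝ≥0∞}
    (hμ : μ = volume.withDensity fun x => g (gridCell h x)) {R : ℝ} (hR : 0 ≤ R) {Q q σ : ℝ}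
    {j L N : ℕ} (hj : 0 < j) (hL : 0 < L) (hN : 0 < N) (hσ : 0 < σ)
    (hq : ∀ y, μ.real (Metric.closedBall y (3 * (2 * R) / σ)) ≤ q) (hQ : q * (j ^ 4 : ℕ) ≤ Q)
    {s : ℝ} (hs : L * σ ≤ s) (t : ℝ) :
    ‖sumChar μ c k (trunc R) s N (t / √N) -
        ((Real.exp (-(sumVar μ c k (trunc R) σ (j ^ 4) / (j ^ 4 : ℕ) * t ^ 2 / 2)) : ℝ) : ℂ)‖ ≤
      blockError t ((2 * (removalConst d k * R)) ^ 2) Q (2 * (removalConst d k * (2 * R)))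
        (2 * (2 * j ^ 4 * (2 * j ^ 4 * R))) (sumVar μ c k (trunc R) σ (j ^ 4))
        (μ.real (gridBoundary d h (3 * (2 * R) / σ))) j
        ((L : ℝ) ^ d / N, N / (L : ℝ) ^ d, |t| / √N, s / (L * σ)) := by
  have : NeZero L := ⟨hL.ne'⟩
  have hLR : (0 : ℝ) < L := by exact_mod_cast hL
  have hNR : (0 : ℝ) < N := by exact_mod_cast hN
  have hsN : 0 < √(N : ℝ) := Real.sqrt_pos.2 hNR
  have hLσ : 0 < L * σ := by positivity
  have hm := measurable_trunc R
  have hB := abs_trunc_le hR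
  have hwr : ∀ t, 2 * R < t → trunc R t = 0 := fun t ht => trunc_eq_zero ht
  have hq0 : 0 ≤ q := measureReal_nonneg.trans (hq 0)
  have hQ0 : 0 ≤ Q := le_trans (by positivity) hQ
  have hrc := removalConst_nonneg d k
  obtain ⟨u, hu⟩ : ∃ u, u = t / √(N : ℝ) := ⟨_, rfl⟩
  have hua : |u| = |t| / √N := by rw [hu, abs_div, abs_of_pos hsN]
  have hu2 : u ^ 2 = t ^ 2 / N := by rw [hu, div_pow, Real.sq_sqrt hNR.le]
  have hsq : ∀ x : ℝ, |u| * √(x * N) = |t| * √x := fun x => by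
    rw [Real.sqrt_mul' _ hNR.le, hua]; field_simp
  have hcard : Fintype.card (Fin d → Fin L) = L ^ d := by simp
  have T1 := norm_sumChar_trunc_sub_le μ hd hac hc0 hc1 k hR hLσ hs N u
  have T2 := norm_sumChar_sub_labelledSum_le (k := k) μ hd hac hc0 hc1 hm hB
    (uniformOn (Set.univ : Set (Fin d → Fin L))) hLR hσ rfl hwr measurable_subcellMap
    (subcellMap_injective hh hL)
    (map_subcellMap hh hL hμ) (fun a y y' hy => subcellMap_sub a hy)
    (measurableSet_gridBoundary h (3 * (2 * R) / σ))
    (fun y hy y' hd => gridCell_eq_of_notMem hh hy hd) N u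
  have T3 := norm_centredChar_labelledSum_sub_le (N := N) (k := k) μ
    (uniformOn (Set.univ : Set (Fin d → Fin L))) hd hac hc0 hc1 hσ hm hB hwr hq hj hQ
    (κ := ((L : ℝ) ^ d)⁻¹) (fun a => by
      rw [measureReal_def, uniformOn_univ_singleton]; simp) rfl u
  obtain ⟨V, hV⟩ : ∃ V, V = sumVar μ c k (trunc R) σ (j ^ 4) := ⟨_, rfl⟩
  rw [← hV] at T3 ⊢
  rw [← hu]
  have T4 : ‖((Real.exp (-(u ^ 2 * V / 2)) : ℝ) : ℂ) ^ Fintype.card (Fin d → Fin L) -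
      ((Real.exp (-(V / (j ^ 4 : ℕ) * t ^ 2 / 2)) : ℝ) : ℂ)‖ =
      |Real.exp (-((L : ℝ) ^ d / N * t ^ 2 * V / 2)) -
        Real.exp (-(V / (j ^ 4 : ℕ) * t ^ 2 / 2))| := by
    rw [← Complex.ofReal_pow, ← Complex.ofReal_sub, Complex.norm_real, Real.norm_eq_abs, hcard,
      ← Real.exp_nat_mul, hu2]
    congr 3
    push_cast
    ring
  have htri := fun a b c e f : ℂ => (norm_sub_le_norm_sub_add_norm_sub a b f).trans
    (add_le_add le_rfl ((norm_sub_le_norm_sub_add_norm_sub b c f).trans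
    (add_le_add le_rfl (norm_sub_le_norm_sub_add_norm_sub c e f))))
  refine (htri _ _ _ _ _).trans ((add_le_add T1 (add_le_add T2
    (add_le_add T3 T4.le))).trans (le_of_eq ?_))
  unfold blockError
  simp only
  have E1 : |u| * √((2 * (removalConst d k * (2 * R * (s / (L * σ) - 1)))) ^ 2 * N) =
      |t| * (2 * (removalConst d k * (2 * R)) * (s / (L * σ) - 1)) := by
    rw [hsq, Real.sqrt_sq]
    · ring
    · have : 0 ≤ s / (L * σ) - 1 := by rw [sub_nonneg, le_div_iff₀ hLσ]; linarith
      positivity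
  have E2 : |u| * √((2 * (removalConst d k * R)) ^ 2 *
      (N * μ.real (gridBoundary d h (3 * (2 * R) / σ)))) =
      |t| * √((2 * (removalConst d k * R)) ^ 2 *
        μ.real (gridBoundary d h (3 * (2 * R) / σ))) := by
    rw [← hsq]; congr 2; ring
  have E3 : ∀ y : ℝ, |u| * √((2 * (removalConst d k * R)) ^ 2 * (4 * Q ^ 2 + 2) / (j ^ 4 : ℕ) *
      ((Fintype.card (Fin d → Fin L) : ℕ) * y)) =
      |t| * √((2 * (removalConst d k * R)) ^ 2 * (4 * Q ^ 2 + 2) / (j ^ 4 : ℕ) *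
        ((L : ℝ) ^ d / N * y)) := fun y => by
    rw [← hsq, hcard]
    congr 2
    push_cast
    field_simp
  rw [E1, E2, E3, hcard]
  have hKt : (L : ℝ) ^ d / N * t ^ 2 = (L : ℝ) ^ d * |u| ^ 2 := by
    rw [sq_abs, hu2]; ring
  have hx2 : (N : ℝ) * ((L : ℝ) ^ d)⁻¹ = N / (L : ℝ) ^ d := (div_eq_mul_inv _ _).symm
  rw [hKt, ← hua, ← sq_abs u, hx2]
  push_cast
  ring

set_option maxHeartbeats 400000 in
include hd hac hc0 hc1 in
/-- For a sample from a distribution whose density is constant on the cells of a grid, the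
truncated total length is asymptotically Gaussian up to an arbitrarily small error. -/
lemma exists_gaussian_approx {h : ℝ} (hh : 0 < h) {g : (Fin d → ℤ) → ℝ} {M : ℝ}
    (hg : ∀ m, g m ≤ M) (hμ : μ = volume.withDensity fun x => ENNReal.ofReal (g (gridCell h x)))
    {R : ℝ} (hR : 0 ≤ R) {ε : ℝ} (hε : 0 < ε) :
    ∃ v, 0 ≤ v ∧ ∀ t : ℝ, ∀ᶠ N : ℕ in atTop,
      ‖sumChar μ c k (trunc R) ((N : ℝ) ^ ((1 : ℝ) / d)) N (t / √N) -
        ((Real.exp (-(v * t ^ 2 / 2)) : ℝ) : ℂ)‖ ≤ ε * (1 + |t| + t ^ 2) := by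
  have hd0 : (d : ℝ) ≠ 0 := by exact_mod_cast (by omega : d ≠ 0)
  have hdpos : (0 : ℝ) < 1 / d := by
    have : (0 : ℝ) < d := by exact_mod_cast (by omega : 0 < d)
    positivity
  obtain ⟨D, hD⟩ : ∃ D : ℝ, D = (2 * (removalConst d k * R)) ^ 2 := ⟨_, rfl⟩
  have hD0 : 0 ≤ D := by rw [hD]; positivity
  have hM0 : 0 ≤ max M 0 := le_max_right _ _
  have hω : 0 ≤ unitBallVolume d := ENNReal.toReal_nonneg
  obtain ⟨Q, hQ⟩ : ∃ Q : ℝ, Q = max M 0 * ((3 * (2 * R)) ^ d * unitBallVolume d) := ⟨_, rfl⟩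
  have hQ0 : 0 ≤ Q := by rw [hQ]; positivity
  -- the scale of a block of `j ^ 4` points
  obtain ⟨σ, hσ⟩ : ∃ σ : ℕ → ℝ, σ = fun j : ℕ => ((j ^ 4 : ℕ) : ℝ) ^ ((1 : ℝ) / d) := ⟨_, rfl⟩
  have hσd : ∀ j, σ j ^ d = (j ^ 4 : ℕ) := fun j => by
    rw [hσ, ← Real.rpow_natCast, ← Real.rpow_mul (Nat.cast_nonneg _), one_div_mul_cancel hd0,
      Real.rpow_one]
  have hσ0 : ∀ j, 0 < j → 0 < σ j := fun j hj => by
    rw [hσ]; exact Real.rpow_pos_of_pos (by positivity) _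
  have hσt : Tendsto σ atTop atTop := by
    rw [hσ]
    exact (tendsto_rpow_atTop hdpos).comp
      (tendsto_natCast_atTop_atTop.comp (tendsto_pow_atTop (by norm_num)))
  -- the parts of the error that vanish as the block size tends to infinity
  have lim1 : Tendsto (fun j : ℕ => √(D * μ.real (gridBoundary d h (3 * (2 * R) / σ j))))
      atTop (𝓝 0) := by
    have h1 := tendsto_gridBoundary hh μ hac (hσt.const_div_atTop (3 * (2 * R)))
    simpa using (h1.const_mul D).sqrt
  have hjt : Tendsto (fun j : ℕ => (j : ℝ)) atTop atTop := tendsto_natCast_atTop_atTop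
  have lim2 : Tendsto (fun j : ℕ => √(D * (4 * Q ^ 2 + 2) * 2 / j)) atTop (𝓝 0) := by
    have h1 := (hjt.const_div_atTop (D * (4 * Q ^ 2 + 2) * 2)).sqrt
    rwa [Real.sqrt_zero] at h1
  have lim3 : Tendsto (fun j : ℕ => 12 * D * (1 + Q) / j) atTop (𝓝 0) :=
    hjt.const_div_atTop _
  obtain ⟨j, hj, b1, b2, b3⟩ : ∃ j : ℕ, 0 < j ∧
      √(D * μ.real (gridBoundary d h (3 * (2 * R) / σ j))) < ε / 2 ∧
      √(D * (4 * Q ^ 2 + 2) * 2 / j) < ε / 2 ∧ 12 * D * (1 + Q) / j < ε :=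
    ((eventually_gt_atTop 0).and ((lim1.eventually_lt_const (by positivity)).and
      ((lim2.eventually_lt_const (by positivity)).and
        (lim3.eventually_lt_const hε)))).exists
  have hjR : (1 : ℝ) ≤ j := by exact_mod_cast hj
  have hσj := hσ0 j hj
  obtain ⟨n, hn⟩ : ∃ n : ℕ, n = j ^ 4 := ⟨_, rfl⟩
  have hnR : (n : ℝ) = (j : ℝ) ^ 4 := by rw [hn]; push_cast; ring
  have hn0 : (0 : ℝ) < n := by rw [hnR]; positivity
  refine ⟨sumVar μ c k (trunc R) (σ j) (j ^ 4) / (j ^ 4 : ℕ),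
    div_nonneg (sumVar_nonneg _ _) (Nat.cast_nonneg _), fun t => ?_⟩
  have hq : ∀ y, μ.real (Metric.closedBall y (3 * (2 * R) / σ j)) ≤
      max M 0 * ((3 * (2 * R) / σ j) ^ d * unitBallVolume d) := fun y => by
    refine ENNReal.toReal_le_of_le_ofReal (by positivity) ?_
    rw [hμ, withDensity_apply _ Metric.isClosed_closedBall.measurableSet,
      ENNReal.ofReal_mul hM0, ← volume_closedBall_eq (by positivity) y]
    refine (setLIntegral_mono (g := fun _ => ENNReal.ofReal (max M 0)) measurable_const
      fun x _ => ENNReal.ofReal_le_ofReal ((hg _).trans (le_max_left _ _))).trans ?_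
    rw [setLIntegral_const]
  have hqn : max M 0 * ((3 * (2 * R) / σ j) ^ d * unitBallVolume d) * (j ^ 4 : ℕ) ≤ Q := by
    rw [hQ, div_pow, hσd]
    have : ((j ^ 4 : ℕ) : ℝ) ≠ 0 := by rw [← hn]; exact hn0.ne'
    apply le_of_eq
    field_simp
  -- the number of subcells in each direction
  obtain ⟨y, hy⟩ : ∃ y : ℕ → ℝ, y = fun N : ℕ => (N : ℝ) ^ ((1 : ℝ) / d) / σ j := ⟨_, rfl⟩
  have hyt : Tendsto y atTop atTop := by
    rw [hy]
    exact (((tendsto_rpow_atTop hdpos).comp tendsto_natCast_atTop_atTop)).atTop_div_const hσj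
  have hyd : ∀ N : ℕ, y N ^ d = N / n := fun N => by
    rw [hy]
    simp only
    rw [div_pow, hσd, ← hn, ← Real.rpow_natCast, ← Real.rpow_mul (Nat.cast_nonneg _),
      one_div_mul_cancel hd0, Real.rpow_one]
  obtain ⟨L, hLdef⟩ : ∃ L : ℕ → ℕ, L = fun N : ℕ => ⌊y N⌋₊ := ⟨_, rfl⟩
  have hratio : Tendsto (fun N => (L N : ℝ) / y N) atTop (𝓝 1) := by
    rw [hLdef]; exact (tendsto_nat_floor_div_atTop (R := ℝ)).comp hyt
  have hLpos : ∀ᶠ N in atTop, 0 < L N := by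
    filter_upwards [hyt.eventually_ge_atTop 1] with N hN
    rw [hLdef]; exact Nat.floor_pos.2 hN
  have hypos : ∀ᶠ N in atTop, 0 < y N := hyt.eventually_gt_atTop 0
  have la : Tendsto (fun N : ℕ => (L N : ℝ) ^ d / N) atTop (𝓝 (1 / n)) := by
    have h1 := (hratio.pow d).div_const (n : ℝ)
    rw [one_pow] at h1
    refine h1.congr' ?_
    filter_upwards [eventually_gt_atTop 0] with N hN
    have hN' : (N : ℝ) ≠ 0 := by exact_mod_cast hN.ne'
    rw [div_pow, hyd]
    field_simp
  have lb : Tendsto (fun N : ℕ => (N : ℝ) / (L N : ℝ) ^ d) atTop (𝓝 n) := by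
    have h1 := la.inv₀ (by positivity)
    rw [one_div, inv_inv] at h1
    exact h1.congr fun N => inv_div _ _
  have lu : Tendsto (fun N : ℕ => |t| / √(N : ℝ)) atTop (𝓝 0) :=
    (Real.tendsto_sqrt_atTop.comp tendsto_natCast_atTop_atTop).const_div_atTop _
  have ll : Tendsto (fun N : ℕ => (N : ℝ) ^ ((1 : ℝ) / d) / (L N * σ j)) atTop (𝓝 1) := by
    have h1 := hratio.inv₀ one_ne_zero
    rw [inv_one] at h1
    refine h1.congr fun N => ?_
    rw [inv_div, hy]
    field_simp
  have lim := ((continuous_blockError t D Q (2 * (removalConst d k * (2 * R)))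
    (2 * (2 * j ^ 4 * (2 * j ^ 4 * R))) (sumVar μ c k (trunc R) (σ j) (j ^ 4))
    (μ.real (gridBoundary d h (3 * (2 * R) / σ j))) j).tendsto _).comp
    (la.prodMk_nhds (lb.prodMk_nhds (lu.prodMk_nhds ll)))
  have hlt : blockError t D Q (2 * (removalConst d k * (2 * R)))
      (2 * (2 * j ^ 4 * (2 * j ^ 4 * R))) (sumVar μ c k (trunc R) (σ j) (j ^ 4))
      (μ.real (gridBoundary d h (3 * (2 * R) / σ j))) j (1 / n, n, 0, 1) <
      ε * (1 + |t| + t ^ 2) := by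
    have f0 := blockError_limit_le (D := D) (Q := Q) hD0 hQ0 hj t
      (2 * (removalConst d k * (2 * R))) (2 * (2 * j ^ 4 * (2 * j ^ 4 * R)))
      (sumVar μ c k (trunc R) (σ j) (j ^ 4)) (μ.real (gridBoundary d h (3 * (2 * R) / σ j)))
    rw [← hn] at f0 ⊢
    have f1 := mul_le_mul_of_nonneg_left b1.le (abs_nonneg t)
    have f2 := mul_le_mul_of_nonneg_left b2.le (abs_nonneg t)
    have f3 := mul_le_mul_of_nonneg_right b3.le (sq_nonneg t)
    linarith
  filter_upwards [lim.eventually_lt_const hlt, hLpos, eventually_gt_atTop 0, hypos]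
    with N h1 hL hN hyN
  have hscale : (L N : ℝ) * σ j ≤ (N : ℝ) ^ ((1 : ℝ) / d) := by
    have h2 : (L N : ℝ) ≤ y N := by rw [hLdef]; exact Nat.floor_le hyN.le
    rw [hy] at h2
    simp only at h2
    rwa [le_div_iff₀ hσj] at h2
  have hfin := norm_sumChar_sub_le_blockError μ hd hac hc0 hc1 k hh
    (g := fun m => ENNReal.ofReal (g m)) hμ hR hj hL hN hσj hq hqn hscale t
  rw [← hD] at hfin
  exact hfin.trans h1.le

end GaussianApproximation

/-! ### Approximation by step densities -/

section StepDensity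

variable {d : ℕ}

/-- The size of a function on `ℝ ^ d`, measured in `L¹` and in `L²` at the same time: the sum of
the first two absolute moments. -/
noncomputable def momentSize (u : Pt d → ℝ) : ℝ≥0∞ := ∫⁻ x, (‖u x‖ₑ + ‖u x‖ₑ ^ 2)

lemma momentSize_mono {u v : Pt d → ℝ} (h : ∀ x, |u x| ≤ |v x|) : momentSize u ≤ momentSize v := by
  refine lintegral_mono fun x => ?_
  have : ‖u x‖ₑ ≤ ‖v x‖ₑ := by
    rw [Real.enorm_eq_ofReal_abs, Real.enorm_eq_ofReal_abs]
    exact ENNReal.ofReal_le_ofReal (h x)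
  dsimp only
  gcongr

lemma momentSize_neg (u : Pt d → ℝ) : momentSize (fun x => -u x) = momentSize u := by
  simp [momentSize]

lemma momentSize_add_le {u v : Pt d → ℝ} (hu : Measurable u) :
    momentSize (fun x => u x + v x) ≤ 2 * (momentSize u + momentSize v) := by
  unfold momentSize
  rw [← lintegral_add_left (by fun_prop), ← lintegral_const_mul' _ _ (by norm_num)]
  refine lintegral_mono fun x => ?_
  have h1 : ‖u x + v x‖ₑ ≤ ‖u x‖ₑ + ‖v x‖ₑ := enorm_add_le _ _
  have h2 : (‖u x‖ₑ + ‖v x‖ₑ) ^ 2 ≤ 2 * (‖u x‖ₑ ^ 2 + ‖v x‖ₑ ^ 2) := by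
    have := ENNReal.rpow_add_le_mul_rpow_add_rpow ‖u x‖ₑ ‖v x‖ₑ (p := 2) (by norm_num)
    norm_num at this
    exact this
  calc ‖u x + v x‖ₑ + ‖u x + v x‖ₑ ^ 2
      ≤ (‖u x‖ₑ + ‖v x‖ₑ) + (‖u x‖ₑ + ‖v x‖ₑ) ^ 2 := by gcongr
    _ ≤ 2 * (‖u x‖ₑ + ‖v x‖ₑ) + 2 * (‖u x‖ₑ ^ 2 + ‖v x‖ₑ ^ 2) := by
        gcongr
        exact le_mul_of_one_le_left zero_le (by norm_num)
    _ = 2 * (‖u x‖ₑ + ‖u x‖ₑ ^ 2 + (‖v x‖ₑ + ‖v x‖ₑ ^ 2)) := by ring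

lemma momentSize_const_mul_le {a : ℝ} (ha0 : 0 ≤ a) (ha : a ≤ 1) (u : Pt d → ℝ) :
    momentSize (fun x => a * u x) ≤ ENNReal.ofReal a * momentSize u := by
  unfold momentSize
  rw [← lintegral_const_mul' _ _ ENNReal.ofReal_ne_top]
  refine lintegral_mono fun x => ?_
  simp only [enorm_mul, mul_pow, mul_add]
  rw [Real.enorm_eq_ofReal ha0]
  gcongr
  rw [sq]
  exact mul_le_of_le_one_left zero_le (ENNReal.ofReal_le_one.2 ha)

lemma lintegral_enorm_le_momentSize (u : Pt d → ℝ) : ∫⁻ x, ‖u x‖ₑ ≤ momentSize u :=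
  lintegral_mono fun _ => le_self_add

lemma lintegral_enorm_sq_le_momentSize (u : Pt d → ℝ) : ∫⁻ x, ‖u x‖ₑ ^ 2 ≤ momentSize u :=
  lintegral_mono fun _ => le_add_self

/-- The function can be approximated in `L¹` and `L²` by functions that are constant on the cells of
a grid, nonnegative and bounded. -/
def StepApprox (f : Pt d → ℝ) : Prop :=
  ∀ ε : ℝ≥0∞, ε ≠ 0 → ∃ h : ℝ, 0 < h ∧ ∃ g : (Fin d → ℤ) → ℝ, (∀ m, 0 ≤ g m) ∧
    (∃ M, ∀ m, g m ≤ M) ∧ momentSize (fun x => f x - g (gridCell h x)) ≤ ε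

/-- The functions with `StepApprox` form a closed set. -/
lemma StepApprox.of_approx {f : Pt d → ℝ} (hf : Measurable f)
    (h : ∀ ε : ℝ≥0∞, ε ≠ 0 → ∃ f' : Pt d → ℝ, Measurable f' ∧ StepApprox f' ∧
      momentSize (fun x => f x - f' x) ≤ ε) : StepApprox f := by
  intro ε hε
  have hε4 : ε / 4 ≠ 0 := by simp [hε]
  obtain ⟨f', hf'm, hf', h1⟩ := h (ε / 4) hε4
  obtain ⟨m, hm, g, hg0, hgM, h2⟩ := hf' (ε / 4) hε4
  refine ⟨m, hm, g, hg0, hgM, ?_⟩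
  have h3 := momentSize_add_le (u := fun x => f x - f' x) (v := fun x => f' x - g (gridCell m x))
    (by fun_prop)
  simp only [sub_add_sub_cancel] at h3
  refine h3.trans ?_
  calc 2 * (momentSize (fun x => f x - f' x) + momentSize fun x => f' x - g (gridCell m x))
      ≤ 2 * (ε / 4 + ε / 4) := by gcongr
    _ = 4 * (ε / 4) := by ring
    _ = ε := ENNReal.mul_div_cancel (by norm_num) (by norm_num)

/-- The corner of the cell with index `m`. -/
noncomputable def gridCorner (h : ℝ) (m : Fin d → ℤ) : Pt d := WithLp.toLp 2 fun i => h * m i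

lemma dist_gridCorner_le {h : ℝ} (hh : 0 < h) (x : Pt d) :
    dist x (gridCorner h (gridCell h x)) ≤ h * √d := by
  rw [dist_eq_norm, EuclideanSpace.norm_eq]
  have : ∀ i, ‖(x - gridCorner h (gridCell h x)) i‖ ^ 2 ≤ h ^ 2 := fun i => by
    refine pow_le_pow_left₀ (norm_nonneg _) ?_ 2
    simp only [gridCorner, gridCell, PiLp.sub_apply, Real.norm_eq_abs]
    have h1 : x i - h * ⌊x i / h⌋ = h * Int.fract (x i / h) := by
      rw [Int.fract]; field_simp
    rw [h1, abs_of_nonneg (mul_nonneg hh.le (Int.fract_nonneg _))]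
    exact mul_le_of_le_one_right hh.le (Int.fract_lt_one _).le
  calc √(∑ i, ‖(x - gridCorner h (gridCell h x)) i‖ ^ 2) ≤ √(∑ _i : Fin d, h ^ 2) :=
        Real.sqrt_le_sqrt (Finset.sum_le_sum fun i _ => this i)
    _ = h * √d := by
        rw [Finset.sum_const, Finset.card_univ, Fintype.card_fin, nsmul_eq_mul, mul_comm,
          Real.sqrt_mul (sq_nonneg h), Real.sqrt_sq hh.le]

/-- Sample the function at the corners of the cells of a fine grid. -/
lemma StepApprox.of_continuous {φ : Pt d → ℝ} (hφ : Continuous φ) (hφc : HasCompactSupport φ)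
    (hφ0 : ∀ x, 0 ≤ φ x) : StepApprox φ := by
  intro ε hε
  obtain ⟨B, hB⟩ := hφ.bounded_above_of_compact_support hφc
  obtain ⟨ρ, hρ⟩ := hφc.isCompact.isBounded.subset_closedBall (0 : Pt d)
  obtain ⟨V, hV⟩ : ∃ V, V = volume (Metric.closedBall (0 : Pt d) (ρ + 1)) := ⟨_, rfl⟩
  have hVt : 2 * V ≠ ∞ := by
    rw [hV]; exact ENNReal.mul_ne_top (by norm_num) measure_closedBall_lt_top.ne
  obtain ⟨η', hη', hηV⟩ := ENNReal.exists_nnreal_pos_mul_lt hVt hε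
  obtain ⟨η, hη⟩ : ∃ η : NNReal, η = min η' 1 := ⟨_, rfl⟩
  have hη0 : (0 : ℝ) < η := by rw [hη]; exact_mod_cast lt_min hη' one_pos
  have hη1 : (η : ℝ≥0∞) ≤ 1 := by rw [hη]; exact_mod_cast min_le_right _ _
  have hηη : (η : ℝ≥0∞) ≤ η' := by rw [hη]; exact_mod_cast min_le_left _ _
  have huc := hφc.uniformContinuous_of_continuous hφ
  rw [Metric.uniformContinuous_iff] at huc
  obtain ⟨δ, hδ, hφδ⟩ := huc η hη0
  obtain ⟨h, hh⟩ : ∃ h, h = min δ 1 / (√d + 1) := ⟨_, rfl⟩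
  have hd0 : 0 ≤ √(d : ℝ) := Real.sqrt_nonneg _
  have hh0 : 0 < h := by rw [hh]; have := lt_min hδ one_pos; positivity
  have hhd : h * √d < min δ 1 := by
    rw [hh, div_mul_eq_mul_div, div_lt_iff₀ (by positivity)]
    have := lt_min hδ one_pos
    nlinarith
  refine ⟨h, hh0, fun m => φ (gridCorner h m), fun m => hφ0 _,
    ⟨B, fun m => (le_abs_self _).trans (hB _)⟩, ?_⟩
  have hpt : ∀ x : Pt d, ‖φ x - φ (gridCorner h (gridCell h x))‖ₑ ≤
      (Metric.closedBall (0 : Pt d) (ρ + 1)).indicator (fun _ => (η : ℝ≥0∞)) x := fun x => by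
    have hdx := (dist_gridCorner_le hh0 x).trans_lt hhd
    by_cases hx : x ∈ Metric.closedBall (0 : Pt d) (ρ + 1)
    · rw [Set.indicator_of_mem hx, Real.enorm_eq_ofReal_abs, ← Real.dist_eq]
      refine ENNReal.ofReal_le_of_le_toReal ?_
      exact (hφδ (hdx.trans_le (min_le_left _ _))).le
    · rw [Set.indicator_of_notMem hx]
      have hzero : ∀ y, dist x y < 1 → φ y = 0 := fun y hy => by
        by_contra h0
        have h1 := hρ (subset_tsupport φ h0)
        rw [Metric.mem_closedBall] at h1 hx
        exact hx (by linarith [dist_triangle x y 0])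
      rw [hzero x (by simp), hzero _ (hdx.trans_le (min_le_right _ _)), sub_zero, enorm_zero]
  calc momentSize (fun x => φ x - φ (gridCorner h (gridCell h x)))
      ≤ ∫⁻ x, (Metric.closedBall (0 : Pt d) (ρ + 1)).indicator (fun _ => 2 * (η : ℝ≥0∞)) x := by
        refine lintegral_mono fun x => ?_
        have h1 := hpt x
        by_cases hx : x ∈ Metric.closedBall (0 : Pt d) (ρ + 1)
        · rw [Set.indicator_of_mem hx] at h1 ⊢
          have h2 : ‖φ x - φ (gridCorner h (gridCell h x))‖ₑ ^ 2 ≤ η := by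
            rw [sq]
            exact (mul_le_of_le_one_left zero_le (h1.trans hη1)).trans h1
          calc _ ≤ (η : ℝ≥0∞) + η := add_le_add h1 h2
            _ = _ := (two_mul _).symm
        · rw [Set.indicator_of_notMem hx] at h1 ⊢
          have h2 := nonpos_iff_eq_zero.1 h1
          simp [h2]
    _ = η * (2 * V) := by
        rw [lintegral_indicator Metric.isClosed_closedBall.measurableSet, setLIntegral_const, hV]
        ring
    _ ≤ η' * (2 * V) := by gcongr
    _ ≤ ε := hηV.le

/-- Continuous functions are dense in `L¹`, and clipping preserves the bounds; for functions with
values in `[0, B]`, closeness in `L¹` gives closeness in `L²`. -/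
lemma StepApprox.of_bounded {f : Pt d → ℝ} (hf : Measurable f) (hfi : Integrable f)
    (hf0 : ∀ x, 0 ≤ f x) {B : ℝ} (hB : ∀ x, f x ≤ B) : StepApprox f := by
  refine StepApprox.of_approx hf fun ε hε => ?_
  have hB0 : 0 ≤ B := (hf0 0).trans (hB 0)
  have hne : (1 + ENNReal.ofReal B) ≠ ∞ := by finiteness
  obtain ⟨η, hη, hηε⟩ := ENNReal.exists_nnreal_pos_mul_lt hne hε
  obtain ⟨φ, hφc, hφl, hφ, -⟩ := hfi.exists_hasCompactSupport_lintegral_sub_le (ε := η)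
    (by exact_mod_cast hη.ne')
  obtain ⟨ψ, hψ⟩ : ∃ ψ : Pt d → ℝ, ψ = fun x => max 0 (min (φ x) B) := ⟨_, rfl⟩
  have hψc : Continuous ψ := by rw [hψ]; fun_prop
  have hψ0 : ∀ x, 0 ≤ ψ x := fun x => by rw [hψ]; exact le_max_left _ _
  have hψB : ∀ x, ψ x ≤ B := fun x => by rw [hψ]; exact max_le hB0 (min_le_right _ _)
  have hclose : ∀ x, |f x - ψ x| ≤ |f x - φ x| := fun x => by
    have h1 : f x = max 0 (min (f x) B) := by rw [min_eq_left (hB x), max_eq_right (hf0 x)]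
    have h2 : ψ x = max 0 (min (φ x) B) := by rw [hψ]
    rw [h2]
    conv_lhs => rw [h1]
    refine (abs_max_sub_max_le_max _ _ _ _).trans ?_
    rw [sub_self, abs_zero, max_eq_right (abs_nonneg _)]
    refine (abs_min_sub_min_le_max _ _ _ _).trans ?_
    rw [sub_self, abs_zero, max_eq_left (abs_nonneg _)]
  have hψs : HasCompactSupport ψ := by
    refine hφc.mono fun x hx => ?_
    rw [Function.mem_support] at hx ⊢
    rintro h0
    apply hx
    simp [hψ, h0, hB0]
  refine ⟨ψ, hψc.measurable, StepApprox.of_continuous hψc hψs hψ0, ?_⟩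
  calc momentSize (fun x => f x - ψ x) ≤ ∫⁻ x, ‖f x - φ x‖ₑ * (1 + ENNReal.ofReal B) := by
        refine lintegral_mono fun x => ?_
        have h1 : ‖f x - ψ x‖ₑ ≤ ‖f x - φ x‖ₑ := by
          rw [Real.enorm_eq_ofReal_abs, Real.enorm_eq_ofReal_abs]
          exact ENNReal.ofReal_le_ofReal (hclose x)
        have h2 : ‖f x - ψ x‖ₑ ≤ ENNReal.ofReal B := by
          rw [Real.enorm_eq_ofReal_abs]
          refine ENNReal.ofReal_le_ofReal (abs_le.2 ⟨?_, ?_⟩)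
          · linarith [hf0 x, hψB x]
          · linarith [hB x, hψ0 x]
        dsimp only
        rw [mul_add, mul_one, sq]
        gcongr
    _ = (∫⁻ x, ‖f x - φ x‖ₑ) * (1 + ENNReal.ofReal B) := lintegral_mul_const' _ _ hne
    _ ≤ η * (1 + ENNReal.ofReal B) := by gcongr
    _ ≤ ε := hηε.le

/-- Truncate the values of the function from above. -/
lemma StepApprox.of_momentSize_ne_top {f : Pt d → ℝ} (hf : Measurable f) (hf0 : ∀ x, 0 ≤ f x)
    (hft : momentSize f ≠ ∞) : StepApprox f := by
  refine StepApprox.of_approx hf fun ε hε => ?_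
  have hfi : Integrable f := ⟨hf.aestronglyMeasurable,
    (lintegral_enorm_le_momentSize f).trans_lt hft.lt_top⟩
  have hlim : Tendsto (fun n : ℕ => momentSize fun x => f x - min (f x) n) atTop
      (𝓝 (∫⁻ _ : Pt d, 0)) := by
    refine tendsto_lintegral_of_dominated_convergence (fun x => ‖f x‖ₑ + ‖f x‖ₑ ^ 2)
      (fun n => by fun_prop) (fun n => Eventually.of_forall fun x => ?_) hft
      (Eventually.of_forall fun x => ?_)
    · have : ‖f x - min (f x) n‖ₑ ≤ ‖f x‖ₑ := by
        rw [Real.enorm_eq_ofReal_abs, Real.enorm_eq_ofReal_abs, abs_of_nonneg (hf0 x)]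
        refine ENNReal.ofReal_le_ofReal (abs_le.2 ⟨?_, ?_⟩)
        · linarith [min_le_left (f x) n, hf0 x]
        · linarith [le_min (hf0 x) (Nat.cast_nonneg n : (0 : ℝ) ≤ n)]
      dsimp only
      gcongr
    · refine tendsto_const_nhds.congr' ?_
      obtain ⟨n0, hn0⟩ := exists_nat_ge (f x)
      filter_upwards [eventually_ge_atTop n0] with n hn
      have : f x ≤ n := hn0.trans (by exact_mod_cast hn)
      rw [min_eq_left this, sub_self, enorm_zero]
      simp
  rw [lintegral_zero] at hlim
  obtain ⟨n, hn⟩ := (hlim.eventually_le_const (pos_iff_ne_zero.2 hε)).exists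
  refine ⟨fun x => min (f x) n, by fun_prop, ?_, hn⟩
  have h0 : ∀ x, 0 ≤ min (f x) (n : ℝ) := fun x => le_min (hf0 x) (Nat.cast_nonneg n)
  refine StepApprox.of_bounded (by fun_prop) (hfi.mono (by fun_prop)
    (Eventually.of_forall fun x => ?_)) h0 (B := n) fun x => min_le_right _ _
  rw [Real.norm_of_nonneg (h0 x), Real.norm_of_nonneg (hf0 x)]
  exact min_le_left _ _

/-- Square integrable probability densities can be approximated in `L¹` and `L²` by
probability densities that are constant on the cells of a grid and bounded. -/
lemma exists_step_density {f : Pt d → ℝ} (hf : Measurable f) (hf0 : ∀ x, 0 ≤ f x)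
    (hf1 : ∫⁻ x, ENNReal.ofReal (f x) = 1) (hft : momentSize f ≠ ∞) {ε : ℝ≥0∞} (hε : ε ≠ 0) :
    ∃ h : ℝ, 0 < h ∧ ∃ g : (Fin d → ℤ) → ℝ, (∀ m, 0 ≤ g m) ∧ (∃ M, ∀ m, g m ≤ M) ∧
      ∫⁻ x, ENNReal.ofReal (g (gridCell h x)) = 1 ∧
      momentSize (fun x => f x - g (gridCell h x)) ≤ ε := by
  have hat : 2 + 8 * (momentSize f + 1) ≠ ∞ := by finiteness
  obtain ⟨δ', hδ', hδε⟩ := ENNReal.exists_nnreal_pos_mul_lt hat hε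
  obtain ⟨δ, hδ⟩ : ∃ δ : NNReal, δ = min δ' (1 / 2) := ⟨_, rfl⟩
  have hδ0 : 0 < δ := by rw [hδ]; exact lt_min hδ' (by norm_num)
  have hδ2 : (δ : ℝ) ≤ 1 / 2 := by
    have : δ ≤ 1 / 2 := by rw [hδ]; exact min_le_right _ _
    exact_mod_cast this
  have hδδ : (δ : ℝ≥0∞) ≤ δ' := by rw [hδ]; exact_mod_cast min_le_left _ _
  obtain ⟨h, hh, g, hg0, ⟨M, hM⟩, hfg⟩ := StepApprox.of_momentSize_ne_top hf hf0 hft δ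
    (by exact_mod_cast hδ0.ne')
  obtain ⟨G, hG⟩ : ∃ G : Pt d → ℝ, G = fun x => g (gridCell h x) := ⟨_, rfl⟩
  have hGm : Measurable G := by
    rw [hG]; exact (measurable_of_countable g).comp (measurable_gridCell h)
  have hG0 : ∀ x, 0 ≤ G x := fun x => by rw [hG]; exact hg0 _
  have hfG : momentSize (fun x => f x - G x) ≤ δ := by rw [hG]; exact hfg
  have hfi : Integrable f := ⟨hf.aestronglyMeasurable,
    (lintegral_enorm_le_momentSize f).trans_lt hft.lt_top⟩
  have hfGi : Integrable fun x => f x - G x := ⟨(hf.sub hGm).aestronglyMeasurable,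
    (lintegral_enorm_le_momentSize _).trans_lt (hfG.trans_lt ENNReal.coe_lt_top)⟩
  have hGi : Integrable G := (hfi.sub hfGi).congr (Eventually.of_forall fun x => by simp)
  have hf1' : ∫ x, f x = 1 := by
    rw [integral_eq_lintegral_of_nonneg_ae (Eventually.of_forall hf0) hf.aestronglyMeasurable, hf1,
      ENNReal.toReal_one]
  obtain ⟨I, hI⟩ : ∃ I, I = ∫ x, G x := ⟨_, rfl⟩
  have hI1 : |1 - I| ≤ δ := by
    rw [hI, ← hf1', ← integral_sub hfi hGi, ← Real.norm_eq_abs]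
    refine (norm_integral_le_lintegral_norm _).trans ?_
    refine ENNReal.toReal_le_of_le_ofReal δ.coe_nonneg ?_
    rw [ENNReal.ofReal_coe_nnreal]
    simp only [ofReal_norm]
    exact (lintegral_enorm_le_momentSize _).trans hfG
  have hI2 : 1 / 2 ≤ I := by have := le_abs_self (1 - I); linarith
  have hI0 : 0 < I := by linarith
  -- the approximating step function has an integral `I` close to `1`, by which it is divided
  refine ⟨h, hh, fun m => g m / I, fun m => div_nonneg (hg0 m) hI0.le,
    ⟨M / I, fun m => div_le_div_of_nonneg_right (hM m) hI0.le⟩, ?_, ?_⟩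
  · have h1 : ∀ x, ENNReal.ofReal (g (gridCell h x) / I) =
        ENNReal.ofReal (G x) * (ENNReal.ofReal I)⁻¹ := fun x => by
      rw [ENNReal.ofReal_div_of_pos hI0, div_eq_mul_inv, hG]
    simp_rw [h1]
    have hIne : ENNReal.ofReal I ≠ 0 := by simpa using hI0
    rw [lintegral_mul_const' _ _ (ENNReal.inv_ne_top.2 hIne),
      ← ofReal_integral_eq_lintegral_ofReal hGi (Eventually.of_forall hG0), ← hI,
      ENNReal.mul_inv_cancel hIne ENNReal.ofReal_ne_top]
  · have hJG : momentSize G ≤ 2 * (momentSize f + δ) := by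
      have h1 := momentSize_add_le (u := f) (v := fun x => -(f x - G x)) hf
      rw [momentSize_neg] at h1
      simp only [neg_sub, add_sub_cancel] at h1
      exact h1.trans (by gcongr)
    have hJ2 : momentSize (fun x => G x - G x / I) ≤ ENNReal.ofReal (2 * δ) * momentSize G := by
      refine le_trans (momentSize_mono fun x => ?_)
        (momentSize_const_mul_le (a := 2 * δ) (by positivity) (by linarith) G)
      have h1 : G x - G x / I = -(1 - I) / I * G x := by field_simp; ring
      rw [h1, abs_mul, abs_mul]
      refine mul_le_mul_of_nonneg_right ?_ (abs_nonneg _)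
      rw [abs_div, abs_neg, abs_of_pos hI0, div_le_iff₀ hI0,
        abs_of_nonneg (by positivity : (0 : ℝ) ≤ 2 * (δ : ℝ))]
      nlinarith [δ.coe_nonneg]
    have h2 := momentSize_add_le (u := fun x => f x - G x) (v := fun x => G x - G x / I)
      (by fun_prop)
    simp only [sub_add_sub_cancel] at h2
    have h3 : (fun x => f x - g (gridCell h x) / I) = fun x => f x - G x / I := by rw [hG]
    rw [h3]
    refine h2.trans (le_trans ?_ hδε.le)
    have hδ1 : (δ : ℝ≥0∞) ≤ 1 := by
      have : δ ≤ 1 := by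
        have h4 : (δ : ℝ) ≤ 1 := by linarith
        exact_mod_cast h4
      exact_mod_cast this
    calc 2 * (momentSize (fun x => f x - G x) + momentSize fun x => G x - G x / I)
        ≤ 2 * (δ + (2 * δ) * (2 * (momentSize f + 1))) := by
          refine mul_le_mul_right (add_le_add hfG (hJ2.trans ?_)) _
          rw [ENNReal.ofReal_mul (by norm_num), ENNReal.ofReal_coe_nnreal]
          refine mul_le_mul' (by simp) (hJG.trans (by gcongr))
      _ = δ * (2 + 8 * (momentSize f + 1)) := by ring
      _ ≤ δ' * (2 + 8 * (momentSize f + 1)) := by gcongr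

end StepDensity

/-! ### The central limit theorem, uniformly in the distribution -/

section DensityStability

variable {d : ℕ}

lemma lintegral_ofReal_le_momentSize (u : Pt d → ℝ) :
    ∫⁻ x, ENNReal.ofReal (u x) ≤ momentSize u :=
  (lintegral_mono fun x => by
    rw [← ofReal_norm]; exact ENNReal.ofReal_le_ofReal (le_abs_self _)).trans
    (lintegral_enorm_le_momentSize u)

lemma lintegral_ofReal_sq_le_momentSize (u : Pt d → ℝ) :
    ∫⁻ x, ENNReal.ofReal (u x ^ 2) ≤ momentSize u :=
  (lintegral_mono fun x => by
    rw [← ofReal_norm, ← ENNReal.ofReal_pow (norm_nonneg _), Real.norm_eq_abs, sq_abs]).trans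
    (lintegral_enorm_sq_le_momentSize u)

/-- The law of the truncated total length depends continuously on the density, uniformly in the
sample size: two samples are coupled point by point through a maximal coupling, and the variance of
the difference of the two lengths is estimated. -/
lemma norm_sumChar_sub_le_of_density (hd : 1 ≤ d) {c : ℝ} (hc0 : 0 ≤ c) (hc1 : c ≤ 1) (k : ℕ)
    {q g : Pt d → ℝ} (hq : Measurable q) (hg : Measurable g) (hq0 : ∀ x, 0 ≤ q x)
    (hg0 : ∀ x, 0 ≤ g x)
    [hQp : IsProbabilityMeasure (volume.withDensity fun x => ENNReal.ofReal (q x))]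
    [hGp : IsProbabilityMeasure (volume.withDensity fun x => ENNReal.ofReal (g x))]
    {η M : ℝ} (hη : 0 < η) (hη1 : η ≤ 1) (hM : 0 ≤ M)
    (hqg : momentSize (fun x => q x - g x) ≤ ENNReal.ofReal (η ^ 2))
    (hqM : momentSize q ≤ ENNReal.ofReal M) (hgM : momentSize g ≤ ENNReal.ofReal M)
    {R : ℝ} (hR : 0 ≤ R) {s : ℝ} (hs : 0 < s) {m : ℕ} (hsm : s ^ d = m) (u : ℝ) :
    ‖sumChar (volume.withDensity fun x => ENNReal.ofReal (q x)) c k (trunc R) s m u -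
        sumChar (volume.withDensity fun x => ENNReal.ofReal (g x)) c k (trunc R) s m u‖ ≤
      |u| * √((2 * (removalConst d k * R)) ^ 2 *
        (m * (η * (1 + 2 * (1 + M) * ((6 * R) ^ d * unitBallVolume d))))) := by
  obtain ⟨π, hπp, hπ1, hπ2, hr1, hr2⟩ := exists_maximal_coupling volume hq hg hq0 hg0
  have hgq : momentSize (fun x => g x - q x) ≤ ENNReal.ofReal (η ^ 2) := by
    have h := momentSize_neg (fun x => q x - g x)
    simp only [neg_sub] at h
    rwa [h]
  have hrt := measurable_trunc R
  have hb := bddMeas_trunc hR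
  have hac1 : π.map Prod.fst ≪ volume := by rw [hπ1]; exact withDensity_absolutelyContinuous _ _
  have hac2 : π.map Prod.snd ≪ volume := by rw [hπ2]; exact withDensity_absolutelyContinuous _ _
  have hηη : η ^ 2 ≤ η := by nlinarith
  have hNm : MeasurableSet {p : Pt d × Pt d | p.1 ≠ p.2} :=
    (measurableSet_eq_fun measurable_fst measurable_snd).compl
  have he : π.real {p | p.1 ≠ p.2} ≤ η := by
    refine ENNReal.toReal_le_of_le_ofReal hη.le ?_
    calc π {p | p.1 ≠ p.2} = (π.restrict {p | p.1 ≠ p.2}).map Prod.fst Set.univ := by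
          rw [Measure.map_apply measurable_fst MeasurableSet.univ]; simp
      _ ≤ volume.withDensity (fun x => ENNReal.ofReal (q x - g x)) Set.univ := hr1 _
      _ = ∫⁻ x, ENNReal.ofReal (q x - g x) := by
          rw [withDensity_apply _ MeasurableSet.univ, Measure.restrict_univ]
      _ ≤ ENNReal.ofReal (η ^ 2) := (lintegral_ofReal_le_momentSize _).trans hqg
      _ ≤ ENNReal.ofReal η := ENNReal.ofReal_le_ofReal hηη
  have hρ : 0 ≤ 3 * (2 * R) / s := by positivity
  have hn1 := coupling_near_le π Prod.fst measurable_fst hq hq0 hπ1 hq hg hr1 hη hM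
    ((lintegral_ofReal_sq_le_momentSize _).trans hqg)
    ((lintegral_ofReal_sq_le_momentSize _).trans hqM) hρ
  have hn2 := coupling_near_le π Prod.snd measurable_snd hg hg0 hπ2 hg hq hr2 hη hM
    ((lintegral_ofReal_sq_le_momentSize _).trans hgq)
    ((lintegral_ofReal_sq_le_momentSize _).trans hgM) hρ
  have hvar := variance_coupling_le (ι := Fin m) hd π hac1 hac2 hc0 hc1 k hs hrt
    (abs_trunc_le hR) (fun t ht => trunc_eq_zero ht) he hn1 hn2
  have hB1 : BddMeas fun z : Fin m → Pt d × Pt d =>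
      graphSum c k (trunc R) (fun a => s • (z a).1) Finset.univ :=
    bddMeas_graphSum hc0 hc1 k hb (φ := fun a (z : Fin m → Pt d × Pt d) => s • (z a).1)
      (fun a => by fun_prop) _
  have hB2 : BddMeas fun z : Fin m → Pt d × Pt d =>
      graphSum c k (trunc R) (fun a => s • (z a).2) Finset.univ :=
    bddMeas_graphSum hc0 hc1 k hb (φ := fun a (z : Fin m → Pt d × Pt d) => s • (z a).2)
      (fun a => by fun_prop) _
  have hmp1 : MeasurePreserving (Prod.fst : Pt d × Pt d → Pt d) π
      (volume.withDensity fun x => ENNReal.ofReal (q x)) := ⟨measurable_fst, hπ1⟩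
  have hmp2 : MeasurePreserving (Prod.snd : Pt d × Pt d → Pt d) π
      (volume.withDensity fun x => ENNReal.ofReal (g x)) := ⟨measurable_snd, hπ2⟩
  have e1 : sumChar (volume.withDensity fun x => ENNReal.ofReal (q x)) c k (trunc R) s m u =
      centredChar (Measure.pi fun _ : Fin m => π)
        (fun z => graphSum c k (trunc R) (fun a => s • (z a).1) Finset.univ) u := by
    have h := measurePreserving_pi (fun _ : Fin m => π) _ (fun _ => hmp1)
    rw [sumChar, ← h.map_eq, centredChar_map h.measurable (measurable_graphSum_smul hrt _)]
  have e2 : sumChar (volume.withDensity fun x => ENNReal.ofReal (g x)) c k (trunc R) s m u =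
      centredChar (Measure.pi fun _ : Fin m => π)
        (fun z => graphSum c k (trunc R) (fun a => s • (z a).2) Finset.univ) u := by
    have h := measurePreserving_pi (fun _ : Fin m => π) _ (fun _ => hmp2)
    rw [sumChar, ← h.map_eq, centredChar_map h.measurable (measurable_graphSum_smul hrt _)]
  rw [e1, e2]
  refine (norm_centredChar_sub_le hB1 hB2 _ u).trans
    (mul_le_mul_of_nonneg_left (Real.sqrt_le_sqrt (hvar.trans (le_of_eq ?_))) (abs_nonneg u))
  have h3 : (m : ℝ) * (3 * (2 * R) / s) ^ d = (6 * R) ^ d := by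
    rw [div_pow, ← hsm]; field_simp; ring
  rw [Fintype.card_fin, ← h3]
  ring

end DensityStability

section LongEdges

variable {d : ℕ}

lemma bddMeas_clip {Δ : ℝ} (hΔ : 0 ≤ Δ) : BddMeas fun t : ℝ => max 0 (min t Δ) :=
  ⟨by fun_prop, Δ, fun t => by
    rw [abs_of_nonneg (le_max_left _ _)]; exact max_le hΔ (min_le_right _ _)⟩

/-- Truncation of the edge lengths changes the law of the total length little, uniformly in the
sample size and over all distributions in `ballMassClass`. -/
lemma norm_sumChar_id_sub_trunc_le (hd : 1 ≤ d) (F : Measure (Pt d)) [IsProbabilityMeasure F]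
    (hac : F ≪ volume) {C : Set (Pt d)} (hC : F Cᶜ = 0)
    {Δ γ : ℝ} (hΔ0 : 0 ≤ Δ) (hΔ : ∀ x ∈ C, ∀ y ∈ C, dist x y ≤ Δ) (hγ : 0 < γ)
    (hF : ∀ x ∈ C, ∀ r, 0 < r → r ≤ Δ → γ * r ^ d ≤ F.real (Metric.closedBall x r))
    {c : ℝ} (hc0 : 0 ≤ c) (hc1 : c ≤ 1)
    (k : ℕ) {s : ℝ} (hs : 0 < s) {m : ℕ} (hm : 2 ≤ m) (hsm : s ^ d = m)
    {R : ℕ} (hR : 1 ≤ R) (u : ℝ) :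
    ‖sumChar F c k (fun t => t) s m u - sumChar F c k (trunc R) s m u‖ ≤
      |u| * √(m * (tailConst d k * ∑' t, tailTerm γ (t + R))) := by
  have hclip := bddMeas_clip (mul_nonneg hs.le hΔ0)
  have hR0 : (0 : ℝ) ≤ R := Nat.cast_nonneg R
  have htr := bddMeas_trunc hR0
  -- almost surely no edge is longer than `s * Δ`, which makes the edge weight bounded
  have hae : (fun z : Fin m → Pt d => graphSum c k (fun t => t) (fun i => s • z i) Finset.univ)
      =ᵐ[Measure.pi fun _ => F] fun z =>
        graphSum c k (fun t => max 0 (min t (s * Δ))) (fun i => s • z i) Finset.univ := by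
    have h1 : ∀ᵐ z : Fin m → Pt d ∂(Measure.pi fun _ => F), ∀ i, z i ∈ C :=
      ae_all_iff.2 fun i => (Measure.quasiMeasurePreserving_eval (fun _ : Fin m => F) i).ae
        (p := fun x => x ∈ C) hC
    filter_upwards [h1] with z hz
    unfold graphSum
    refine Finset.sum_congr rfl fun i _ => Finset.sum_congr rfl fun j _ => ?_
    congr 1
    have : dist (s • z i) (s • z j) ≤ s * Δ := by
      rw [dist_smul₀, Real.norm_of_nonneg hs.le]
      exact mul_le_mul_of_nonneg_left (hΔ _ (hz i) _ (hz j)) hs.le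
    simp only
    rw [min_eq_left this, max_eq_right dist_nonneg]
  have e1 : sumChar F c k (fun t => t) s m u =
      sumChar F c k (fun t => max 0 (min t (s * Δ))) s m u := centredChar_congr_ae hae u
  rw [e1]
  have h1 := bddMeas_graphSum_smul (ι := Fin m) (d := d) (s := s) (k := k) hc0 hc1 hclip Finset.univ
  have h2 := bddMeas_graphSum_smul (ι := Fin m) (d := d) (s := s) (k := k) hc0 hc1 htr Finset.univ
  refine (norm_centredChar_sub_le h1 h2 (Measure.pi fun _ => F) u).trans
    (mul_le_mul_of_nonneg_left (Real.sqrt_le_sqrt ?_) (abs_nonneg u))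
  have h3 := variance_longEdges_le (ι := Fin m) F hd hac hC hΔ hγ hF hc0 hc1 k hs
    (by simpa using hm) (by simpa using hsm) hR (w := fun t => max 0 (min t (s * Δ)) - trunc R t)
    (hclip.sub htr) (fun t h0 ht => by
      rw [min_eq_left ht, max_eq_right h0]
      split_ifs with h
      · rw [abs_of_nonneg (by linarith [trunc_le_self (R := (R : ℝ)) h0])]
        linarith [trunc_nonneg (R : ℝ) t]
      · rw [trunc_eq_self h0 (not_lt.1 h), sub_self, abs_zero])
  simp only [graphSum_sub_weight, Fintype.card_fin] at h3
  exact h3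

/-- The lower bound on the mass of balls extends to all radii up to any `Δ`. -/
lemma le_measureReal_closedBall_of_mem_ballMassClass {γ r₀ : ℝ} (hγ : 0 < γ) (hr₀ : 0 < r₀)
    {C : Set (Pt d)} {Q : ProbabilityMeasure (Pt d)} (hQ : Q ∈ ballMassClass γ r₀ C) {Δ : ℝ}
    {x : Pt d} (hx : x ∈ C) {r : ℝ} (hr : 0 < r) (hrΔ : r ≤ Δ) :
    γ * (min 1 (r₀ / Δ)) ^ d * r ^ d ≤ (Q : Measure (Pt d)).real (Metric.closedBall x r) := by
  have hΔ : 0 < Δ := hr.trans_le hrΔ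
  have hmin : 0 < min 1 (r₀ / Δ) := lt_min one_pos (div_pos hr₀ hΔ)
  obtain ⟨a, ha⟩ : ∃ a, a = min 1 (r₀ / Δ) := ⟨_, rfl⟩
  rw [← ha] at hmin ⊢
  have ha1 : a ≤ 1 := by rw [ha]; exact min_le_left _ _
  have har : a * r ≤ r₀ := by
    calc a * r ≤ r₀ / Δ * r := by rw [ha]; gcongr; exact min_le_right _ _
      _ ≤ r₀ / Δ * Δ := by gcongr
      _ = r₀ := div_mul_cancel₀ _ hΔ.ne'
  have h := hQ.2 x hx (a * r) (by positivity) har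
  rw [mul_assoc, ← mul_pow]
  calc γ * (a * r) ^ d = (ENNReal.ofReal (γ * (a * r) ^ d)).toReal :=
        (ENNReal.toReal_ofReal (by positivity)).symm
    _ ≤ ((Q : Measure (Pt d)) (Metric.closedBall x (a * r))).toReal :=
        ENNReal.toReal_mono (measure_ne_top _ _) h
    _ ≤ _ := measureReal_mono (Metric.closedBall_subset_closedBall (by nlinarith))

end LongEdges

section GaussianLimit

lemma abs_div_sqrt_mul_sqrt {m : ℕ} (hm : 0 < m) (t X : ℝ) :
    |t / √(m : ℝ)| * √(m * X) = |t| * √X := by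
  have h : (0 : ℝ) < √(m : ℝ) := Real.sqrt_pos.2 (by exact_mod_cast hm)
  rw [abs_div, abs_of_pos h, Real.sqrt_mul (Nat.cast_nonneg m)]
  field_simp

/-- Gaussian characteristic functions that are asymptotically close to each other have variances
that converge. -/
lemma exists_common_variance {v : ℕ → ℝ} (hv : ∀ i, 0 ≤ v i)
    (h : ∀ i j t, |Real.exp (-(v i * t ^ 2 / 2)) - Real.exp (-(v j * t ^ 2 / 2))| ≤
      (1 / ((i : ℝ) + 1) + 1 / ((j : ℝ) + 1)) * (1 + |t| + t ^ 2)) :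
    ∃ V, 0 ≤ V ∧ ∀ j t, |Real.exp (-(V * t ^ 2 / 2)) - Real.exp (-(v j * t ^ 2 / 2))| ≤
      1 / ((j : ℝ) + 1) * (1 + |t| + t ^ 2) := by
  -- a fixed small `t` bounds all `v i` with `i ≥ 7` in terms of `v 7`
  obtain ⟨t, ht0, ht1, ht2⟩ : ∃ t : ℝ, 0 < t ∧ 1 + |t| + t ^ 2 < 2 ∧
      3 / 4 < Real.exp (-(v 7 * t ^ 2 / 2)) := by
    have h1 : ∀ᶠ t : ℝ in 𝓝 0, 1 + |t| + t ^ 2 < 2 :=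
      ContinuousAt.eventually_lt (by fun_prop) continuousAt_const (by norm_num)
    have h2 : ∀ᶠ t : ℝ in 𝓝 0, 3 / 4 < Real.exp (-(v 7 * t ^ 2 / 2)) :=
      ContinuousAt.eventually_lt continuousAt_const (by fun_prop) (by norm_num)
    have h3 : ∀ᶠ t : ℝ in 𝓝[>] 0, 1 + |t| + t ^ 2 < 2 ∧ 3 / 4 < Real.exp (-(v 7 * t ^ 2 / 2)) :=
      nhdsWithin_le_nhds (h1.and h2)
    obtain ⟨t, ⟨ht1, ht2⟩, ht0⟩ := (h3.and self_mem_nhdsWithin).exists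
    exact ⟨t, ht0, ht1, ht2⟩
  have hbd : ∀ n, v (n + 7) ∈ Set.Icc 0 (8 / t ^ 2) := fun n => by
    refine ⟨hv _, ?_⟩
    have h1 := h (n + 7) 7 t
    have h2 : (1 / (((n + 7 : ℕ) : ℝ) + 1) + 1 / (((7 : ℕ) : ℝ) + 1)) ≤ 1 / 4 := by
      have : 1 / (((n + 7 : ℕ) : ℝ) + 1) ≤ 1 / 8 := by
        apply one_div_le_one_div_of_le (by norm_num)
        push_cast; linarith [(Nat.cast_nonneg n : (0 : ℝ) ≤ n)]
      norm_num at this ⊢; linarith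
    have h3 := h1.trans (mul_le_mul_of_nonneg_right h2 (by positivity))
    have h4 := (abs_le.1 h3).1
    have h5 : 1 / 4 ≤ Real.exp (-(v (n + 7) * t ^ 2 / 2)) := by linarith
    have h6 : Real.exp (-4) < 1 / 4 := by
      rw [Real.exp_neg, inv_eq_one_div]
      refine one_div_lt_one_div_of_lt (by norm_num) ?_
      linarith [Real.add_one_lt_exp (x := 4) (by norm_num)]
    have h7 := Real.exp_lt_exp.1 (h6.trans_le h5)
    rw [le_div_iff₀ (by positivity)]
    linarith
  obtain ⟨V, hV, φ, hφ, hlim⟩ := isCompact_Icc.tendsto_subseq hbd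
  refine ⟨V, hV.1, fun j t => ?_⟩
  have l1 : Tendsto (fun n => |Real.exp (-(v (φ n + 7) * t ^ 2 / 2)) -
      Real.exp (-(v j * t ^ 2 / 2))|) atTop
      (𝓝 |Real.exp (-(V * t ^ 2 / 2)) - Real.exp (-(v j * t ^ 2 / 2))|) := by
    have hc : Continuous fun x : ℝ => |Real.exp (-(x * t ^ 2 / 2)) -
      Real.exp (-(v j * t ^ 2 / 2))| := by fun_prop
    exact (hc.tendsto V).comp hlim
  have l2 : Tendsto (fun n => (1 / (((φ n + 7 : ℕ) : ℝ) + 1) + 1 / ((j : ℝ) + 1)) *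
      (1 + |t| + t ^ 2)) atTop (𝓝 ((0 + 1 / ((j : ℝ) + 1)) * (1 + |t| + t ^ 2))) := by
    refine Tendsto.mul_const _ (Tendsto.add_const _ ?_)
    exact tendsto_one_div_add_atTop_nhds_zero_nat.comp
      ((tendsto_add_atTop_nat 7).comp hφ.tendsto_atTop)
  rw [zero_add] at l2
  exact le_of_tendsto_of_tendsto' l1 l2 fun n => h _ j t

variable {d : ℕ} (hd : 1 ≤ d) {c : ℝ} (hc0 : 0 ≤ c) (hc1 : c ≤ 1) (k : ℕ) {γ r₀ : ℝ}
  (hγ : 0 < γ) (hr₀ : 0 < r₀) {C : Set (Pt d)} (hC : Bornology.IsBounded C) {f : Pt d → ℝ}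
  (hf : Measurable f) (hf0 : ∀ x, 0 ≤ f x) (hf1 : ∫⁻ x, ENNReal.ofReal (f x) = 1)
  (hft : momentSize f ≠ ∞)

lemma isProbabilityMeasure_withDensity_ofReal {f : Pt d → ℝ}
    (hf1 : ∫⁻ x, ENNReal.ofReal (f x) = 1) :
    IsProbabilityMeasure (volume.withDensity fun x => ENNReal.ofReal (f x)) :=
  ⟨by rw [withDensity_apply _ MeasurableSet.univ, Measure.restrict_univ, hf1]⟩

set_option maxHeartbeats 400000 in
include hd hc0 hc1 hγ hr₀ hC hf hf0 hf1 hft in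
/-- Up to an error `ε`, the total length is asymptotically Gaussian, uniformly over all
distributions in `ballMassClass` whose density is close to `f`. -/
lemma exists_gaussian_approx_near {ε : ℝ} (hε : 0 < ε) :
    ∃ v δ : ℝ, 0 ≤ v ∧ 0 < δ ∧ ∀ t, ∀ᶠ m : ℕ in atTop,
      ∀ Q ∈ ballMassClass γ r₀ C, ∀ q, HasDensity Q q →
        momentSize (fun x => q x - f x) ≤ ENNReal.ofReal δ →
        ‖sumChar (Q : Measure (Pt d)) c k (fun t => t) ((m : ℝ) ^ ((1 : ℝ) / d)) m
            (t / √(m : ℝ)) - ((Real.exp (-(v * t ^ 2 / 2)) : ℝ) : ℂ)‖ ≤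
          ε * (1 + |t| + t ^ 2) := by
  obtain ⟨Δ, hΔ1, hΔ⟩ : ∃ Δ : ℝ, 1 ≤ Δ ∧ ∀ x ∈ C, ∀ y ∈ C, dist x y ≤ Δ := by
    obtain ⟨Δ, h⟩ := Metric.isBounded_iff.1 hC
    exact ⟨max 1 Δ, le_max_left _ _, fun x hx y hy => (h hx hy).trans (le_max_right _ _)⟩
  have hΔ0 : 0 < Δ := by linarith
  obtain ⟨γ', hγ'⟩ : ∃ γ', γ' = γ * (min 1 (r₀ / Δ)) ^ d := ⟨_, rfl⟩
  have hγ'0 : 0 < γ' := by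
    rw [hγ']; exact mul_pos hγ (pow_pos (lt_min one_pos (div_pos hr₀ hΔ0)) _)
  have hε3 : 0 < (ε / 3) ^ 2 := by positivity
  -- the truncation level, chosen in terms of the class of distributions alone
  obtain ⟨R, hR1, hR⟩ : ∃ R : ℕ, 1 ≤ R ∧
      tailConst d k * ∑' t, tailTerm γ' (t + R) < (ε / 3) ^ 2 := by
    have h1 := (tendsto_tail (γ := γ')).const_mul (tailConst d k)
    rw [mul_zero] at h1
    obtain ⟨R, h2, h3⟩ := ((h1.eventually_lt_const hε3).and (eventually_ge_atTop 1)).exists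
    exact ⟨R, h3, h2⟩
  obtain ⟨A, hA⟩ : ∃ A, A = momentSize f := ⟨_, rfl⟩
  rw [← hA] at hft
  obtain ⟨M, hM0, hM⟩ : ∃ M : ℝ, 0 ≤ M ∧ 2 * (1 + A) = ENNReal.ofReal M :=
    ⟨(2 * (1 + A)).toReal, ENNReal.toReal_nonneg, (ENNReal.ofReal_toReal (by finiteness)).symm⟩
  obtain ⟨K, hK⟩ : ∃ K, K = (2 * (removalConst d k * R)) ^ 2 *
      (1 + 2 * (1 + M) * ((6 * R) ^ d * unitBallVolume d)) := ⟨_, rfl⟩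
  have hK0 : 0 ≤ K := by
    have : 0 ≤ unitBallVolume d := ENNReal.toReal_nonneg
    rw [hK]; positivity
  -- how close the densities have to be, given the truncation level
  obtain ⟨η, hη, hη1, hηK⟩ : ∃ η : ℝ, 0 < η ∧ η ≤ 1 ∧ K * η ≤ (ε / 3) ^ 2 := by
    refine ⟨min 1 ((ε / 3) ^ 2 / (K + 1)), lt_min one_pos (by positivity), min_le_left _ _, ?_⟩
    calc K * min 1 ((ε / 3) ^ 2 / (K + 1)) ≤ (K + 1) * ((ε / 3) ^ 2 / (K + 1)) := by
          gcongr
          · linarith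
          · exact min_le_right _ _
      _ = (ε / 3) ^ 2 := by field_simp
  have hδ : 0 < η ^ 2 / 4 := by positivity
  obtain ⟨h, hh, g, hg0, ⟨B, hB⟩, hg1, hfg⟩ := exists_step_density hf hf0 hf1 (hA ▸ hft)
    (ε := ENNReal.ofReal (η ^ 2 / 4)) (ENNReal.ofReal_pos.2 hδ).ne'
  have hδ1 : ENNReal.ofReal (η ^ 2 / 4) ≤ 1 := by
    rw [ENNReal.ofReal_le_one]; nlinarith
  obtain ⟨g', hg'⟩ : ∃ g' : Pt d → ℝ, g' = fun x => g (gridCell h x) := ⟨_, rfl⟩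
  have hg'm : Measurable g' := by
    rw [hg']; exact (measurable_of_countable g).comp (measurable_gridCell h)
  have hg'0 : ∀ x, 0 ≤ g' x := fun x => by rw [hg']; exact hg0 _
  have hgf : momentSize (fun x => g' x - f x) ≤ ENNReal.ofReal (η ^ 2 / 4) := by
    have h1 := momentSize_neg (fun x => f x - g' x)
    simp only [neg_sub] at h1
    rw [h1, hg']; exact hfg
  have hsize : ∀ q : Pt d → ℝ, Measurable q →
      momentSize (fun x => q x - f x) ≤ ENNReal.ofReal (η ^ 2 / 4) →
      momentSize q ≤ ENNReal.ofReal M := fun q hq hqf => by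
    have h1 := momentSize_add_le (v := f) (hq.sub hf)
    simp only [Pi.sub_apply, sub_add_cancel] at h1
    refine h1.trans ?_
    rw [← hM, ← hA]
    gcongr
    exact hqf.trans hδ1
  have hGp : IsProbabilityMeasure (volume.withDensity fun x => ENNReal.ofReal (g' x)) :=
    isProbabilityMeasure_withDensity_ofReal (by rw [hg']; exact hg1)
  obtain ⟨v, hv0, hv⟩ := exists_gaussian_approx
    (volume.withDensity fun x => ENNReal.ofReal (g' x)) hd (withDensity_absolutelyContinuous _ _)
    hc0 hc1 k hh hB (by rw [hg']) (Nat.cast_nonneg R) (ε := ε / 3) (by positivity)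
  refine ⟨v, η ^ 2 / 4, hv0, hδ, fun t => ?_⟩
  filter_upwards [hv t, eventually_ge_atTop 2] with m hvm hm Q hQ q ⟨hqm, hq0, hQq⟩ hqf
  have hm0 : 0 < m := by omega
  have hmR : (0 : ℝ) < m := by exact_mod_cast hm0
  have hs : 0 < (m : ℝ) ^ ((1 : ℝ) / d) := Real.rpow_pos_of_pos hmR _
  have hsm : ((m : ℝ) ^ ((1 : ℝ) / d)) ^ d = m := by
    rw [← Real.rpow_natCast, ← Real.rpow_mul hmR.le, one_div_mul_cancel (by positivity),
      Real.rpow_one]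
  have hac : (Q : Measure (Pt d)) ≪ volume := by
    rw [hQq]; exact withDensity_absolutelyContinuous _ _
  have T1 := norm_sumChar_id_sub_trunc_le hd (Q : Measure (Pt d)) hac hQ.1 hΔ0.le hΔ hγ'0
    (fun x hx r hr hrΔ => by
      rw [hγ']; exact le_measureReal_closedBall_of_mem_ballMassClass hγ hr₀ hQ hx hr hrΔ)
    hc0 hc1 k hs hm hsm hR1 (t / √(m : ℝ))
  have hQp : IsProbabilityMeasure (volume.withDensity fun x => ENNReal.ofReal (q x)) := by
    rw [← hQq]; infer_instance
  have hqg : momentSize (fun x => q x - g' x) ≤ ENNReal.ofReal (η ^ 2) := by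
    have h1 := momentSize_add_le (v := fun x => f x - g' x) (hqm.sub hf)
    simp only [Pi.sub_apply, sub_add_sub_cancel] at h1
    have h2 : momentSize (fun x => f x - g' x) ≤ ENNReal.ofReal (η ^ 2 / 4) := by
      rw [hg']; exact hfg
    calc momentSize (fun x => q x - g' x)
        ≤ 2 * (ENNReal.ofReal (η ^ 2 / 4) + ENNReal.ofReal (η ^ 2 / 4)) := by
          refine h1.trans ?_; gcongr; exact hqf
      _ = ENNReal.ofReal (η ^ 2) := by
          rw [← ENNReal.ofReal_add hδ.le hδ.le, ← ENNReal.ofReal_ofNat 2,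
            ← ENNReal.ofReal_mul (by norm_num)]
          congr 1; ring
  have T2 := norm_sumChar_sub_le_of_density hd hc0 hc1 k hqm hg'm hq0 hg'0 hη hη1 hM0 hqg
    (hsize q hqm hqf) (hsize g' hg'm hgf) (Nat.cast_nonneg R) hs hsm (t / √(m : ℝ))
  rw [← hQq] at T2
  rw [abs_div_sqrt_mul_sqrt hm0] at T1
  rw [show (2 * (removalConst d k * (R : ℝ))) ^ 2 *
      (m * (η * (1 + 2 * (1 + M) * ((6 * (R : ℝ)) ^ d * unitBallVolume d)))) = m * (K * η) by
    rw [hK]; ring, abs_div_sqrt_mul_sqrt hm0] at T2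
  have s1 : √(tailConst d k * ∑' t, tailTerm γ' (t + R)) ≤ ε / 3 :=
    Real.sqrt_le_iff.2 ⟨by positivity, hR.le⟩
  have s2 : √(K * η) ≤ ε / 3 := Real.sqrt_le_iff.2 ⟨by positivity, hηK⟩
  have a0 := abs_nonneg t
  have u1 := T1.trans (mul_le_mul_of_nonneg_left s1 a0)
  have u2 := T2.trans (mul_le_mul_of_nonneg_left s2 a0)
  refine (norm_sub_le_norm_sub_add_norm_sub _ _ _).trans
    ((add_le_add (norm_sub_le_norm_sub_add_norm_sub _ _ _) le_rfl).trans
    ((add_le_add (add_le_add u1 u2) hvm).trans ?_))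
  nlinarith [sq_nonneg t, mul_nonneg hε.le (sq_nonneg t), mul_nonneg hε.le a0]

include hd hc0 hc1 hγ hr₀ hC hf hf0 hf1 hft in
/-- The total length satisfies a central limit theorem, uniformly over all distributions in
`ballMassClass` whose density is close to `f`. -/
theorem exists_gaussian_limit {F : ProbabilityMeasure (Pt d)} (hF : F ∈ ballMassClass γ r₀ C)
    (hFf : HasDensity F f) :
    ∃ v : ℝ, 0 ≤ v ∧ ∀ t, ∀ ε > 0, ∃ δ > 0, ∀ᶠ m : ℕ in atTop,
      ∀ Q ∈ ballMassClass γ r₀ C, ∀ q, HasDensity Q q →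
        momentSize (fun x => q x - f x) ≤ ENNReal.ofReal δ →
        ‖sumChar (Q : Measure (Pt d)) c k (fun t => t) ((m : ℝ) ^ ((1 : ℝ) / d)) m
            (t / √(m : ℝ)) - ((Real.exp (-(v * t ^ 2 / 2)) : ℝ) : ℂ)‖ ≤ ε := by
  choose v δ hv0 hδ0 hv using fun n : ℕ => exists_gaussian_approx_near hd hc0 hc1 k hγ hr₀ hC hf
    hf0 hf1 hft (ε := 1 / ((n : ℝ) + 1)) (by positivity)
  have hFF : ∀ n, momentSize (fun x => f x - f x) ≤ ENNReal.ofReal (δ n) := fun n => by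
    simp [momentSize]
  obtain ⟨V, hV0, hV⟩ := exists_common_variance hv0 fun i j t => by
    obtain ⟨m, h1, h2⟩ := ((hv i t).and (hv j t)).exists
    have h1' := h1 F hF f hFf (hFF i)
    have h2' := h2 F hF f hFf (hFF j)
    rw [← Real.norm_eq_abs, ← Complex.norm_real, Complex.ofReal_sub, add_mul]
    refine (norm_sub_le_norm_sub_add_norm_sub _ _ _).trans (add_le_add ?_ h2')
    rw [norm_sub_rev]
    exact h1'
  refine ⟨V, hV0, fun t ε hε => ?_⟩
  obtain ⟨n, hn⟩ : ∃ n : ℕ, 1 / ((n : ℝ) + 1) < ε / (2 * (1 + |t| + t ^ 2)) :=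
    exists_nat_one_div_lt (by positivity)
  refine ⟨δ n, hδ0 n, (hv n t).mono fun m hm Q hQ q hq hqf => ?_⟩
  have h1 := hm Q hQ q hq hqf
  have h2 := hV n t
  rw [← Real.norm_eq_abs, ← Complex.norm_real, Complex.ofReal_sub, norm_sub_rev] at h2
  have h3 : 0 < 1 + |t| + t ^ 2 := by positivity
  rw [lt_div_iff₀ (by positivity)] at hn
  refine (norm_sub_le_norm_sub_add_norm_sub _ _ _).trans ((add_le_add h1 h2).trans ?_)
  linarith

end GaussianLimit

/-! ### Control of the densities by their Lᵖ norms, and the total length as a sum over pairs -/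

section DensityNorms

variable {d : ℕ}

/-- For `p > 2`, the norms in `L¹` and `Lᵖ` control `momentSize`. -/
lemma exists_momentSize_le_eLpNorm {p : ℝ≥0∞} (hp : 2 < p) :
    ∃ r : ℝ, 0 < r ∧ ∀ u : Pt d → ℝ, Measurable u →
      momentSize u ≤ 2 * eLpNorm u 1 volume + eLpNorm u 1 volume * eLpNorm u p volume +
        eLpNorm u p volume ^ r := by
  have hsplit : ∀ u : Pt d → ℝ, Measurable u →
      momentSize u = eLpNorm u 1 volume + ∫⁻ x, ‖u x‖ₑ ^ 2 := fun u hu => by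
    rw [momentSize, lintegral_add_left (by fun_prop), eLpNorm_one_eq_lintegral_enorm]
  rcases eq_or_ne p ∞ with rfl | hpt
  · refine ⟨1, one_pos, fun u hu => ?_⟩
    have h : ∫⁻ x, ‖u x‖ₑ ^ 2 ≤ eLpNorm u 1 volume * eLpNorm u ∞ volume := by
      rw [eLpNorm_one_eq_lintegral_enorm, ← lintegral_mul_const _ (by fun_prop)]
      refine lintegral_mono_ae ?_
      filter_upwards [ae_le_eLpNormEssSup (f := u) (μ := volume)] with x hx
      rw [sq, eLpNorm_exponent_top]
      gcongr
    rw [hsplit u hu]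
    calc eLpNorm u 1 volume + ∫⁻ x, ‖u x‖ₑ ^ 2
        ≤ eLpNorm u 1 volume + eLpNorm u 1 volume * eLpNorm u ∞ volume := by gcongr
      _ ≤ 2 * eLpNorm u 1 volume + eLpNorm u 1 volume * eLpNorm u ∞ volume := by
          gcongr; exact le_mul_of_one_le_left (zero_le) one_le_two
      _ ≤ _ := le_self_add
  · have hp2 : 2 < p.toReal := by
      have := (ENNReal.toReal_lt_toReal (by norm_num) hpt).2 hp
      simpa using this
    have hp0 : 0 < p.toReal := by linarith
    refine ⟨p.toReal, hp0, fun u hu => ?_⟩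
    have hN : eLpNorm u p volume ^ p.toReal = ∫⁻ x, ‖u x‖ₑ ^ p.toReal := by
      rw [eLpNorm_eq_lintegral_rpow_enorm_toReal (by rintro rfl; simp at hp) hpt,
        ← ENNReal.rpow_mul, one_div_mul_cancel hp0.ne', ENNReal.rpow_one]
    have h : ∫⁻ x, ‖u x‖ₑ ^ 2 ≤ eLpNorm u 1 volume + eLpNorm u p volume ^ p.toReal := by
      rw [hN, eLpNorm_one_eq_lintegral_enorm, ← lintegral_add_left (by fun_prop)]
      refine lintegral_mono fun x => ?_
      rcases le_total ‖u x‖ₑ 1 with hx | hx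
      · refine le_trans ?_ le_self_add
        rw [sq]; exact mul_le_of_le_one_left zero_le hx
      · refine le_trans ?_ le_add_self
        rw [← ENNReal.rpow_two]
        exact ENNReal.rpow_le_rpow_of_exponent_le hx hp2.le
    rw [hsplit u hu, two_mul]
    calc eLpNorm u 1 volume + ∫⁻ x, ‖u x‖ₑ ^ 2
        ≤ eLpNorm u 1 volume + (eLpNorm u 1 volume + eLpNorm u p volume ^ p.toReal) := by gcongr
      _ = eLpNorm u 1 volume + eLpNorm u 1 volume + 0 + eLpNorm u p volume ^ p.toReal := by
          ring
      _ ≤ _ := by gcongr; exact zero_le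

lemma momentSize_ne_top_of_eLpNorm {p : ℝ≥0∞} (hp : 2 < p) {u : Pt d → ℝ} (hu : Measurable u)
    (h1 : eLpNorm u 1 volume < ∞) (h2 : eLpNorm u p volume < ∞) : momentSize u ≠ ∞ := by
  obtain ⟨r, hr, h⟩ := exists_momentSize_le_eLpNorm (d := d) hp
  refine ne_top_of_le_ne_top ?_ (h u hu)
  have := ENNReal.rpow_lt_top_of_nonneg hr.le h2.ne
  finiteness

lemma exists_forall_momentSize_le {p : ℝ≥0∞} (hp : 2 < p) {δ : ℝ≥0∞} (hδ : 0 < δ) :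
    ∃ η : ℝ≥0∞, 0 < η ∧ ∀ u : Pt d → ℝ, Measurable u →
      eLpNorm u 1 volume < η → eLpNorm u p volume < η → momentSize u ≤ δ := by
  obtain ⟨r, hr, h⟩ := exists_momentSize_le_eLpNorm (d := d) hp
  have hlim : Tendsto (fun a : ℝ≥0∞ => 3 * a + a ^ r) (𝓝 0) (𝓝 0) := by
    have h1 : Tendsto (fun a : ℝ≥0∞ => 3 * a) (𝓝 0) (𝓝 (3 * 0)) :=
      ENNReal.Tendsto.const_mul tendsto_id (Or.inr (by norm_num))
    have h2 : Tendsto (fun a : ℝ≥0∞ => a ^ r) (𝓝 0) (𝓝 (0 ^ r)) :=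
      (ENNReal.continuous_rpow_const).tendsto 0
    have h3 := h1.add h2
    rwa [ENNReal.zero_rpow_of_pos hr, mul_zero, add_zero] at h3
  have hev := (hlim.eventually_le_const hδ).and (eventually_le_nhds (zero_lt_one (α := ℝ≥0∞)))
  obtain ⟨η, hη, hηδ⟩ := (ENNReal.nhds_zero_basis.eventually_iff).1 hev
  obtain ⟨a, ha0, haη⟩ := exists_between hη
  obtain ⟨h3, h4⟩ := hηδ (show a ∈ Set.Iio η from haη)
  refine ⟨a, ha0, fun u hu h1 h2 => (h u hu).trans (le_trans ?_ h3)⟩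
  calc 2 * eLpNorm u 1 volume + eLpNorm u 1 volume * eLpNorm u p volume + eLpNorm u p volume ^ r
      ≤ 2 * a + a * 1 + a ^ r := by
        gcongr
        exact h2.le.trans h4
    _ = 3 * a + a ^ r := by ring

end DensityNorms

section TotalLength

variable {d : ℕ}

/-- The parameter of `graphSum` that corresponds to a convention for the graph. -/
noncomputable def pairDiscount : GraphKind → ℝ
  | .directed => 0
  | .undirected => 1 / 2

lemma pairDiscount_nonneg (κ : GraphKind) : 0 ≤ pairDiscount κ := by
  cases κ <;> norm_num [pairDiscount]

lemma pairDiscount_le_one (κ : GraphKind) : pairDiscount κ ≤ 1 := by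
  cases κ <;> norm_num [pairDiscount]

lemma nb_univ_iff {n : ℕ} (k : ℕ) (x : Fin n → Pt d) (i j : Fin n) :
    Nb k x Finset.univ i j ↔ IsNearestNeighbor k x i j := by
  have h : {l : Fin n | l ≠ i ∧ dist (x i) (x l) < dist (x i) (x j)} =
      (closer x Finset.univ i j : Set (Fin n)) := by
    ext l; simp [closer]
  rw [IsNearestNeighbor, h, Set.ncard_coe_finset]
  simp [Nb]

/-- For the undirected graph, the sum over the ordered pairs is rearranged into one over the pairs
`i < j`, the two orientations together contributing one edge if at least one is present. -/
lemma totalLength_eq_graphSum {n : ℕ} (κ : GraphKind) (k : ℕ) (x : Fin n → Pt d) :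
    totalLength κ k x = graphSum (pairDiscount κ) k (fun t => t) x Finset.univ := by
  classical
  cases κ with
  | directed =>
    simp only [totalLength, graphSum, edgeCoef, pairDiscount, nb_univ_iff]
    refine Finset.sum_congr rfl fun i _ => Finset.sum_congr rfl fun j _ => ?_
    split_ifs <;> simp
  | undirected =>
    simp only [totalLength, graphSum, edgeCoef, pairDiscount, nb_univ_iff]
    obtain ⟨a, ha⟩ : ∃ a : Fin n → Fin n → ℝ, a = fun i j => dist (x i) (x j) *
        ((if IsNearestNeighbor k x i j then 1 else 0) -
          1 / 2 * if IsNearestNeighbor k x i j ∧ IsNearestNeighbor k x j i then 1 else 0) :=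
      ⟨_, rfl⟩
    have hsum : ∑ i, ∑ j, a i j = ∑ i, ∑ j, if i < j then a i j + a j i else 0 := by
      have h1 : ∀ i j, a i j = (if i < j then a i j else 0) + if j < i then a i j else 0 :=
        fun i j => by
          rcases lt_trichotomy i j with h | h | h
          · rw [if_pos h, if_neg h.not_gt, add_zero]
          · subst h; simp [ha]
          · rw [if_neg h.not_gt, if_pos h, zero_add]
      calc ∑ i, ∑ j, a i j
          = ∑ i, ∑ j, ((if i < j then a i j else 0) + if j < i then a i j else 0) :=
            Finset.sum_congr rfl fun i _ => Finset.sum_congr rfl fun j _ => h1 i j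
        _ = (∑ i, ∑ j, if i < j then a i j else 0) + ∑ i, ∑ j, if j < i then a i j else 0 := by
            simp only [Finset.sum_add_distrib]
        _ = (∑ i, ∑ j, if i < j then a i j else 0) + ∑ i, ∑ j, if i < j then a j i else 0 := by
            congr 1; exact Finset.sum_comm
        _ = _ := by
            simp only [← Finset.sum_add_distrib]
            refine Finset.sum_congr rfl fun i _ => Finset.sum_congr rfl fun j _ => ?_
            split_ifs <;> simp
    rw [show (∑ i, ∑ j, dist (x i) (x j) * ((if IsNearestNeighbor k x i j then 1 else 0) -
          1 / 2 * if IsNearestNeighbor k x i j ∧ IsNearestNeighbor k x j i then 1 else 0)) =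
        ∑ i, ∑ j, a i j by rw [ha], hsum]
    refine Finset.sum_congr rfl fun i _ => Finset.sum_congr rfl fun j _ => ?_
    by_cases hij : i < j
    · simp only [ha, hij, true_and, if_true, dist_comm (x j) (x i)]
      by_cases h1 : IsNearestNeighbor k x i j <;> by_cases h2 : IsNearestNeighbor k x j i <;>
        (simp [h1, h2]; try ring)
    · simp [hij]

lemma scaledLength_eq_graphSum {n : ℕ} (κ : GraphKind) (k : ℕ) (x : Fin n → Pt d) :
    scaledLength κ k x = graphSum (pairDiscount κ) k (fun t => t)
      (fun i => ((n : ℝ) ^ ((1 : ℝ) / (d : ℝ))) • x i) Finset.univ :=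
  totalLength_eq_graphSum κ k _

lemma measurable_scaledLength {n : ℕ} (κ : GraphKind) (k : ℕ) :
    Measurable (scaledLength κ k : (Fin n → Pt d) → ℝ) := by
  have h := measurable_graphSum_smul (d := d) (ι := Fin n) (c := pairDiscount κ) (k := k)
    (s := (n : ℝ) ^ ((1 : ℝ) / (d : ℝ))) (w := fun t => t) measurable_id Finset.univ
  have e : (scaledLength κ k : (Fin n → Pt d) → ℝ) = _ :=
    funext fun x => scaledLength_eq_graphSum κ k x
  rw [e]
  exact h

lemma measurable_standardizedLength (κ : GraphKind) (k m : ℕ) (Q : ProbabilityMeasure (Pt d)) :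
    Measurable (standardizedLength κ k m Q) :=
  ((measurable_scaledLength κ k).sub_const _).const_mul _

/-- The law of the standardized total length of a sample of size `m` from `Q`. -/
noncomputable def lengthLaw (κ : GraphKind) (k m : ℕ) (Q : ProbabilityMeasure (Pt d)) :
    ProbabilityMeasure ℝ :=
  ⟨(sampleLaw m Q).map (standardizedLength κ k m Q),
    Measure.isProbabilityMeasure_map (measurable_standardizedLength κ k m Q).aemeasurable⟩

lemma charFun_lengthLaw (κ : GraphKind) (k m : ℕ) (Q : ProbabilityMeasure (Pt d)) (t : ℝ) :
    charFun (lengthLaw κ k m Q : Measure ℝ) t =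
      sumChar (Q : Measure (Pt d)) (pairDiscount κ) k (fun t => t) ((m : ℝ) ^ ((1 : ℝ) / d)) m
        (t / √(m : ℝ)) := by
  rw [charFun_apply_real, lengthLaw, ProbabilityMeasure.coe_mk,
    integral_map (measurable_standardizedLength κ k m Q).aemeasurable (by fun_prop), sumChar,
    centredChar]
  simp only [← scaledLength_eq_graphSum, standardizedLength, standardize]
  refine integral_congr_ae (ae_of_all _ fun z => ?_)
  simp only
  congr 1
  push_cast
  ring

lemma integral_lengthLaw (κ : GraphKind) (k m : ℕ) (Q : ProbabilityMeasure (Pt d)) (φ : ℝ →ᵇ ℝ) :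
    ∫ y, φ y ∂(lengthLaw κ k m Q : Measure ℝ) =
      ∫ x, φ (standardizedLength κ k m Q x) ∂(sampleLaw m Q) :=
  integral_map (measurable_standardizedLength κ k m Q).aemeasurable
    φ.continuous.aestronglyMeasurable

end TotalLength

/-! ### Limit laws and the bootstrap -/

section LimitLaw

variable {d : ℕ} {κ : GraphKind} {k : ℕ} {γ r₀ : ℝ} {C : Set (Pt d)} {f : Pt d → ℝ}

/-- `N` is the limit of the law of the standardized total length, along all sequences of sample
sizes tending to infinity and of distributions in `ballMassClass` whose densities approach `f`. -/
def IsUniformLimitLaw (κ : GraphKind) (k : ℕ) (γ r₀ : ℝ) (C : Set (Pt d)) (f : Pt d → ℝ)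
    (N : ProbabilityMeasure ℝ) : Prop :=
  ∀ (m : ℕ → ℕ) (Q : ℕ → ProbabilityMeasure (Pt d)) (q : ℕ → Pt d → ℝ),
    Tendsto m atTop atTop → (∀ᶠ n in atTop, Q n ∈ ballMassClass γ r₀ C) →
    (∀ n, HasDensity (Q n) (q n)) →
    Tendsto (fun n => momentSize fun x => q n x - f x) atTop (𝓝 0) →
    Tendsto (fun n => lengthLaw κ k (m n) (Q n)) atTop (𝓝 N)

/-- The central limit theorem for the total length, with a limit that does not depend on the
sequences of sample sizes and of distributions. -/
lemma exists_isUniformLimitLaw (hd : 1 ≤ d) (κ : GraphKind) (k : ℕ) (hγ : 0 < γ) (hr₀ : 0 < r₀)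
    (hC : Bornology.IsBounded C) {F : ProbabilityMeasure (Pt d)} (hF : F ∈ ballMassClass γ r₀ C)
    (hFf : HasDensity F f) (hft : momentSize f ≠ ∞) :
    ∃ N : ProbabilityMeasure ℝ, IsUniformLimitLaw κ k γ r₀ C f N := by
  obtain ⟨hf, hf0, hFd⟩ := hFf
  have hf1 : ∫⁻ x, ENNReal.ofReal (f x) = 1 := by
    have h : (F : Measure (Pt d)) Set.univ = 1 := measure_univ
    rwa [hFd, withDensity_apply _ MeasurableSet.univ, Measure.restrict_univ] at h
  obtain ⟨v, hv0, hv⟩ := exists_gaussian_limit hd (pairDiscount_nonneg κ) (pairDiscount_le_one κ) k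
    hγ hr₀ hC hf hf0 hf1 hft hF ⟨hf, hf0, hFd⟩
  refine ⟨⟨gaussianReal 0 v.toNNReal, inferInstance⟩, fun m Q q hm hQ hq hqf => ?_⟩
  refine ProbabilityMeasure.tendsto_iff_tendsto_charFun.2 fun t => ?_
  have hN : charFun (gaussianReal 0 v.toNNReal) t = ((Real.exp (-(v * t ^ 2 / 2)) : ℝ) : ℂ) := by
    rw [charFun_gaussianReal, Complex.ofReal_exp, Real.coe_toNNReal _ hv0]
    push_cast
    congr 1
    ring
  rw [ProbabilityMeasure.coe_mk, hN, Metric.tendsto_nhds]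
  intro ε hε
  obtain ⟨δ, hδ, h⟩ := hv t (ε / 2) (half_pos hε)
  filter_upwards [hm.eventually h, hQ, hqf.eventually_le_const (ENNReal.ofReal_pos.2 hδ)]
    with n h1 h2 h3
  rw [charFun_lengthLaw, dist_eq_norm]
  exact (h1 (Q n) h2 (q n) (hq n) h3).trans_lt (half_lt_self hε)

/-- The convergence to a uniform limit law, tested against a bounded continuous function, in
terms of neighbourhoods. -/
lemma IsUniformLimitLaw.exists_forall_abs_integral_sub_lt {N : ProbabilityMeasure ℝ}
    (hN : IsUniformLimitLaw κ k γ r₀ C f N) (φ : ℝ →ᵇ ℝ) {ε : ℝ} (hε : 0 < ε) :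
    ∃ δ : ℝ≥0∞, 0 < δ ∧ ∃ m₀ : ℕ, ∀ m ≥ m₀, ∀ Q ∈ ballMassClass γ r₀ C, ∀ q, HasDensity Q q →
      momentSize (fun x => q x - f x) ≤ δ →
      |∫ y, φ y ∂(lengthLaw κ k m Q : Measure ℝ) - ∫ y, φ y ∂(N : Measure ℝ)| < ε := by
  by_contra! hcon
  choose m hm Q hQ q hq hqf hge using fun n : ℕ =>
    hcon (1 / ((n : ℝ≥0∞) + 1)) (ENNReal.div_pos one_ne_zero (by finiteness)) n
  have h1 : Tendsto (fun n : ℕ => 1 / ((n : ℝ≥0∞) + 1)) atTop (𝓝 0) := by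
    have h2 := ENNReal.tendsto_inv_nat_nhds_zero.comp (tendsto_add_atTop_nat 1)
    refine h2.congr fun n => ?_
    simp
  have h3 := hN m Q q (tendsto_atTop_mono hm tendsto_id) (Eventually.of_forall hQ) hq
    (tendsto_of_tendsto_of_tendsto_of_le_of_le tendsto_const_nhds h1 (fun _ => zero_le) hqf)
  have h4 := ProbabilityMeasure.tendsto_iff_forall_integral_tendsto.1 h3 φ
  rw [Metric.tendsto_nhds] at h4
  obtain ⟨n, hn⟩ := (h4 ε hε).exists
  exact (hge n).not_gt hn

lemma tendstoInDistribution_standardizedLength_iff (m : ℕ → ℕ) (Q : ℕ → ProbabilityMeasure (Pt d))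
    (G : ProbabilityMeasure ℝ) :
    TendstoInDistribution (fun n => standardizedLength κ k (m n) (Q n)) atTop (id : ℝ → ℝ)
      (fun n => sampleLaw (m n) (Q n)) (G : Measure ℝ) ↔
      Tendsto (fun n => lengthLaw κ k (m n) (Q n)) atTop (𝓝 G) := by
  have hG : (⟨(G : Measure ℝ).map id, Measure.isProbabilityMeasure_map aemeasurable_id⟩ :
      ProbabilityMeasure ℝ) = G := Subtype.ext Measure.map_id
  constructor
  · intro h
    have h1 := h.tendsto
    rwa [hG] at h1
  · intro h
    refine ⟨fun n => (measurable_standardizedLength κ k _ _).aemeasurable, aemeasurable_id, ?_⟩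
    rw [hG]
    exact h

variable {Ω : Type*} [MeasurableSpace Ω] {P : Measure Ω}

/-- Under the hypotheses in probability on the estimators, the bootstrap statistic converges in
probability to the uniform limit law. -/
lemma IsUniformLimitLaw.bootstrapTendstoInProbability {N : ProbabilityMeasure ℝ}
    (hN : IsUniformLimitLaw κ k γ r₀ C f N) {p : ℝ≥0∞} (hp : 2 < p) (hf : Measurable f)
    {Q : ℕ → Ω → ProbabilityMeasure (Pt d)} {q : ℕ → Ω → Pt d → ℝ}
    (hq : ∀ n ω, HasDensity (Q n ω) (q n ω)) {m : ℕ → ℕ} (hm : Tendsto m atTop atTop)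
    (hnorm : ∀ a ∈ ({1, p} : Set ℝ≥0∞), ∀ ε : ℝ≥0∞, 0 < ε → Tendsto
      (fun n => P {ω | ε ≤ eLpNorm (fun y => q n ω y - f y) a volume}) atTop (𝓝 0))
    (hclass : TendstoInMeasure P
      (fun n ω => (ballMassClass γ r₀ C).indicator (fun _ => (1 : ℝ)) (Q n ω)) atTop
      (fun _ => 1)) :
    BootstrapTendstoInProbability P κ k m Q N := by
  intro φ
  rw [tendstoInMeasure_iff_dist]
  intro ε hε
  obtain ⟨δ, hδ, m₀, h⟩ := hN.exists_forall_abs_integral_sub_lt φ hε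
  obtain ⟨η, hη, hηδ⟩ := exists_forall_momentSize_le (d := d) hp hδ
  have h1 := hnorm 1 (by simp) η hη
  have h2 := hnorm p (by simp) η hη
  have h3 := tendstoInMeasure_iff_dist.1 hclass 1 one_pos
  have h4 := (h1.add h2).add h3
  rw [add_zero, add_zero] at h4
  refine tendsto_of_tendsto_of_tendsto_of_le_of_le' tendsto_const_nhds h4
    (Eventually.of_forall fun _ => zero_le) ?_
  filter_upwards [hm.eventually_ge_atTop m₀] with n hn
  refine (measure_mono ?_).trans ((measure_union_le _ _).trans
    (add_le_add_left (measure_union_le _ _) _))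
  intro ω hω
  by_contra hcon
  simp only [Set.mem_union, Set.mem_ofPred_eq, not_or, not_le] at hcon
  obtain ⟨⟨g1, g2⟩, g3⟩ := hcon
  have hQ : Q n ω ∈ ballMassClass γ r₀ C := by
    by_contra hQ
    rw [Set.indicator_of_notMem hQ] at g3
    norm_num at g3
  have g4 := h (m n) hn (Q n ω) hQ (q n ω) (hq n ω)
    (hηδ (fun y => q n ω y - f y) ((hq n ω).1.sub hf) g1 g2)
  rw [integral_lengthLaw] at g4
  rw [Set.mem_ofPred_eq, Real.dist_eq] at hω
  exact hω.not_gt g4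

/-- Under the almost sure hypotheses on the estimators, the conditional law of the bootstrap
statistic converges almost surely to the uniform limit law. -/
lemma IsUniformLimitLaw.ae_tendsto_lengthLaw {N : ProbabilityMeasure ℝ}
    (hN : IsUniformLimitLaw κ k γ r₀ C f N) {p : ℝ≥0∞} (hp : 2 < p) (hf : Measurable f)
    {Q : ℕ → Ω → ProbabilityMeasure (Pt d)} {q : ℕ → Ω → Pt d → ℝ}
    (hq : ∀ n ω, HasDensity (Q n ω) (q n ω)) {m : ℕ → ℕ} (hm : Tendsto m atTop atTop)
    (hnorm : ∀ a ∈ ({1, p} : Set ℝ≥0∞), ∀ᵐ ω ∂P, Tendsto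
      (fun n => eLpNorm (fun y => q n ω y - f y) a volume) atTop (𝓝 0))
    (hclass : ∀ᵐ ω ∂P, Tendsto
      (fun n => (ballMassClass γ r₀ C).indicator (fun _ => (1 : ℝ)) (Q n ω)) atTop (𝓝 1)) :
    ∀ᵐ ω ∂P, Tendsto (fun n => lengthLaw κ k (m n) (Q n ω)) atTop (𝓝 N) := by
  filter_upwards [hnorm 1 (by simp), hnorm p (by simp), hclass] with ω h1 h2 h3
  refine hN m (fun n => Q n ω) (fun n => q n ω) hm ?_ (fun n => hq n ω) ?_
  · filter_upwards [h3.eventually_const_lt one_half_lt_one] with n hn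
    by_contra hQ
    rw [Set.indicator_of_notMem hQ] at hn
    norm_num at hn
  · refine ENNReal.tendsto_nhds_zero.2 fun δ hδ => ?_
    obtain ⟨η, hη, hηδ⟩ := exists_forall_momentSize_le (d := d) hp hδ
    filter_upwards [h1.eventually_lt_const hη, h2.eventually_lt_const hη] with n g1 g2
    exact hηδ _ ((hq n ω).1.sub hf) g1 g2

variable [IsProbabilityMeasure P]

/-- Convergence in distribution of the standardized total length of a random sample, in terms of
the law of the sample. -/
lemma tendstoInDistribution_standardize_iff {X : ℕ → Ω → Pt d} (hX : ∀ i, Measurable (X i))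
    (hXind : iIndepFun X P) {F : ProbabilityMeasure (Pt d)}
    (hXlaw : ∀ i, P.map (X i) = (F : Measure (Pt d))) (G : ProbabilityMeasure ℝ) :
    TendstoInDistribution
        (fun n => standardize P n (fun ω => scaledLength κ k (fun i : Fin n => X i ω)))
        atTop (id : ℝ → ℝ) (fun _ => P) (G : Measure ℝ) ↔
      Tendsto (fun n => lengthLaw κ k n F) atTop (𝓝 G) := by
  have hG : (⟨(G : Measure ℝ).map id, Measure.isProbabilityMeasure_map aemeasurable_id⟩ :
      ProbabilityMeasure ℝ) = G := Subtype.ext Measure.map_id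
  have hXn : ∀ n, Measurable fun ω => fun i : Fin n => X i ω := fun n =>
    measurable_pi_lambda _ fun i => hX i
  have hlaw : ∀ n : ℕ, P.map (fun ω => fun i : Fin n => X i ω) = sampleLaw n F := fun n => by
    have h := iIndepFun.map_fun_eq_pi_map (f := fun i : Fin n => X i)
      (fun i => (hX i).aemeasurable) (hXind.precomp Fin.val_injective)
    simp only [hXlaw] at h
    exact h
  have hst : ∀ n, standardize P n (fun ω => scaledLength κ k (fun i : Fin n => X i ω)) =
      standardizedLength κ k n F ∘ fun ω => fun i : Fin n => X i ω := fun n => by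
    funext ω
    simp only [standardize, standardizedLength, Function.comp_apply, ← hlaw n]
    rw [integral_map (hXn n).aemeasurable (measurable_scaledLength κ k).aestronglyMeasurable]
  have hmeas : ∀ n, AEMeasurable
      (standardize P n (fun ω => scaledLength κ k (fun i : Fin n => X i ω))) P := fun n => by
    rw [hst]
    exact ((measurable_standardizedLength κ k n F).comp (hXn n)).aemeasurable
  have hL : ∀ n, (⟨P.map (standardize P n (fun ω => scaledLength κ k (fun i : Fin n => X i ω))),
      Measure.isProbabilityMeasure_map (hmeas n)⟩ : ProbabilityMeasure ℝ) = lengthLaw κ k n F :=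
    fun n => Subtype.ext (by
      simp only [lengthLaw]
      rw [hst, ← Measure.map_map (measurable_standardizedLength κ k n F) (hXn n), hlaw])
  constructor
  · intro h
    have h1 := h.tendsto
    rw [hG] at h1
    exact h1.congr fun n => hL n
  · intro h
    refine ⟨hmeas, aemeasurable_id, ?_⟩
    rw [hG]
    exact h.congr fun n => (hL n).symm

lemma tendstoInMeasure_const_iff_eq {φ : ℕ → Ω → ℝ} {a b : ℝ}
    (ha : TendstoInMeasure P φ atTop fun _ => a) :
    TendstoInMeasure P φ atTop (fun _ => b) ↔ a = b := by
  refine ⟨fun hb => ?_, fun h => h ▸ ha⟩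
  obtain ⟨ω, hω⟩ := (tendstoInMeasure_ae_unique ha hb).exists
  exact hω

end LimitLaw

end KnnBootstrap

open KnnBootstrap in
theorem corollary4p6 {d : ℕ} (hd : 1 ≤ d) (κ : GraphKind) (k : ℕ)
    (p : ℝ≥0∞) (hp : 2 < p)
    (γ r₀ : ℝ) (hγ : 0 < γ) (hr₀ : 0 < r₀)
    (C : Set (Pt d)) (hC : Bornology.IsBounded C)
    -- the sampling distribution `F` and its density `f`
    (F : ProbabilityMeasure (Pt d)) (f : Pt d → ℝ) (hf : HasDensity F f)
    (hfp : eLpNorm f p volume < ∞) (hF : F ∈ ballMassClass γ r₀ C)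
    -- the i.i.d. sample
    {Ω : Type*} [MeasurableSpace Ω] (P : Measure Ω) [IsProbabilityMeasure P]
    (X : ℕ → Ω → Pt d) (hX : ∀ i, Measurable (X i)) (hXind : iIndepFun X P)
    (hXlaw : ∀ i, P.map (X i) = (F : Measure (Pt d)))
    -- the estimators `Fhat n` of `F` and `fhat n` of `f`, functions of the sample of size `n`
    (Fhat : (n : ℕ) → (Fin n → Pt d) → ProbabilityMeasure (Pt d))
    (fhat : (n : ℕ) → (Fin n → Pt d) → Pt d → ℝ)
    (hfhat : ∀ n s, HasDensity (Fhat n s) (fhat n s))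
    (hfhat_meas : ∀ n, Measurable (fun q : (Fin n → Pt d) × Pt d => fhat n q.1 q.2))
    -- the bootstrap sample sizes and the limit distribution
    (m : ℕ → ℕ) (hm : Tendsto m atTop atTop) (G : ProbabilityMeasure ℝ) :
    -- version in probability
    ((∀ q ∈ ({1, p} : Set ℝ≥0∞), ∀ ε : ℝ≥0∞, 0 < ε → Tendsto
          (fun n => P {ω | ε ≤
            eLpNorm (fun y => fhat n (fun i : Fin n => X i ω) y - f y) q volume})
          atTop (𝓝 0)) →
      TendstoInMeasure P
          (fun n ω => (ballMassClass γ r₀ C).indicator (fun _ => (1 : ℝ))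
            (Fhat n (fun i : Fin n => X i ω)))
          atTop (fun _ => 1) →
      (TendstoInDistribution
          (fun n => standardize P n (fun ω => scaledLength κ k (fun i : Fin n => X i ω)))
          atTop (id : ℝ → ℝ) (fun _ => P) (G : Measure ℝ) ↔
        BootstrapTendstoInProbability P κ k m (fun n ω => Fhat n (fun i : Fin n => X i ω)) G)) ∧
    -- almost sure version
    ((∀ q ∈ ({1, p} : Set ℝ≥0∞), ∀ᵐ ω ∂P, Tendsto
          (fun n => eLpNorm (fun y => fhat n (fun i : Fin n => X i ω) y - f y) q volume)
          atTop (𝓝 0)) →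
      (∀ᵐ ω ∂P, Tendsto
          (fun n => (ballMassClass γ r₀ C).indicator (fun _ => (1 : ℝ))
            (Fhat n (fun i : Fin n => X i ω)))
          atTop (𝓝 1)) →
      (TendstoInDistribution
          (fun n => standardize P n (fun ω => scaledLength κ k (fun i : Fin n => X i ω)))
          atTop (id : ℝ → ℝ) (fun _ => P) (G : Measure ℝ) ↔
        BootstrapTendstoAlmostSurely P κ k m (fun n ω => Fhat n (fun i : Fin n => X i ω)) G)) := by
  have hf1 : eLpNorm f 1 volume < ∞ := by
    have h : (F : Measure (Pt d)) Set.univ = 1 := measure_univ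
    rw [hf.2.2, withDensity_apply _ MeasurableSet.univ, Measure.restrict_univ] at h
    rw [eLpNorm_one_eq_lintegral_enorm]
    simp_rw [← ofReal_norm, Real.norm_of_nonneg (hf.2.1 _)]
    rw [h]
    exact ENNReal.one_lt_top
  obtain ⟨N, hN⟩ := exists_isUniformLimitLaw hd κ k hγ hr₀ hC hF hf
    (momentSize_ne_top_of_eLpNorm hp hf.1 hf1 hfp)
  -- Both sides of either equivalence say that `G` is the limit law `N`.
  have hFN : Tendsto (fun n => lengthLaw κ k n F) atTop (𝓝 N) :=
    hN id (fun _ => F) (fun _ => f) tendsto_id (Eventually.of_forall fun _ => hF) (fun _ => hf)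
      (by simp [momentSize])
  rw [tendstoInDistribution_standardize_iff hX hXind hXlaw,
    show Tendsto (fun n => lengthLaw κ k n F) atTop (𝓝 G) ↔ N = G from
      ⟨fun h => tendsto_nhds_unique hFN h, fun h => h ▸ hFN⟩]
  refine ⟨fun h1 h2 => ?_, fun h1 h2 => ?_⟩
  · have hB := hN.bootstrapTendstoInProbability hp hf.1
      (Q := fun n ω => Fhat n (fun i : Fin n => X i ω))
      (q := fun n ω => fhat n (fun i : Fin n => X i ω)) (fun n ω => hfhat n _) hm h1 h2
    refine ⟨fun h => h ▸ hB, fun h => ?_⟩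
    have hNG : (N : Measure ℝ) = G := ext_of_forall_integral_eq_of_IsFiniteMeasure fun φ =>
      (tendstoInMeasure_const_iff_eq (hB φ)).1 (h φ)
    exact Subtype.ext hNG
  · have hB := hN.ae_tendsto_lengthLaw (P := P) hp hf.1
      (Q := fun n ω => Fhat n (fun i : Fin n => X i ω))
      (q := fun n ω => fhat n (fun i : Fin n => X i ω)) (fun n ω => hfhat n _) hm h1 h2
    simp only [BootstrapTendstoAlmostSurely, tendstoInDistribution_standardizedLength_iff]
    refine ⟨fun h => h ▸ hB, fun h => ?_⟩
    obtain ⟨ω, h3, h4⟩ := (hB.and h).exists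
    exact tendsto_nhds_unique h3 h4
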